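/- Let $A$ and $B$ be associative unital algebras over a commutative ring $k$ (one may take $k=\mathbb Z$; the base ring plays no role). Let $\mathfrak C$ be an $A$-coring and $\mathfrak D$ a $B$-coring, and assume that ${}_A\mathfrak C$ and ${}_B\mathfrak D$ are flat. Let $X$ be a $\mathfrak C$-$\mathfrak D$-bicomodule and $\Lambda$ a $\mathfrak D$-$\mathfrak C$-bicomodule. For a right $\mathfrak C$-comodule $M$ and a left $\mathfrak C$-comodule $N$ put $\omega_{M,N}=\rho_M\otimes_A N-M\otimes_A\lambda_N: M\otimes_A N\to M\otimes_A\mathfrak C\otimes_A N$ and $M\square_{\mathfrak C}N=\ker\omega_{M,N}$, and similarly over $\mathfrak D$. Let $\mathcal M^{\mathfrak C}$, $\mathcal M^{\mathfrak D}$ be the categories of right comodules. We say that $(-\square_{\mathfrak C}X,\,-\square_{\mathfrak D}\Lambda)$ is a pair of inverse equivalences if the functors $S=-\square_{\mathfrak C}X:\mathcal M^{\mathfrak C}\to\mathcal M^{\mathfrak D}$ and $T=-\square_{\mathfrak D}\Lambda:\mathcal M^{\mathfrak D}\to\mathcal M^{\mathfrak C}$ satisfy $TS\cong 1$ and $ST\cong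 1$ naturally. A left comodule $N$ over $\mathfrak C$ (resp. $\mathfrak D$) is coflat if $-\square N$ is exact on right comodules. A map of left $A$-modules is pure if its kernel is preserved by $W\otimes_A-$ for every right $A$-module $W$; similarly over $B$. A coring is coseparable if its comultiplication is a section in the category of bicomodules over it. (I) Suppose in addition that $\mathfrak C_A$ and $\mathfrak D_B$ are flat. The following are equivalent: (1) $(-\square_{\mathfrak C}X,\,-\square_{\mathfrak D}\Lambda)$ is a pair of inverse equivalences; (2) there exist bicomodule isomorphisms $f:X\square_{\mathfrak D}\Lambda\to\mathfrak C$ and $g:\Lambda\square_{\mathfrak C}X\to\mathfrak D$, and at least one of the following holds: (a) ${}_AX$ and ${}_B\Lambda$ are flat, $\omega_{X,\Lambda}$ is pure as a map of left $A$-modules and $\omega_{\Lambda,X}$ is pure as a map of left $B$-modules; (b) ${}_{\mathfrak C}X$ and ${}_{\mathfrak D}\Lambda$ are coflat. In such a case the isomorphisms $f$ and $g$ can be chosen so that the following two diagrams commute: the two maps $\Lambda\square_{\mathfrak C}X\square_{\mathfrak D}\Lambda\xrightarrow{\Lambda\square f}\Lambda\square_{\mathfrak C}\mathfrak C\cong\Lambda$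 and $\Lambda\square_{\mathfrak C}X\square_{\mathfrak D}\Lambda\xrightarrow{g\square\Lambda}\mathfrak D\square_{\mathfrak D}\Lambda\cong\Lambda$ are equal, and the two maps $X\square_{\mathfrak D}\Lambda\square_{\mathfrak C}X\xrightarrow{f\square X}\mathfrak C\square_{\mathfrak C}X\cong X$ and $X\square_{\mathfrak D}\Lambda\square_{\mathfrak C}X\xrightarrow{X\square g}X\square_{\mathfrak D}\mathfrak D\cong X$ are equal. Here $(\Lambda\square_{\mathfrak C}X)\square_{\mathfrak D}\Lambda$ and $\Lambda\square_{\mathfrak C}(X\square_{\mathfrak D}\Lambda)$ are identified inside $\Lambda\otimes_A X\otimes_B\Lambda$ (that they are canonically isomorphic is part of the claim), and likewise for $X\square_{\mathfrak D}\Lambda\square_{\mathfrak C}X$. If moreover $A$ and $B$ are von Neumann regular rings, then (1) holds if and only if bicomodule isomorphisms $f$ and $g$ as in (2) exist (conditions (a), (b) can be deleted). (II) Suppose, instead of the flatness of $\mathfrak C_A$ and $\mathfrak D_B$, that $\mathfrak C$ and $\mathfrak D$ are coseparable. Then (1) holds if and only if there exist bicomodule isomorphisms $f:X\square_{\mathfrak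 D}\Lambda\to\mathfrak C$ and $g:\Lambda\square_{\mathfrak C}X\to\mathfrak D$; and in such a case $f$ and $g$ can be chosen so that the two diagrams above commute. -/

import Mathlib

open CategoryTheory
open scoped TensorProduct

namespace CoringTheory

universe u v w

attribute [-instance] CategoryTheory.catToReflQuiver

/-! ### Tensor products over a noncommutative ring

A right `A`-module is a `Module Aᵐᵒᵖ`. -/

section Tens

variable (A : Type*) [Ring A] (M N : Type*) [AddCommGroup M] [Module Aᵐᵒᵖ M]
  [AddCommGroup N] [Module A N]

/-- The subgroup of `M ⊗ℤ N` generated by all `ma ⊗ n - m ⊗ an`. -/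
def balancer : AddSubgroup (M ⊗[ℤ] N) :=
  AddSubgroup.closure
    {t | ∃ (m : M) (a : A) (n : N),
      t = (MulOpposite.op a • m) ⊗ₜ[ℤ] n - m ⊗ₜ[ℤ] (a • n)}

/-- The tensor product `M ⊗_A N` of a right `A`-module and a left `A`-module. -/
def Tens : Type _ := (M ⊗[ℤ] N) ⧸ balancer A M N

instance : AddCommGroup (Tens A M N) :=
  inferInstanceAs (AddCommGroup ((M ⊗[ℤ] N) ⧸ balancer A M N))

end Tens

namespace Tens

section basic

variable {A : Type*} [Ring A] {M N : Type*} [AddCommGroup M] [Module Aᵐᵒᵖ M]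
  [AddCommGroup N] [Module A N] {P : Type*} [AddCommGroup P]

/-- The projection `M ⊗ℤ N → M ⊗_A N`. -/
def proj : M ⊗[ℤ] N →+ Tens A M N := QuotientAddGroup.mk' (balancer A M N)

/-- The pure tensor `m ⊗_A n`. -/
def mk (m : M) (n : N) : Tens A M N := proj (m ⊗ₜ[ℤ] n)

theorem mk_add_left (m m' : M) (n : N) :
    (mk (m + m') n : Tens A M N) = mk m n + mk m' n := by
  simp only [mk, TensorProduct.add_tmul, map_add]

theorem mk_add_right (m : M) (n n' : N) :
    (mk m (n + n') : Tens A M N) = mk m n + mk m n' := by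
  simp only [mk, TensorProduct.tmul_add, map_add]

theorem mk_smul (a : A) (m : M) (n : N) :
    (mk (MulOpposite.op a • m) n : Tens A M N) = mk m (a • n) := by
  refine (QuotientAddGroup.eq_iff_sub_mem).2 ?_
  exact AddSubgroup.subset_closure ⟨m, a, n, rfl⟩

/-- The biadditive map `(m, n) ↦ m ⊗_A n`. -/
def mkHom : M →+ N →+ Tens A M N :=
  AddMonoidHom.mk' (fun m => AddMonoidHom.mk' (fun n => mk m n) (mk_add_right m))
    (fun m m' => by ext n; exact mk_add_left m m' n)

@[simp] theorem mk_zero_left (n : N) : (mk (0 : M) n : Tens A M N) = 0 := by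
  simp [mk]

@[simp] theorem mk_zero_right (m : M) : (mk m (0 : N) : Tens A M N) = 0 := by
  simp [mk]

@[simp] theorem mkHom_apply (m : M) (n : N) : mkHom m n = (mk m n : Tens A M N) := rfl

@[elab_as_elim]
theorem induction {p : Tens A M N → Prop} (t : Tens A M N) (h0 : p 0)
    (hmk : ∀ m n, p (mk m n)) (hadd : ∀ s t, p s → p t → p (s + t)) : p t := by
  obtain ⟨t, rfl⟩ : ∃ t', proj (A := A) t' = t := QuotientAddGroup.mk'_surjective _ t
  induction t using TensorProduct.induction_on with
  | zero => rwa [map_zero]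
  | tmul m n => exact hmk m n
  | add s t hs ht => rw [map_add]; exact hadd _ _ hs ht

theorem hom_ext {f g : Tens A M N →+ P} (h : ∀ m n, f (mk m n) = g (mk m n)) : f = g := by
  ext t
  induction t using Tens.induction with
  | h0 => simp
  | hmk m n => exact h m n
  | hadd s t hs ht => simp [hs, ht]

/-- The universal property: balanced biadditive maps factor through `M ⊗_A N`. -/
def lift (φ : M →+ N →+ P) (h : ∀ (m : M) (a : A) (n : N),
    φ (MulOpposite.op a • m) n = φ m (a • n)) : Tens A M N →+ P :=
  QuotientAddGroup.lift (balancer A M N)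
    (TensorProduct.liftAddHom (R := ℤ) φ (fun r m n => by simp)) (by
      rw [balancer, AddSubgroup.closure_le]
      rintro _ ⟨m, a, n, rfl⟩
      simp [h])

@[simp] theorem lift_mk (φ : M →+ N →+ P) (h) (m : M) (n : N) :
    lift (A := A) φ h (mk m n) = φ m n := rfl

end basic

section map

variable {A : Type*} [Ring A] {M M' M'' N N' N'' : Type*}
  [AddCommGroup M] [Module Aᵐᵒᵖ M] [AddCommGroup M'] [Module Aᵐᵒᵖ M']
  [AddCommGroup M''] [Module Aᵐᵒᵖ M'']
  [AddCommGroup N] [Module A N] [AddCommGroup N'] [Module A N']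
  [AddCommGroup N''] [Module A N'']

/-- `f ⊗_A g : M ⊗_A N → M' ⊗_A N'`. -/
def map (f : M →ₗ[Aᵐᵒᵖ] M') (g : N →ₗ[A] N') : Tens A M N →+ Tens A M' N' :=
  lift ((AddMonoidHom.compHom.flip g.toAddMonoidHom).comp (mkHom.comp f.toAddMonoidHom))
    (by intro m a n; simp [mk_smul])

@[simp] theorem map_mk (f : M →ₗ[Aᵐᵒᵖ] M') (g : N →ₗ[A] N') (m : M) (n : N) :
    map f g (mk m n) = mk (f m) (g n) := by
  simp [map]

theorem map_map (f : M →ₗ[Aᵐᵒᵖ] M') (g : N →ₗ[A] N') (f' : M' →ₗ[Aᵐᵒᵖ] M'')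
    (g' : N' →ₗ[A] N'') (t : Tens A M N) :
    map f' g' (map f g t) = map (f'.comp f) (g'.comp g) t :=
  DFunLike.congr_fun (f := (map f' g').comp (map f g)) (hom_ext (by simp)) t

end map

section action

variable {A S : Type*} [Ring A] [Ring S] {M N : Type*} [AddCommGroup M] [Module Aᵐᵒᵖ M]
  [AddCommGroup N] [Module A N]

/-- The left `S`-action `s(m ⊗ n) = sm ⊗ n` when `M` is an `(S, A)`-bimodule. -/
@[reducible] def leftModule [Module S M] [SMulCommClass S Aᵐᵒᵖ M] :
    Module S (Tens A M N) :=
  { smul := fun s t => map (N := N) (DistribSMul.toLinearMap Aᵐᵒᵖ M s) (.id : N →ₗ[A] N) t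
    one_smul := fun t => DFunLike.congr_fun
      (f := map (N := N) (DistribSMul.toLinearMap Aᵐᵒᵖ M 1) (.id : N →ₗ[A] N)) (g := AddMonoidHom.id _) (hom_ext (by simp)) t
    mul_smul := fun s s' t => DFunLike.congr_fun
      (f := map (N := N) (DistribSMul.toLinearMap Aᵐᵒᵖ M (s * s')) (.id : N →ₗ[A] N))
      (g := (map (N := N) (DistribSMul.toLinearMap Aᵐᵒᵖ M s) (.id : N →ₗ[A] N)).comp
        (map (N := N) (DistribSMul.toLinearMap Aᵐᵒᵖ M s') (.id : N →ₗ[A] N)))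
      (hom_ext (by simp [mul_smul])) t
    smul_zero := fun s => map_zero _
    smul_add := fun s => map_add _
    zero_smul := fun t => DFunLike.congr_fun
      (f := map (N := N) (DistribSMul.toLinearMap Aᵐᵒᵖ M 0) (.id : N →ₗ[A] N)) (g := 0) (hom_ext (by simp)) t
    add_smul := fun s s' t => DFunLike.congr_fun
      (f := map (N := N) (DistribSMul.toLinearMap Aᵐᵒᵖ M (s + s')) (.id : N →ₗ[A] N))
      (g := map (N := N) (DistribSMul.toLinearMap Aᵐᵒᵖ M s) (.id : N →ₗ[A] N) +
        map (N := N) (DistribSMul.toLinearMap Aᵐᵒᵖ M s') (.id : N →ₗ[A] N))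
      (hom_ext (by simp [add_smul, mk_add_left])) t }

/-- The right `S`-action `(m ⊗ n)s = m ⊗ ns` when `N` is an `(A, S)`-bimodule. -/
@[reducible] def rightModule [Module Sᵐᵒᵖ N] [SMulCommClass A Sᵐᵒᵖ N] :
    Module Sᵐᵒᵖ (Tens A M N) :=
  haveI : SMulCommClass Sᵐᵒᵖ A N := SMulCommClass.symm _ _ _
  { smul := fun s t => map (M := M) (.id : M →ₗ[Aᵐᵒᵖ] M) (DistribSMul.toLinearMap A N (s : Sᵐᵒᵖ)) t
    one_smul := fun t => DFunLike.congr_fun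
      (f := map (M := M) (.id : M →ₗ[Aᵐᵒᵖ] M) (DistribSMul.toLinearMap A N (1 : Sᵐᵒᵖ))) (g := AddMonoidHom.id _) (hom_ext (by simp)) t
    mul_smul := fun s s' t => DFunLike.congr_fun
      (f := map (M := M) (.id : M →ₗ[Aᵐᵒᵖ] M) (DistribSMul.toLinearMap A N ((s * s') : Sᵐᵒᵖ)))
      (g := (map (M := M) (.id : M →ₗ[Aᵐᵒᵖ] M) (DistribSMul.toLinearMap A N (s : Sᵐᵒᵖ))).comp
        (map (M := M) (.id : M →ₗ[Aᵐᵒᵖ] M) (DistribSMul.toLinearMap A N (s' : Sᵐᵒᵖ))))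
      (hom_ext (by simp [mul_smul])) t
    smul_zero := fun s => map_zero _
    smul_add := fun s => map_add _
    zero_smul := fun t => DFunLike.congr_fun
      (f := map (M := M) (.id : M →ₗ[Aᵐᵒᵖ] M) (DistribSMul.toLinearMap A N (0 : Sᵐᵒᵖ))) (g := 0) (hom_ext (by simp)) t
    add_smul := fun s s' t => DFunLike.congr_fun
      (f := map (M := M) (.id : M →ₗ[Aᵐᵒᵖ] M) (DistribSMul.toLinearMap A N ((s + s') : Sᵐᵒᵖ)))
      (g := map (M := M) (.id : M →ₗ[Aᵐᵒᵖ] M) (DistribSMul.toLinearMap A N (s : Sᵐᵒᵖ)) +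
        map (M := M) (.id : M →ₗ[Aᵐᵒᵖ] M) (DistribSMul.toLinearMap A N (s' : Sᵐᵒᵖ)))
      (hom_ext (by simp [add_smul, mk_add_right])) t }

end action

end Tens

/-! ### Bimodules -/

/-- `(S, T)`-bimodules. A right `T`-module is the same thing as a `(ℤ, T)`-bimodule. -/
structure BiMod (S : Type v) (T : Type w) [Ring S] [Ring T] where
  carrier : Type u
  [grp : AddCommGroup carrier]
  [left : Module S carrier]
  [right : Module Tᵐᵒᵖ carrier]
  [comm : SMulCommClass S Tᵐᵒᵖ carrier]

namespace BiMod

attribute [instance] grp left right comm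

variable {S : Type*} {T : Type*} {A B : Type*} [Ring S] [Ring T] [Ring A] [Ring B]

/-- Bimodule maps. -/
@[ext]
structure Hom (M N : BiMod.{u} S T) where
  fn : M.carrier →+ N.carrier
  map_lsmul : ∀ (s : S) (m : M.carrier), fn (s • m) = s • fn m
  map_rsmul : ∀ (t : Tᵐᵒᵖ) (m : M.carrier), fn (t • m) = t • fn m

instance : Category (BiMod.{u} S T) where
  Hom := Hom
  id M := ⟨AddMonoidHom.id _, fun _ _ => rfl, fun _ _ => rfl⟩
  comp f g := ⟨g.fn.comp f.fn, fun s m => by simp [f.map_lsmul, g.map_lsmul],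
    fun t m => by simp [f.map_rsmul, g.map_rsmul]⟩

@[ext]
theorem hom_ext {M N : BiMod.{u} S T} {f g : M ⟶ N} (h : ∀ m, f.fn m = g.fn m) : f = g :=
  Hom.ext (AddMonoidHom.ext h)

@[simp] theorem id_fn (M : BiMod.{u} S T) (m : M.carrier) : Hom.fn (𝟙 M) m = m := rfl

@[simp] theorem comp_fn {M N P : BiMod.{u} S T} (f : M ⟶ N) (g : N ⟶ P) (m : M.carrier) :
    (f ≫ g).fn m = g.fn (f.fn m) := rfl

/-- The underlying left linear map. -/
def Hom.l {M N : BiMod.{u} S T} (f : M ⟶ N) : M.carrier →ₗ[S] N.carrier :=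
  { f.fn with map_smul' := f.map_lsmul }

/-- The underlying right linear map. -/
def Hom.r {M N : BiMod.{u} S T} (f : M ⟶ N) : M.carrier →ₗ[Tᵐᵒᵖ] N.carrier :=
  { f.fn with map_smul' := f.map_rsmul }

@[simp] theorem l_apply {M N : BiMod.{u} S T} (f : M ⟶ N) (m : M.carrier) :
    Hom.l f m = f.fn m := rfl

@[simp] theorem r_apply {M N : BiMod.{u} S T} (f : M ⟶ N) (m : M.carrier) :
    Hom.r f m = f.fn m := rfl

instance {M N : BiMod.{u} S T} : Zero (M ⟶ N) :=
  ⟨⟨0, fun _ _ => by simp, fun _ _ => by simp⟩⟩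

instance {M N : BiMod.{u} S T} : Sub (M ⟶ N) :=
  ⟨fun f g => ⟨f.fn - g.fn, fun s m => by simp [f.map_lsmul, g.map_lsmul, smul_sub],
    fun s m => by simp [f.map_rsmul, g.map_rsmul, smul_sub]⟩⟩

@[simp] theorem zero_fn {M N : BiMod.{u} S T} (m : M.carrier) :
    Hom.fn (0 : M ⟶ N) m = 0 := rfl

@[simp] theorem sub_fn {M N : BiMod.{u} S T} (f g : M ⟶ N) (m : M.carrier) :
    (f - g).fn m = f.fn m - g.fn m := rfl

/-- `A` as an `(A, A)`-bimodule. -/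
def unit (A : Type u) [Ring A] : BiMod.{u} A A where
  carrier := A

/-- `M ⊗_A N` as an `(S, T)`-bimodule. -/
def tensor (M : BiMod.{u} S A) (N : BiMod.{u} A T) : BiMod.{u} S T :=
  letI : Module S (Tens A M.carrier N.carrier) := Tens.leftModule
  letI : Module Tᵐᵒᵖ (Tens A M.carrier N.carrier) := Tens.rightModule
  { carrier := Tens A M.carrier N.carrier
    comm := ⟨fun s t x => by
      have : SMulCommClass Tᵐᵒᵖ A N.carrier := SMulCommClass.symm _ _ _
      change Tens.map _ _ (Tens.map _ _ x) = Tens.map _ _ (Tens.map _ _ x)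
      simp only [Tens.map_map, LinearMap.comp_id, LinearMap.id_comp]⟩ }

infixl:70 " ⊠ " => BiMod.tensor

/-- The pure tensor `m ⊗ n`, as an element of the bimodule `M ⊗_A N`. -/
def tmk {M : BiMod.{u} S A} {N : BiMod.{u} A T} (m : M.carrier) (n : N.carrier) :
    (M ⊠ N).carrier := Tens.mk m n

section tmk

variable {M : BiMod.{u} S A} {N : BiMod.{u} A T}

theorem lsmul_tmk (s : S) (m : M.carrier) (n : N.carrier) :
    s • (tmk m n : (M ⊠ N).carrier) = tmk (s • m) n := rfl

theorem rsmul_tmk (t : Tᵐᵒᵖ) (m : M.carrier) (n : N.carrier) :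
    t • (tmk m n : (M ⊠ N).carrier) = tmk m (t • n) := rfl

theorem tmk_smul (a : A) (m : M.carrier) (n : N.carrier) :
    (tmk (MulOpposite.op a • m) n : (M ⊠ N).carrier) = tmk m (a • n) :=
  Tens.mk_smul a m n

theorem tmk_add_left (m m' : M.carrier) (n : N.carrier) :
    (tmk (m + m') n : (M ⊠ N).carrier) = tmk m n + tmk m' n := Tens.mk_add_left _ _ _

theorem tmk_add_right (m : M.carrier) (n n' : N.carrier) :
    (tmk m (n + n') : (M ⊠ N).carrier) = tmk m n + tmk m n' := Tens.mk_add_right _ _ _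

/-- The biadditive map `(m, n) ↦ m ⊗ n`. -/
def tmkHom : M.carrier →+ N.carrier →+ (M ⊠ N).carrier := Tens.mkHom

@[simp] theorem tmkHom_apply (m : M.carrier) (n : N.carrier) :
    tmkHom m n = (tmk m n : (M ⊠ N).carrier) := rfl

theorem addHom_ext {P : Type*} [AddCommGroup P] {f g : (M ⊠ N).carrier →+ P}
    (h : ∀ m n, f (tmk m n) = g (tmk m n)) : f = g := Tens.hom_ext h

theorem tensor_ext {P : BiMod.{u} S T} {f g : M ⊠ N ⟶ P}
    (h : ∀ m n, f.fn (tmk m n) = g.fn (tmk m n)) : f = g := Hom.ext (addHom_ext h)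

@[elab_as_elim]
theorem tensor_ind {p : (M ⊠ N).carrier → Prop} (x : (M ⊠ N).carrier) (h0 : p 0)
    (hmk : ∀ m n, p (tmk m n)) (hadd : ∀ x y, p x → p y → p (x + y)) : p x :=
  Tens.induction x h0 hmk hadd

/-- A balanced biadditive map induces an additive map. -/
def alift {P : Type*} [AddCommGroup P] (φ : M.carrier →+ N.carrier →+ P)
    (h : ∀ m (a : A) n, φ (MulOpposite.op a • m) n = φ m (a • n)) : (M ⊠ N).carrier →+ P :=
  Tens.lift φ h

@[simp] theorem alift_tmk {P : Type*} [AddCommGroup P] (φ : M.carrier →+ N.carrier →+ P)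
    (h) (m : M.carrier) (n : N.carrier) :
    alift φ h (tmk m n : (M ⊠ N).carrier) = φ m n := rfl

/-- A balanced, left and right linear biadditive map induces a bimodule map. -/
def tlift {P : BiMod.{u} S T} (φ : M.carrier →+ N.carrier →+ P.carrier)
    (h : ∀ m (a : A) n, φ (MulOpposite.op a • m) n = φ m (a • n))
    (hl : ∀ (s : S) m n, φ (s • m) n = s • φ m n)
    (hr : ∀ (t : Tᵐᵒᵖ) m n, φ m (t • n) = t • φ m n) : M ⊠ N ⟶ P where
  fn := alift φ h
  map_lsmul s := DFunLike.congr_fun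
    (f := (alift φ h).comp (DistribSMul.toAddMonoidHom (M ⊠ N).carrier s))
    (g := (DistribSMul.toAddMonoidHom P.carrier s).comp (alift φ h)) (addHom_ext (hl s))
  map_rsmul t := DFunLike.congr_fun
    (f := (alift φ h).comp (DistribSMul.toAddMonoidHom (M ⊠ N).carrier t))
    (g := (DistribSMul.toAddMonoidHom P.carrier t).comp (alift φ h)) (addHom_ext (hr t))

@[simp] theorem tlift_tmk {P : BiMod.{u} S T} (φ : M.carrier →+ N.carrier →+ P.carrier)
    (h hl hr) (m : M.carrier) (n : N.carrier) :
    Hom.fn (tlift (P := P) φ h hl hr) (tmk m n) = φ m n := rfl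

end tmk

/-- `f ⊗_A g` for bimodule maps `f` and `g`. -/
def tmap {M M' : BiMod.{u} S A} {N N' : BiMod.{u} A T} (f : M ⟶ M') (g : N ⟶ N') :
    M ⊠ N ⟶ M' ⊠ N' where
  fn := Tens.map (Hom.r f) (Hom.l g)
  map_lsmul s := DFunLike.congr_fun
    (f := AddMonoidHom.comp (Tens.map (Hom.r f) (Hom.l g))
      (DistribSMul.toAddMonoidHom (M ⊠ N).carrier s))
    (g := (DistribSMul.toAddMonoidHom (M' ⊠ N').carrier s).comp (Tens.map (Hom.r f) (Hom.l g)))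
    (addHom_ext fun m n => congrArg (fun x => tmk x (g.fn n)) (f.map_lsmul s m))
  map_rsmul t := DFunLike.congr_fun
    (f := AddMonoidHom.comp (Tens.map (Hom.r f) (Hom.l g))
      (DistribSMul.toAddMonoidHom (M ⊠ N).carrier t))
    (g := (DistribSMul.toAddMonoidHom (M' ⊠ N').carrier t).comp (Tens.map (Hom.r f) (Hom.l g)))
    (addHom_ext fun m n => congrArg (tmk (f.fn m)) (g.map_rsmul t n))

infixl:82 " ⊠ₘ " => BiMod.tmap

@[simp] theorem tmap_tmk {M M' : BiMod.{u} S A} {N N' : BiMod.{u} A T} (f : M ⟶ M')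
    (g : N ⟶ N') (m : M.carrier) (n : N.carrier) :
    (f ⊠ₘ g).fn (tmk m n) = tmk (f.fn m) (g.fn n) := rfl

@[simp] theorem tmap_id (M : BiMod.{u} S A) (N : BiMod.{u} A T) :
    (𝟙 M) ⊠ₘ (𝟙 N) = 𝟙 (M ⊠ N) := tensor_ext fun _ _ => rfl

theorem tmap_comp {M M' M'' : BiMod.{u} S A} {N N' N'' : BiMod.{u} A T} (f : M ⟶ M')
    (f' : M' ⟶ M'') (g : N ⟶ N') (g' : N' ⟶ N'') :
    (f ⊠ₘ g) ≫ (f' ⊠ₘ g') = (f ≫ f') ⊠ₘ (g ≫ g') := tensor_ext fun _ _ => rfl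

theorem tmap_comp_assoc {M M' M'' : BiMod.{u} S A} {N N' N'' : BiMod.{u} A T} (f : M ⟶ M')
    (f' : M' ⟶ M'') (g : N ⟶ N') (g' : N' ⟶ N'') {P : BiMod.{u} S T} (h : M'' ⊠ N'' ⟶ P) :
    (f ⊠ₘ g) ≫ (f' ⊠ₘ g') ≫ h = ((f ≫ f') ⊠ₘ (g ≫ g')) ≫ h := tensor_ext fun _ _ => rfl

/-- The associativity map `(m ⊗ n) ⊗ p ↦ m ⊗ (n ⊗ p)`. -/
def assocHom (M : BiMod.{u} S A) (N : BiMod.{u} A B) (P : BiMod.{u} B T) :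
    (M ⊠ N) ⊠ P ⟶ M ⊠ (N ⊠ P) :=
  tlift
    (alift
      (AddMonoidHom.mk' (fun m => (AddMonoidHom.compHom (tmkHom m)).comp tmkHom)
        (fun m m' => by ext n p; simp) :
        M.carrier →+ N.carrier →+ P.carrier →+ (M ⊠ (N ⊠ P)).carrier)
      (fun m a n => by ext p; exact tmk_smul a m (tmk n p)))
    (fun x b p => tensor_ind x (by simp) (fun m n => congrArg (tmk m) (tmk_smul b n p))
      (fun x y hx hy => by simp only [smul_add, map_add, AddMonoidHom.add_apply, hx, hy]))
    (fun s x p => tensor_ind x (by simp) (fun m n => rfl)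
      (fun x y hx hy => by simp only [smul_add, map_add, AddMonoidHom.add_apply, hx, hy]))
    (fun t x p => tensor_ind x (by simp) (fun m n => rfl)
      (fun x y hx hy => by simp only [smul_add, map_add, AddMonoidHom.add_apply, hx, hy]))

@[simp] theorem assocHom_tmk {M : BiMod.{u} S A} {N : BiMod.{u} A B} {P : BiMod.{u} B T}
    (m : M.carrier) (n : N.carrier) (p : P.carrier) :
    (assocHom M N P).fn (tmk (tmk m n) p) = tmk m (tmk n p) := rfl

/-- The inverse associativity map `m ⊗ (n ⊗ p) ↦ (m ⊗ n) ⊗ p`. -/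
def assocInv (M : BiMod.{u} S A) (N : BiMod.{u} A B) (P : BiMod.{u} B T) :
    M ⊠ (N ⊠ P) ⟶ (M ⊠ N) ⊠ P :=
  tlift
    (AddMonoidHom.mk' (fun m => alift
        ((tmkHom : (M ⊠ N).carrier →+ P.carrier →+ ((M ⊠ N) ⊠ P).carrier).comp (tmkHom m))
        (fun n b p => tmk_smul (M := M ⊠ N) (N := P) b (tmk m n) p))
      (fun m m' => addHom_ext fun n p => by
        change tmk (tmk (m + m') n) p = tmk (tmk m n) p + tmk (tmk m' n) p
        rw [tmk_add_left, tmk_add_left]))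
    (fun m a x => tensor_ind x (by simp)
      (fun n p => congrArg (fun y => tmk (M := M ⊠ N) (N := P) y p) (tmk_smul a m n))
      (fun x y hx hy => by simp only [smul_add, map_add, hx, hy]))
    (fun s m x => tensor_ind x (by simp) (fun n p => rfl)
      (fun x y hx hy => by simp only [smul_add, map_add, hx, hy]))
    (fun t m x => tensor_ind x (by simp) (fun n p => rfl)
      (fun x y hx hy => by simp only [smul_add, map_add, hx, hy]))

@[simp] theorem assocInv_tmk {M : BiMod.{u} S A} {N : BiMod.{u} A B} {P : BiMod.{u} B T}
    (m : M.carrier) (n : N.carrier) (p : P.carrier) :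
    (assocInv M N P).fn (tmk m (tmk n p)) = tmk (tmk m n) p := rfl

theorem tensor_ext₃ {M : BiMod.{u} S A} {N : BiMod.{u} A B} {P : BiMod.{u} B T}
    {Q : BiMod.{u} S T} {f g : (M ⊠ N) ⊠ P ⟶ Q}
    (h : ∀ m n p, f.fn (tmk (tmk m n) p) = g.fn (tmk (tmk m n) p)) : f = g :=
  tensor_ext fun x p => DFunLike.congr_fun
    (f := f.fn.comp ((tmkHom (M := M ⊠ N) (N := P)).flip p))
    (g := g.fn.comp ((tmkHom (M := M ⊠ N) (N := P)).flip p)) (addHom_ext fun m n => h m n p) x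

theorem tensor_ext₃' {M : BiMod.{u} S A} {N : BiMod.{u} A B} {P : BiMod.{u} B T}
    {Q : BiMod.{u} S T} {f g : M ⊠ (N ⊠ P) ⟶ Q}
    (h : ∀ m n p, f.fn (tmk m (tmk n p)) = g.fn (tmk m (tmk n p))) : f = g :=
  tensor_ext fun m x => DFunLike.congr_fun
    (f := f.fn.comp (tmkHom (M := M) (N := N ⊠ P) m))
    (g := g.fn.comp (tmkHom (M := M) (N := N ⊠ P) m)) (addHom_ext fun n p => h m n p) x

/-- The associativity isomorphism `(M ⊗ N) ⊗ P ≅ M ⊗ (N ⊗ P)`. -/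
@[simps]
def assoc (M : BiMod.{u} S A) (N : BiMod.{u} A B) (P : BiMod.{u} B T) :
    (M ⊠ N) ⊠ P ≅ M ⊠ (N ⊠ P) where
  hom := assocHom M N P
  inv := assocInv M N P
  hom_inv_id := tensor_ext₃ fun _ _ _ => rfl
  inv_hom_id := tensor_ext₃' fun _ _ _ => rfl

end BiMod

namespace BiMod

variable {S : Type v} {T : Type w} {A B A' : Type*} [Ring S] [Ring T] [Ring A] [Ring B]
  [Ring A']

theorem assoc_naturality {M M' : BiMod.{u} S A} {N N' : BiMod.{u} A B} {P P' : BiMod.{u} B T}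
    (f : M ⟶ M') (g : N ⟶ N') (h : P ⟶ P') :
    ((f ⊠ₘ g) ⊠ₘ h) ≫ assocHom M' N' P' = assocHom M N P ≫ (f ⊠ₘ (g ⊠ₘ h)) :=
  tensor_ext₃ fun _ _ _ => rfl

theorem assoc_inv_naturality {M M' : BiMod.{u} S A} {N N' : BiMod.{u} A B}
    {P P' : BiMod.{u} B T} (f : M ⟶ M') (g : N ⟶ N') (h : P ⟶ P') :
    (f ⊠ₘ (g ⊠ₘ h)) ≫ assocInv M' N' P' = assocInv M N P ≫ ((f ⊠ₘ g) ⊠ₘ h) :=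
  tensor_ext₃' fun _ _ _ => rfl

/-- The canonical map `A ⊗_A N → N`, `a ⊗ n ↦ an`. -/
def lunit {A : Type u} [Ring A] (N : BiMod.{u} A T) : unit A ⊠ N ⟶ N :=
  tlift (M := unit A)
    (AddMonoidHom.mk' (fun a : A => DistribSMul.toAddMonoidHom N.carrier a)
      (fun a a' => by ext n; exact add_smul (R := A) a a' n))
    (fun (m a : A) n => mul_smul m a n)
    (fun (s m : A) n => mul_smul s m n)
    (fun t (m : A) n => smul_comm m t n)

@[simp] theorem lunit_tmk {A : Type u} [Ring A] (N : BiMod.{u} A T) (a : A) (n : N.carrier) :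
    (lunit N).fn (tmk (M := unit A) a n) = a • n := rfl

/-- The canonical map `M ⊗_A A → M`, `m ⊗ a ↦ ma`. -/
def runit {A : Type u} [Ring A] (M : BiMod.{u} S A) : M ⊠ unit A ⟶ M :=
  tlift (N := unit A)
    (AddMonoidHom.flip (AddMonoidHom.mk'
      (fun a : A => DistribSMul.toAddMonoidHom M.carrier (MulOpposite.op a))
      (fun a a' => by ext n; exact add_smul (R := Aᵐᵒᵖ) (MulOpposite.op a) (MulOpposite.op a') n)))
    (fun m (a n : A) => (mul_smul (MulOpposite.op n) (MulOpposite.op a) m).symm)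
    (fun s m (n : A) => (smul_comm s (MulOpposite.op n) m).symm)
    (fun t m (n : A) => mul_smul t (MulOpposite.op n) m)

@[simp] theorem runit_tmk {A : Type u} [Ring A] (M : BiMod.{u} S A) (m : M.carrier) (a : A) :
    (runit M).fn (tmk (N := unit A) m a) = MulOpposite.op a • m := rfl

theorem tensor_ext₄ {M : BiMod.{u} S A} {N : BiMod.{u} A B} {P : BiMod.{u} B A'}
    {R : BiMod.{u} A' T} {Q : BiMod.{u} S T} {f g : ((M ⊠ N) ⊠ P) ⊠ R ⟶ Q}
    (h : ∀ m n p r, f.fn (tmk (tmk (tmk m n) p) r) = g.fn (tmk (tmk (tmk m n) p) r)) : f = g :=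
  tensor_ext₃ fun x p r => DFunLike.congr_fun
    (f := f.fn.comp (((tmkHom (M := (M ⊠ N) ⊠ P) (N := R)).flip r).comp
      ((tmkHom (M := M ⊠ N) (N := P)).flip p)))
    (g := g.fn.comp (((tmkHom (M := (M ⊠ N) ⊠ P) (N := R)).flip r).comp
      ((tmkHom (M := M ⊠ N) (N := P)).flip p)))
    (addHom_ext fun m n => h m n p r) x

theorem pentagon (M : BiMod.{u} S A) (N : BiMod.{u} A B) (P : BiMod.{u} B A')
    (R : BiMod.{u} A' T) :
    assocHom (M ⊠ N) P R ≫ assocHom M N (P ⊠ R) =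
      (assocHom M N P ⊠ₘ 𝟙 R) ≫ assocHom M (N ⊠ P) R ≫ (𝟙 M ⊠ₘ assocHom N P R) :=
  tensor_ext₄ fun _ _ _ _ => rfl

theorem assocHom_inv (M : BiMod.{u} S A) (N : BiMod.{u} A B) (P : BiMod.{u} B T) :
    assocHom M N P ≫ assocInv M N P = 𝟙 _ := (assoc M N P).hom_inv_id

theorem assocInv_hom (M : BiMod.{u} S A) (N : BiMod.{u} A B) (P : BiMod.{u} B T) :
    assocInv M N P ≫ assocHom M N P = 𝟙 _ := (assoc M N P).inv_hom_id

theorem pentagon_inv (M : BiMod.{u} S A) (N : BiMod.{u} A B) (P : BiMod.{u} B A')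
    (R : BiMod.{u} A' T) :
    assocInv M (N ⊠ P) R ≫ (assocInv M N P ⊠ₘ 𝟙 R) ≫ assocHom (M ⊠ N) P R =
      (𝟙 M ⊠ₘ assocHom N P R) ≫ assocInv M N (P ⊠ R) := by
  rw [← cancel_mono (assoc M N (P ⊠ R)).hom]
  simp only [assoc_hom, Category.assoc, assocInv_hom, Category.comp_id]
  rw [pentagon, tmap_comp_assoc, assocInv_hom, Category.comp_id, tmap_id, Category.id_comp,
    reassoc_of% (assocInv_hom M (N ⊠ P) R)]

theorem pentagon_mid (M : BiMod.{u} S A) (N : BiMod.{u} A B) (P : BiMod.{u} B A')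
    (R : BiMod.{u} A' T) :
    assocInv (M ⊠ N) P R ≫ (assocHom M N P ⊠ₘ 𝟙 R) ≫ assocHom M (N ⊠ P) R =
      assocHom M N (P ⊠ R) ≫ (𝟙 M ⊠ₘ assocInv N P R) := by
  have h := congrArg (fun k => assocInv (M ⊠ N) P R ≫ k ≫ (𝟙 M ⊠ₘ assocInv N P R))
    (pentagon M N P R)
  simp only [Category.assoc, tmap_comp, assocHom_inv, Category.comp_id, tmap_id] at h
  rw [← h, reassoc_of% (assocInv_hom (M ⊠ N) P R)]

theorem assoc_lunit {A : Type u} [Ring A] (M : BiMod.{u} A B) (N : BiMod.{u} B T) :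
    assocHom (unit A) M N ≫ lunit (M ⊠ N) = lunit M ⊠ₘ 𝟙 N :=
  tensor_ext₃ fun _ _ _ => rfl

theorem assoc_runit {A : Type u} [Ring A] (M : BiMod.{u} S B) (N : BiMod.{u} B A) :
    assocHom M N (unit A) ≫ (𝟙 M ⊠ₘ runit N) = runit (M ⊠ N) :=
  tensor_ext₃ fun _ _ _ => rfl

/-! ### Kernels, flatness and purity -/

section ker

variable {M N : BiMod.{u} S T}

/-- The kernel of a bimodule map. -/
def ker (f : M ⟶ N) : BiMod.{u} S T :=
  letI : Module S f.fn.ker :=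
    { smul := fun s x => ⟨s • x.1, by
        rw [AddMonoidHom.mem_ker, f.map_lsmul, (AddMonoidHom.mem_ker).1 x.2, smul_zero]⟩
      one_smul := fun x => Subtype.ext (one_smul S x.1)
      mul_smul := fun s s' x => Subtype.ext (mul_smul s s' x.1)
      smul_zero := fun s => Subtype.ext (smul_zero s)
      smul_add := fun s x y => Subtype.ext (smul_add s x.1 y.1)
      add_smul := fun s s' x => Subtype.ext (add_smul s s' x.1)
      zero_smul := fun x => Subtype.ext (zero_smul S x.1) }
  letI : Module Tᵐᵒᵖ f.fn.ker :=
    { smul := fun s x => ⟨s • x.1, by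
        rw [AddMonoidHom.mem_ker, f.map_rsmul, (AddMonoidHom.mem_ker).1 x.2, smul_zero]⟩
      one_smul := fun x => Subtype.ext (one_smul Tᵐᵒᵖ x.1)
      mul_smul := fun s s' x => Subtype.ext (mul_smul s s' x.1)
      smul_zero := fun s => Subtype.ext (smul_zero s)
      smul_add := fun s x y => Subtype.ext (smul_add s x.1 y.1)
      add_smul := fun s s' x => Subtype.ext (add_smul s s' x.1)
      zero_smul := fun x => Subtype.ext (zero_smul Tᵐᵒᵖ x.1) }
  { carrier := f.fn.ker
    comm := ⟨fun s t x => Subtype.ext (smul_comm s t x.1)⟩ }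

/-- The inclusion of the kernel. -/
def kerι (f : M ⟶ N) : ker f ⟶ M where
  fn := f.fn.ker.subtype
  map_lsmul _ _ := rfl
  map_rsmul _ _ := rfl

theorem kerι_injective (f : M ⟶ N) : Function.Injective (kerι f).fn := Subtype.val_injective

theorem kerι_comp (f : M ⟶ N) : kerι f ≫ f = 0 := hom_ext fun x => x.2

theorem exact_kerι (f : M ⟶ N) : Function.Exact (kerι f).fn f.fn := fun x =>
  ⟨fun hx => ⟨⟨x, hx⟩, rfl⟩, by rintro ⟨y, rfl⟩; exact y.2⟩

theorem cancel_inj {P : BiMod.{u} S T} {i : N ⟶ P} (hi : Function.Injective i.fn) {f g : M ⟶ N}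
    (h : f ≫ i = g ≫ i) : f = g :=
  hom_ext fun m => hi (congrArg (fun k : M ⟶ P => k.fn m) h)

/-- A bimodule map whose values lie in the image of an injective `i` factors through `i`. -/
noncomputable def liftInj {P : BiMod.{u} S T} (i : N ⟶ P) (hi : Function.Injective i.fn)
    (f : M ⟶ P) (hf : ∀ m, ∃ n, i.fn n = f.fn m) : M ⟶ N where
  fn := AddMonoidHom.mk' (fun m => (hf m).choose) fun m m' => hi (by
    refine Eq.trans ?_ (map_add i.fn _ _).symm
    exact (hf (m + m')).choose_spec.trans ((map_add f.fn m m').trans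
      (congrArg₂ (· + ·) (hf m).choose_spec.symm (hf m').choose_spec.symm)))
  map_lsmul s m := hi (by
    rw [i.map_lsmul]
    exact (hf (s • m)).choose_spec.trans
      ((f.map_lsmul s m).trans (congrArg (s • ·) (hf m).choose_spec.symm)))
  map_rsmul s m := hi (by
    rw [i.map_rsmul]
    exact (hf (s • m)).choose_spec.trans
      ((f.map_rsmul s m).trans (congrArg (s • ·) (hf m).choose_spec.symm)))

theorem liftInj_comp {P : BiMod.{u} S T} (i : N ⟶ P)
    (hi : Function.Injective i.fn) (f : M ⟶ P) (hf : ∀ m, ∃ n, i.fn n = f.fn m) :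
    liftInj i hi f hf ≫ i = f := hom_ext fun m => (hf m).choose_spec

/-- The map `f` is `Z`-pure for a left `T`-module `Z`: the functor `- ⊗_T Z` preserves the
kernel of `f`. -/
def IsPureRight (f : M ⟶ N) (Z : Type u) [AddCommGroup Z] [Module T Z] : Prop :=
  Function.Injective (Tens.map (Hom.r (kerι f)) (.id : Z →ₗ[T] Z)) ∧
    Function.Exact (Tens.map (Hom.r (kerι f)) (.id : Z →ₗ[T] Z))
      (Tens.map (Hom.r f) (.id : Z →ₗ[T] Z))

/-- The map `f` is `W`-pure for a right `S`-module `W`: the functor `W ⊗_S -` preserves the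
kernel of `f`. -/
def IsPureLeft (f : M ⟶ N) (W : Type u) [AddCommGroup W] [Module Sᵐᵒᵖ W] : Prop :=
  Function.Injective (Tens.map (.id : W →ₗ[Sᵐᵒᵖ] W) (Hom.l (kerι f))) ∧
    Function.Exact (Tens.map (.id : W →ₗ[Sᵐᵒᵖ] W) (Hom.l (kerι f)))
      (Tens.map (.id : W →ₗ[Sᵐᵒᵖ] W) (Hom.l f))

/-- The map `f` is pure as a map of left `S`-modules. -/
def IsPureLeftModuleMap (f : M ⟶ N) : Prop :=
  ∀ (W : Type u) [AddCommGroup W] [Module Sᵐᵒᵖ W], IsPureLeft f W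

end ker

/-- The left module `_S M` is flat: the functor `- ⊗_S M` on right `S`-modules is exact. -/
def LeftFlat (M : BiMod.{u} S T) : Prop :=
  ∀ (P P' P'' : Type u) [AddCommGroup P] [AddCommGroup P'] [AddCommGroup P'']
    [Module Sᵐᵒᵖ P] [Module Sᵐᵒᵖ P'] [Module Sᵐᵒᵖ P'']
    (f : P →ₗ[Sᵐᵒᵖ] P') (g : P' →ₗ[Sᵐᵒᵖ] P''), Function.Exact f g →
    Function.Exact (Tens.map f (.id : M.carrier →ₗ[S] M.carrier))
      (Tens.map g (.id : M.carrier →ₗ[S] M.carrier))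

/-- The right module `M_T` is flat: the functor `M ⊗_T -` on left `T`-modules is exact. -/
def RightFlat (M : BiMod.{u} S T) : Prop :=
  ∀ (P P' P'' : Type u) [AddCommGroup P] [AddCommGroup P'] [AddCommGroup P'']
    [Module T P] [Module T P'] [Module T P'']
    (f : P →ₗ[T] P') (g : P' →ₗ[T] P''), Function.Exact f g →
    Function.Exact (Tens.map (.id : M.carrier →ₗ[Tᵐᵒᵖ] M.carrier) f)
      (Tens.map (.id : M.carrier →ₗ[Tᵐᵒᵖ] M.carrier) g)

theorem LeftFlat.injective {Z : BiMod.{u} A B} (hZ : LeftFlat Z) {P P' : Type u}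
    [AddCommGroup P] [AddCommGroup P'] [Module Aᵐᵒᵖ P] [Module Aᵐᵒᵖ P'] (f : P →ₗ[Aᵐᵒᵖ] P')
    (hf : Function.Injective f) :
    Function.Injective (Tens.map f (.id : Z.carrier →ₗ[A] Z.carrier)) := by
  have h := hZ PUnit.{u+1} P P' 0 f (fun x => by
    rw [map_eq_zero_iff f hf]; simp [eq_comm])
  rw [injective_iff_map_eq_zero]
  intro t ht
  obtain ⟨s, rfl⟩ := (h t).1 ht
  exact DFunLike.congr_fun (g := (0 : _ →+ _)) (Tens.hom_ext (by simp)) s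

theorem RightFlat.injective {Z : BiMod.{u} A B} (hZ : RightFlat Z) {P P' : Type u}
    [AddCommGroup P] [AddCommGroup P'] [Module B P] [Module B P'] (f : P →ₗ[B] P')
    (hf : Function.Injective f) :
    Function.Injective (Tens.map (.id : Z.carrier →ₗ[Bᵐᵒᵖ] Z.carrier) f) := by
  have h := hZ PUnit.{u+1} P P' 0 f (fun x => by
    rw [map_eq_zero_iff f hf]; simp [eq_comm])
  rw [injective_iff_map_eq_zero]
  intro t ht
  obtain ⟨s, rfl⟩ := (h t).1 ht
  exact DFunLike.congr_fun (g := (0 : _ →+ _)) (Tens.hom_ext (by simp)) s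

theorem LeftFlat.isPureRight {Z : BiMod.{u} T B} (hZ : LeftFlat Z) {M N : BiMod.{u} S T}
    (f : M ⟶ N) : IsPureRight f Z.carrier :=
  ⟨hZ.injective _ (kerι_injective f), hZ _ _ _ _ _ (exact_kerι f)⟩

theorem RightFlat.isPureLeft {Z : BiMod.{u} B S} (hZ : RightFlat Z) {M N : BiMod.{u} S T}
    (f : M ⟶ N) : IsPureLeft f Z.carrier :=
  ⟨hZ.injective _ (kerι_injective f), hZ _ _ _ _ _ (exact_kerι f)⟩

end BiMod
open BiMod

/-! ### Corings and comodules -/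

/-- Corings over a ring `A`. -/
structure Coring (A : Type u) [Ring A] where
  bim : BiMod.{u} A A
  comul : bim ⟶ bim ⊠ bim
  counit : bim ⟶ unit A
  coassoc : comul ≫ (comul ⊠ₘ 𝟙 bim) ≫ assocHom bim bim bim = comul ≫ (𝟙 bim ⊠ₘ comul)
  counit_left : comul ≫ (counit ⊠ₘ 𝟙 bim) ≫ lunit bim = 𝟙 bim
  counit_right : comul ≫ (𝟙 bim ⊠ₘ counit) ≫ runit bim = 𝟙 bim

variable {A B E : Type u} [Ring A] [Ring B] [Ring E] {S : Type v} [Ring S] {T : Type w} [Ring T]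

/-- Right `C`-comodules which are also left `S`-modules, with left `S`-linear coaction.
Right `C`-comodules in the usual sense are the case `S = ℤ`. -/
structure RComod (S : Type v) [Ring S] (C : Coring A) where
  mod : BiMod.{u} S A
  rco : mod ⟶ mod ⊠ C.bim
  rcoassoc : rco ≫ (rco ⊠ₘ 𝟙 C.bim) ≫ assocHom mod C.bim C.bim = rco ≫ (𝟙 mod ⊠ₘ C.comul)
  rcounit : rco ≫ (𝟙 mod ⊠ₘ C.counit) ≫ runit mod = 𝟙 mod

/-- Left `C`-comodules which are also right `T`-modules, with right `T`-linear coaction. -/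
structure LComod (C : Coring A) (T : Type w) [Ring T] where
  mod : BiMod.{u} A T
  lco : mod ⟶ C.bim ⊠ mod
  lcoassoc : lco ≫ (C.comul ⊠ₘ 𝟙 mod) ≫ assocHom C.bim C.bim mod = lco ≫ (𝟙 C.bim ⊠ₘ lco)
  lcounit : lco ≫ (C.counit ⊠ₘ 𝟙 mod) ≫ lunit mod = 𝟙 mod

/-- `C`-`D`-bicomodules. -/
structure Bicomod (C : Coring A) (D : Coring B) extends LComod C B, RComod A D where
  compat : rco ≫ (lco ⊠ₘ 𝟙 D.bim) ≫ assocHom C.bim mod D.bim = lco ≫ (𝟙 C.bim ⊠ₘ rco)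

namespace RComod

variable {C : Coring A}

/-- Morphisms of right comodules. -/
@[ext]
structure Hom (M N : RComod S C) where
  hom : M.mod ⟶ N.mod
  colinear : hom ≫ N.rco = M.rco ≫ (hom ⊠ₘ 𝟙 C.bim)

instance : Category (RComod S C) where
  Hom := Hom
  id M := ⟨𝟙 _, by simp⟩
  comp f g := ⟨f.hom ≫ g.hom, by
    rw [Category.assoc, g.colinear, ← Category.assoc, f.colinear, Category.assoc, tmap_comp,
      Category.comp_id]⟩

@[ext]
theorem hom_ext {M N : RComod S C} {f g : M ⟶ N} (h : f.hom = g.hom) : f = g := Hom.ext h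

@[simp] theorem id_hom (M : RComod S C) : Hom.hom (𝟙 M) = 𝟙 M.mod := rfl

@[simp] theorem comp_hom {M N P : RComod S C} (f : M ⟶ N) (g : N ⟶ P) :
    (f ≫ g).hom = f.hom ≫ g.hom := rfl

end RComod

namespace LComod

variable {C : Coring A}

/-- Morphisms of left comodules. -/
@[ext]
structure Hom (M N : LComod C T) where
  hom : M.mod ⟶ N.mod
  colinear : hom ≫ N.lco = M.lco ≫ (𝟙 C.bim ⊠ₘ hom)

instance : Category (LComod C T) where
  Hom := Hom
  id M := ⟨𝟙 _, by simp⟩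
  comp f g := ⟨f.hom ≫ g.hom, by
    rw [Category.assoc, g.colinear, ← Category.assoc, f.colinear, Category.assoc, tmap_comp,
      Category.comp_id]⟩

@[ext]
theorem hom_ext {M N : LComod C T} {f g : M ⟶ N} (h : f.hom = g.hom) : f = g := Hom.ext h

@[simp] theorem id_hom (M : LComod C T) : Hom.hom (𝟙 M) = 𝟙 M.mod := rfl

@[simp] theorem comp_hom {M N P : LComod C T} (f : M ⟶ N) (g : N ⟶ P) :
    (f ≫ g).hom = f.hom ≫ g.hom := rfl

end LComod

namespace Bicomod

variable {C : Coring A} {D : Coring B}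

/-- Morphisms of bicomodules: bimodule maps which are left and right colinear. -/
@[ext]
structure Hom (M N : Bicomod C D) where
  hom : M.mod ⟶ N.mod
  lcolinear : hom ≫ N.lco = M.lco ≫ (𝟙 C.bim ⊠ₘ hom)
  rcolinear : hom ≫ N.rco = M.rco ≫ (hom ⊠ₘ 𝟙 D.bim)

instance : Category (Bicomod C D) where
  Hom := Hom
  id M := ⟨𝟙 _, by simp, by simp⟩
  comp f g := ⟨f.hom ≫ g.hom, by
    rw [Category.assoc, g.lcolinear, ← Category.assoc, f.lcolinear, Category.assoc, tmap_comp,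
      Category.comp_id], by
    rw [Category.assoc, g.rcolinear, ← Category.assoc, f.rcolinear, Category.assoc, tmap_comp,
      Category.comp_id]⟩

/-- The underlying right comodule morphism. -/
def Hom.toR {M N : Bicomod C D} (f : M ⟶ N) : M.toRComod ⟶ N.toRComod := ⟨f.hom, f.rcolinear⟩

/-- The underlying left comodule morphism. -/
def Hom.toL {M N : Bicomod C D} (f : M ⟶ N) : M.toLComod ⟶ N.toLComod := ⟨f.hom, f.lcolinear⟩

end Bicomod

/-- The coring `C` as a `C`-`C`-bicomodule. -/
def Coring.regular (C : Coring A) : Bicomod C C where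
  mod := C.bim
  lco := C.comul
  rco := C.comul
  lcoassoc := C.coassoc
  lcounit := C.counit_left
  rcoassoc := C.coassoc
  rcounit := C.counit_right
  compat := C.coassoc

/-- `M ⊗_E N` for a left `C`-comodule `M` and an `(E, T)`-bimodule `N`. -/
def LComod.tensor {C : Coring A} (M : LComod C E) (N : BiMod.{u} E T) : LComod C T where
  mod := M.mod ⊠ N
  lco := (M.lco ⊠ₘ 𝟙 N) ≫ assocHom C.bim M.mod N
  lcoassoc := by
    have h := congrArg (fun k => k ⊠ₘ 𝟙 N) M.lcoassoc
    simp only [Category.assoc]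
    calc _ = (M.lco ⊠ₘ 𝟙 N) ≫ ((C.comul ⊠ₘ 𝟙 M.mod) ⊠ₘ 𝟙 N) ≫
          assocHom _ _ _ ≫ assocHom _ _ _ := by
          rw [reassoc_of% (assoc_naturality C.comul (𝟙 M.mod) (𝟙 N)), tmap_id]
      _ = ((M.lco ≫ (C.comul ⊠ₘ 𝟙 M.mod) ≫ assocHom _ _ _) ⊠ₘ 𝟙 N) ≫
          assocHom _ _ _ ≫ (𝟙 C.bim ⊠ₘ assocHom _ _ _) := by
          rw [pentagon]; simp only [tmap_comp_assoc, Category.comp_id]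
      _ = (M.lco ⊠ₘ 𝟙 N) ≫ ((𝟙 C.bim ⊠ₘ M.lco) ⊠ₘ 𝟙 N) ≫
          assocHom _ _ _ ≫ (𝟙 C.bim ⊠ₘ assocHom _ _ _) := by
          rw [M.lcoassoc]; simp only [tmap_comp_assoc, Category.comp_id]
      _ = _ := by
          rw [reassoc_of% (assoc_naturality (𝟙 C.bim) M.lco (𝟙 N)), tmap_comp,
            Category.comp_id]
  lcounit := by
    have h := assoc_naturality C.counit (𝟙 M.mod) (𝟙 N)
    rw [tmap_id] at h
    rw [Category.assoc, ← reassoc_of% h, assoc_lunit, tmap_comp, tmap_comp, M.lcounit]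
    simp

/-- `M ⊗_E N` for an `(S, E)`-bimodule `M` and a right `D`-comodule `N`. -/
def RComod.tensor {D : Coring B} (M : BiMod.{u} S E) (N : RComod E D) : RComod S D where
  mod := M ⊠ N.mod
  rco := (𝟙 M ⊠ₘ N.rco) ≫ assocInv M N.mod D.bim
  rcoassoc := by
    have h := congrArg (fun k => (𝟙 M ⊠ₘ k) ≫ assocInv _ _ _) N.rcoassoc
    have e := assoc_inv_naturality (𝟙 M) N.rco (𝟙 D.bim)
    have e' := assoc_inv_naturality (𝟙 M) (𝟙 N.mod) D.comul
    rw [tmap_id] at e'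
    have c : ((𝟙 M ⊠ₘ N.rco) ≫ assocInv M N.mod D.bim) ⊠ₘ 𝟙 D.bim =
        ((𝟙 M ⊠ₘ N.rco) ⊠ₘ 𝟙 D.bim) ≫ (assocInv M N.mod D.bim ⊠ₘ 𝟙 D.bim) := by
      rw [tmap_comp, Category.comp_id]
    rw [c]
    simp only [Category.assoc]
    rw [← reassoc_of% e, pentagon_inv, ← e', tmap_comp_assoc, tmap_comp_assoc, tmap_comp_assoc]
    simpa using h
  rcounit := by
    have e := assoc_inv_naturality (𝟙 M) (𝟙 N.mod) D.counit
    rw [tmap_id] at e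
    rw [Category.assoc, ← reassoc_of% e, ← assoc_runit, reassoc_of% assocInv_hom, tmap_comp,
      tmap_comp, N.rcounit]
    simp

/-- The `C`-`D`-bicomodule `M ⊗_E N`, with the left coaction of `M` and the right coaction
of `N`. -/
def Bicomod.tensor {C : Coring A} {D : Coring B} (M : LComod C E) (N : RComod E D) :
    Bicomod C D where
  __ := LComod.tensor M N.mod
  __ := RComod.tensor M.mod N
  compat := by
    change ((𝟙 M.mod ⊠ₘ N.rco) ≫ assocInv M.mod N.mod D.bim) ≫
      (((M.lco ⊠ₘ 𝟙 N.mod) ≫ assocHom C.bim M.mod N.mod) ⊠ₘ 𝟙 D.bim) ≫ assocHom _ _ _ =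
      ((M.lco ⊠ₘ 𝟙 N.mod) ≫ assocHom C.bim M.mod N.mod) ≫
      (𝟙 C.bim ⊠ₘ ((𝟙 M.mod ⊠ₘ N.rco) ≫ assocInv M.mod N.mod D.bim))
    have e := assoc_inv_naturality M.lco (𝟙 N.mod) (𝟙 D.bim)
    have e' := assoc_naturality (𝟙 C.bim) (𝟙 M.mod) N.rco
    rw [tmap_id] at e e'
    have c : ((M.lco ⊠ₘ 𝟙 N.mod) ≫ assocHom C.bim M.mod N.mod) ⊠ₘ 𝟙 D.bim =
        ((M.lco ⊠ₘ 𝟙 N.mod) ⊠ₘ 𝟙 D.bim) ≫ (assocHom C.bim M.mod N.mod ⊠ₘ 𝟙 D.bim) := by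
      rw [tmap_comp, Category.comp_id]
    have c' : 𝟙 C.bim ⊠ₘ ((𝟙 M.mod ⊠ₘ N.rco) ≫ assocInv M.mod N.mod D.bim) =
        (𝟙 C.bim ⊠ₘ (𝟙 M.mod ⊠ₘ N.rco)) ≫ (𝟙 C.bim ⊠ₘ assocInv M.mod N.mod D.bim) := by
      rw [tmap_comp, Category.comp_id]
    rw [c, c']
    simp only [Category.assoc]
    rw [← reassoc_of% e, pentagon_mid, ← reassoc_of% e', tmap_comp_assoc, tmap_comp_assoc]
    simp

/-! ### The cotensor product -/

/-- The coaction of `P` restricts to a subbimodule `i : K → P`, as soon as the relevant tensor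
products of `i` are injective and the coaction of `P` maps `K` into `K ⊗ D`. -/
noncomputable def RComod.sub {D : Coring B} (P : RComod S D) {K : BiMod.{u} S B} (i : K ⟶ P.mod)
    (hi : Function.Injective i.fn) (h₁ : Function.Injective (i ⊠ₘ 𝟙 D.bim).fn)
    (h₂ : Function.Injective (i ⊠ₘ 𝟙 (D.bim ⊠ D.bim)).fn)
    (h : ∀ x, ∃ y, (i ⊠ₘ 𝟙 D.bim).fn y = (i ≫ P.rco).fn x) : RComod S D where
  mod := K
  rco := liftInj _ h₁ _ h
  rcoassoc := by
    have e := liftInj_comp _ h₁ _ h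
    set r := liftInj _ h₁ _ h
    refine cancel_inj h₂ ?_
    have n := assoc_naturality i (𝟙 D.bim) (𝟙 D.bim)
    rw [tmap_id] at n
    rw [Category.assoc, Category.assoc, ← n, tmap_comp_assoc, e, Category.comp_id,
      Category.assoc, tmap_comp, Category.id_comp, Category.comp_id]
    calc _ = (r ≫ (i ⊠ₘ 𝟙 D.bim)) ≫ (P.rco ⊠ₘ 𝟙 D.bim) ≫ assocHom _ _ _ := by
          rw [Category.assoc, tmap_comp_assoc, Category.comp_id]
      _ = (r ≫ (i ⊠ₘ 𝟙 D.bim)) ≫ (𝟙 _ ⊠ₘ D.comul) := by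
          rw [e, Category.assoc, Category.assoc, P.rcoassoc]
      _ = _ := by rw [Category.assoc, tmap_comp, Category.comp_id, Category.id_comp]
  rcounit := by
    have e := liftInj_comp _ h₁ _ h
    set r := liftInj _ h₁ _ h
    refine cancel_inj hi ?_
    have n : runit K ≫ i = (i ⊠ₘ 𝟙 (unit B)) ≫ runit P.mod :=
      tensor_ext fun _ (_ : B) => i.map_rsmul _ _
    rw [Category.assoc, Category.assoc, n, tmap_comp_assoc]
    calc _ = (r ≫ (i ⊠ₘ 𝟙 D.bim)) ≫ (𝟙 _ ⊠ₘ D.counit) ≫ runit _ := by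
          rw [Category.assoc, tmap_comp_assoc]; simp
      _ = _ := by rw [e, Category.assoc, P.rcounit, Category.comp_id, Category.id_comp]

/-- The left-handed version of `RComod.sub`. -/
noncomputable def LComod.sub {C : Coring A} (P : LComod C T) {K : BiMod.{u} A T} (i : K ⟶ P.mod)
    (hi : Function.Injective i.fn) (h₁ : Function.Injective (𝟙 C.bim ⊠ₘ i).fn)
    (h₂ : Function.Injective (𝟙 (C.bim ⊠ C.bim) ⊠ₘ i).fn)
    (h : ∀ x, ∃ y, (𝟙 C.bim ⊠ₘ i).fn y = (i ≫ P.lco).fn x) : LComod C T where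
  mod := K
  lco := liftInj _ h₁ _ h
  lcoassoc := by
    have e := liftInj_comp _ h₁ _ h
    set r := liftInj _ h₁ _ h
    have h₂' : Function.Injective (𝟙 C.bim ⊠ₘ (𝟙 C.bim ⊠ₘ i)).fn := by
      have n := assoc_inv_naturality (𝟙 C.bim) (𝟙 C.bim) i
      rw [tmap_id] at n
      have n' := assocInv_hom C.bim C.bim K
      intro x y hxy
      have := congrArg (assocInv _ _ _).fn hxy
      rw [← comp_fn, ← comp_fn, n] at this
      have h3 := congrArg (assocHom C.bim C.bim K).fn (h₂ this)
      rwa [← comp_fn, ← comp_fn, n'] at h3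
    refine cancel_inj h₂' ?_
    have n := assoc_naturality (𝟙 C.bim) (𝟙 C.bim) i
    rw [tmap_id] at n
    rw [Category.assoc, Category.assoc, ← n, tmap_comp_assoc, Category.comp_id,
      Category.id_comp, Category.assoc, tmap_comp, Category.id_comp, e]
    calc _ = (r ≫ (𝟙 C.bim ⊠ₘ i)) ≫ (C.comul ⊠ₘ 𝟙 _) ≫ assocHom _ _ _ := by
          rw [Category.assoc, tmap_comp_assoc, Category.comp_id, Category.id_comp]
      _ = (r ≫ (𝟙 C.bim ⊠ₘ i)) ≫ (𝟙 _ ⊠ₘ P.lco) := by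
          rw [e, Category.assoc, Category.assoc, P.lcoassoc]
      _ = _ := by rw [Category.assoc, tmap_comp, Category.id_comp]
  lcounit := by
    have e := liftInj_comp _ h₁ _ h
    set r := liftInj _ h₁ _ h
    refine cancel_inj hi ?_
    have n : lunit K ≫ i = (𝟙 (unit A) ⊠ₘ i) ≫ lunit P.mod :=
      tensor_ext fun (_ : A) _ => i.map_lsmul _ _
    rw [Category.assoc, Category.assoc, n, tmap_comp_assoc]
    calc _ = (r ≫ (𝟙 C.bim ⊠ₘ i)) ≫ (C.counit ⊠ₘ 𝟙 _) ≫ lunit _ := by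
          rw [Category.assoc, tmap_comp_assoc]; simp
      _ = _ := by rw [e, Category.assoc, P.lcounit, Category.comp_id, Category.id_comp]

/-- The map `ω = ρ_M ⊗ N - M ⊗ λ_N : M ⊗_A N → M ⊗_A C ⊗_A N`. -/
def omega {C : Coring A} (M : RComod S C) (N : LComod C T) :
    M.mod ⊠ N.mod ⟶ (M.mod ⊠ C.bim) ⊠ N.mod :=
  (M.rco ⊠ₘ 𝟙 N.mod) - (𝟙 M.mod ⊠ₘ N.lco) ≫ assocInv M.mod C.bim N.mod

/-- The cotensor product `M □_C N`, the kernel of `ω`. -/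
def cotensor {C : Coring A} (M : RComod S C) (N : LComod C T) : BiMod.{u} S T :=
  ker (omega M N)

/-- The inclusion `M □_C N → M ⊗_A N`. -/
def cotensorι {C : Coring A} (M : RComod S C) (N : LComod C T) :
    cotensor M N ⟶ M.mod ⊠ N.mod := kerι (omega M N)

theorem comp_sub' {M N P : BiMod.{u} S T} (f : M ⟶ N) (g h : N ⟶ P) :
    f ≫ (g - h) = f ≫ g - f ≫ h := rfl

theorem sub_comp' {M N P : BiMod.{u} S T} (f g : M ⟶ N) (h : N ⟶ P) :
    (f - g) ≫ h = f ≫ h - g ≫ h := hom_ext fun _ => map_sub h.fn _ _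

theorem eq_of_sub_eq_zero {M N : BiMod.{u} S T} {f g : M ⟶ N} (h : f - g = 0) : f = g :=
  hom_ext fun m => sub_eq_zero.1 (congrArg (fun k : M ⟶ N => k.fn m) h)

theorem sub_self' {M N : BiMod.{u} S T} (f : M ⟶ N) : f - f = 0 :=
  hom_ext fun m => sub_self (f.fn m)

theorem sub_tmap {F : Type*} [Ring F] {M N : BiMod.{u} S F} {P Q : BiMod.{u} F T} (f g : M ⟶ N) (h : P ⟶ Q) :
    (f - g) ⊠ₘ h = (f ⊠ₘ h) - (g ⊠ₘ h) := tensor_ext fun _ n =>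
  map_sub ((tmkHom (M := N) (N := Q)).flip (h.fn n)) _ _

theorem tmap_sub {F : Type*} [Ring F] {M N : BiMod.{u} S F} {P Q : BiMod.{u} F T} (f : M ⟶ N) (g h : P ⟶ Q) :
    f ⊠ₘ (g - h) = (f ⊠ₘ g) - (f ⊠ₘ h) := tensor_ext fun m _ =>
  map_sub (tmkHom (M := N) (N := Q) (f.fn m)) _ _

theorem cotensorι_eq {C : Coring A} (M : RComod S C) (N : LComod C T) :
    cotensorι M N ≫ (M.rco ⊠ₘ 𝟙 N.mod) =
      cotensorι M N ≫ (𝟙 M.mod ⊠ₘ N.lco) ≫ assocInv M.mod C.bim N.mod :=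
  eq_of_sub_eq_zero (kerι_comp (omega M N))

theorem cotensorι_omega {C : Coring A} (M : RComod S C) (N : LComod C T) {Q : BiMod.{u} S T}
    (g : (M.mod ⊠ C.bim) ⊠ N.mod ⟶ Q) (x : (cotensor M N).carrier) :
    ((cotensorι M N ≫ omega M N ≫ g).fn x) = 0 := by
  have z : cotensorι M N ≫ omega M N = 0 := kerι_comp _
  rw [← Category.assoc, z]
  exact map_zero g.fn

/-- `ω` is right colinear. -/
theorem omega_rcolinear {C : Coring A} {D : Coring B} (M : RComod S C) (N : Bicomod C D) :
    (RComod.tensor M.mod N.toRComod).rco ≫ (omega M N.toLComod ⊠ₘ 𝟙 D.bim) =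
      omega M N.toLComod ≫ (RComod.tensor (M.mod ⊠ C.bim) N.toRComod).rco := by
  change ((𝟙 M.mod ⊠ₘ N.rco) ≫ assocInv M.mod N.mod D.bim) ≫ (omega M N.toLComod ⊠ₘ 𝟙 D.bim) =
    omega M N.toLComod ≫ (𝟙 (M.mod ⊠ C.bim) ⊠ₘ N.rco) ≫ assocInv (M.mod ⊠ C.bim) N.mod D.bim
  rw [omega, sub_tmap, comp_sub', sub_comp']
  congr 1
  · have e := assoc_inv_naturality M.rco (𝟙 N.mod) (𝟙 D.bim)
    rw [tmap_id] at e
    rw [Category.assoc, ← e, tmap_comp_assoc, tmap_comp_assoc]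
    simp
  · have c : ((𝟙 M.mod ⊠ₘ N.lco) ≫ assocInv M.mod C.bim N.mod) ⊠ₘ 𝟙 D.bim =
        ((𝟙 M.mod ⊠ₘ N.lco) ⊠ₘ 𝟙 D.bim) ≫ (assocInv M.mod C.bim N.mod ⊠ₘ 𝟙 D.bim) := by
      rw [tmap_comp, Category.comp_id]
    have e := assoc_inv_naturality (𝟙 M.mod) N.lco (𝟙 D.bim)
    have e' := assoc_inv_naturality (𝟙 M.mod) (𝟙 C.bim) N.rco
    rw [tmap_id] at e'
    have p : assocInv M.mod (C.bim ⊠ N.mod) D.bim ≫ (assocInv M.mod C.bim N.mod ⊠ₘ 𝟙 D.bim) =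
        (𝟙 M.mod ⊠ₘ assocHom C.bim N.mod D.bim) ≫ assocInv M.mod C.bim (N.mod ⊠ D.bim) ≫
          assocInv (M.mod ⊠ C.bim) N.mod D.bim := by
      rw [← reassoc_of% (pentagon_inv M.mod C.bim N.mod D.bim), assocHom_inv, Category.comp_id]
    rw [c]
    simp only [Category.assoc]
    rw [← reassoc_of% e, p, ← reassoc_of% e', tmap_comp_assoc, tmap_comp_assoc, tmap_comp_assoc]
    simp only [Category.assoc, Category.id_comp]
    rw [N.compat]

/-- `ω` is left colinear. -/
theorem omega_lcolinear {C : Coring A} {D : Coring B} (M : Bicomod D C) (N : LComod C T) :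
    (LComod.tensor M.toLComod N.mod).lco ≫ (𝟙 D.bim ⊠ₘ omega M.toRComod N) =
      omega M.toRComod N ≫
        (LComod.tensor (LComod.tensor M.toLComod C.bim) N.mod).lco := by
  change ((M.lco ⊠ₘ 𝟙 N.mod) ≫ assocHom D.bim M.mod N.mod) ≫ (𝟙 D.bim ⊠ₘ omega M.toRComod N) =
    omega M.toRComod N ≫ (((M.lco ⊠ₘ 𝟙 C.bim) ≫ assocHom D.bim M.mod C.bim) ⊠ₘ 𝟙 N.mod) ≫
      assocHom D.bim (M.mod ⊠ C.bim) N.mod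
  rw [omega, tmap_sub, comp_sub', sub_comp']
  congr 1
  · have e := assoc_naturality (𝟙 D.bim) M.rco (𝟙 N.mod)
    rw [Category.assoc, ← e, tmap_comp_assoc, tmap_comp_assoc, M.compat]
  · have c : 𝟙 D.bim ⊠ₘ ((𝟙 M.mod ⊠ₘ N.lco) ≫ assocInv M.mod C.bim N.mod) =
        (𝟙 D.bim ⊠ₘ (𝟙 M.mod ⊠ₘ N.lco)) ≫ (𝟙 D.bim ⊠ₘ assocInv M.mod C.bim N.mod) := by
      rw [tmap_comp, Category.comp_id]
    have c' : ((M.lco ⊠ₘ 𝟙 C.bim) ≫ assocHom D.bim M.mod C.bim) ⊠ₘ 𝟙 N.mod =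
        ((M.lco ⊠ₘ 𝟙 C.bim) ⊠ₘ 𝟙 N.mod) ≫ (assocHom D.bim M.mod C.bim ⊠ₘ 𝟙 N.mod) := by
      rw [tmap_comp, Category.comp_id]
    have e := assoc_naturality (𝟙 D.bim) (𝟙 M.mod) N.lco
    have e' := assoc_inv_naturality M.lco (𝟙 C.bim) (𝟙 N.mod)
    rw [tmap_id] at e e'
    rw [c, c']
    simp only [Category.assoc]
    rw [← reassoc_of% e, ← pentagon_mid, ← reassoc_of% e', tmap_comp_assoc, tmap_comp_assoc]
    simp

/-- The conditions under which `M □_C N` inherits the right coaction of `N`: `ω` is `D`-pure and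
the inclusion of its kernel stays injective after applying `- ⊗ D ⊗ D`. -/
structure CotensorPureRight {C : Coring A} {D : Coring B} (M : RComod S C) (N : Bicomod C D) :
    Prop where
  pure : IsPureRight (omega M N.toLComod) D.bim.carrier
  inj : Function.Injective (cotensorι M N.toLComod ⊠ₘ 𝟙 (D.bim ⊠ D.bim)).fn

/-- The conditions under which `M □_C N` inherits the left coaction of `M`. -/
structure CotensorPureLeft {C : Coring A} {D : Coring B} (M : Bicomod D C) (N : LComod C T) :
    Prop where
  pure : IsPureLeft (omega M.toRComod N) D.bim.carrier
  inj : Function.Injective (𝟙 (D.bim ⊠ D.bim) ⊠ₘ cotensorι M.toRComod N).fn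

/-- The conditions under which `M □_C N` is a bicomodule. -/
structure CotensorPure {C : Coring A} {D : Coring B} {G : Coring E} (M : Bicomod D C)
    (N : Bicomod C G) : Prop where
  right : CotensorPureRight M.toRComod N
  left : CotensorPureLeft M N.toLComod
  inj : Function.Injective
    (𝟙 D.bim ⊠ₘ (cotensorι M.toRComod N.toLComod ⊠ₘ 𝟙 G.bim)).fn

/-- The right `D`-comodule `M □_C N`: its coaction is the restriction of `M ⊗ ρ_N`. -/
noncomputable def cotensorRight {C : Coring A} {D : Coring B} (M : RComod S C) (N : Bicomod C D)
    (h : CotensorPureRight M N) : RComod S D :=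
  RComod.sub (RComod.tensor M.mod N.toRComod) (cotensorι M N.toLComod) (kerι_injective _)
    h.pure.1 h.inj fun x => (h.pure.2 _).1 (by
      exact (congrArg (fun k => (cotensorι M N.toLComod ≫ k).fn x) (omega_rcolinear M N)).trans
        (cotensorι_omega M N.toLComod _ x))

/-- The left `D`-comodule `M □_C N`: its coaction is the restriction of `λ_M ⊗ N`. -/
noncomputable def cotensorLeft {C : Coring A} {D : Coring B} (M : Bicomod D C) (N : LComod C T)
    (h : CotensorPureLeft M N) : LComod D T :=
  LComod.sub (LComod.tensor M.toLComod N.mod) (cotensorι M.toRComod N) (kerι_injective _)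
    h.pure.1 h.inj fun x => (h.pure.2 _).1 (by
      exact (congrArg (fun k => (cotensorι M.toRComod N ≫ k).fn x) (omega_lcolinear M N)).trans
        (cotensorι_omega M.toRComod N _ x))

theorem cotensorRight_rco {C : Coring A} {D : Coring B} (M : RComod S C) (N : Bicomod C D)
    (h : CotensorPureRight M N) :
    (cotensorRight M N h).rco ≫ (cotensorι M N.toLComod ⊠ₘ 𝟙 D.bim) =
      cotensorι M N.toLComod ≫ (RComod.tensor M.mod N.toRComod).rco :=
  liftInj_comp _ h.pure.1 _ _

theorem cotensorLeft_lco {C : Coring A} {D : Coring B} (M : Bicomod D C) (N : LComod C T)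
    (h : CotensorPureLeft M N) :
    (cotensorLeft M N h).lco ≫ (𝟙 D.bim ⊠ₘ cotensorι M.toRComod N) =
      cotensorι M.toRComod N ≫ (LComod.tensor M.toLComod N.mod).lco :=
  liftInj_comp _ h.pure.1 _ _

theorem sub_compat_aux {F : BiMod.{u} B B} {G : BiMod.{u} E E} {K P : BiMod.{u} B E} (i : K ⟶ P)
    (r : K ⟶ K ⊠ G) (l : K ⟶ F ⊠ K) (r' : P ⟶ P ⊠ G) (l' : P ⟶ F ⊠ P)
    (p : r' ≫ (l' ⊠ₘ 𝟙 G) ≫ assocHom F P G = l' ≫ (𝟙 F ⊠ₘ r'))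
    (hr : r ≫ (i ⊠ₘ 𝟙 G) = i ≫ r') (hl : l ≫ (𝟙 F ⊠ₘ i) = i ≫ l') :
    (r ≫ (l ⊠ₘ 𝟙 G) ≫ assocHom F K G) ≫ (𝟙 F ⊠ₘ (i ⊠ₘ 𝟙 G)) =
      (l ≫ (𝟙 F ⊠ₘ r)) ≫ (𝟙 F ⊠ₘ (i ⊠ₘ 𝟙 G)) :=
  calc _ = r ≫ ((l ≫ (𝟙 F ⊠ₘ i)) ⊠ₘ 𝟙 G) ≫ assocHom F P G := by
        rw [Category.assoc, Category.assoc, ← assoc_naturality, tmap_comp_assoc, Category.comp_id]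
    _ = (r ≫ (i ⊠ₘ 𝟙 G)) ≫ (l' ⊠ₘ 𝟙 G) ≫ assocHom F P G := by
        rw [hl, Category.assoc, tmap_comp_assoc, Category.comp_id]
    _ = (l ≫ (𝟙 F ⊠ₘ i)) ≫ (𝟙 F ⊠ₘ r') := by
        rw [hr, Category.assoc, p, hl, Category.assoc]
    _ = _ := by
        rw [Category.assoc, Category.assoc, tmap_comp, tmap_comp, hr, Category.comp_id]

/-- The bicomodule `M □_C N`. -/
noncomputable def cotensorBicomod {C : Coring A} {D : Coring B} {G : Coring E} (M : Bicomod D C)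
    (N : Bicomod C G) (h : CotensorPure M N) : Bicomod D G where
  __ := cotensorLeft M N.toLComod h.left
  __ := cotensorRight M.toRComod N h.right
  compat := by
    refine cancel_inj h.inj ?_
    exact sub_compat_aux (cotensorι M.toRComod N.toLComod)
      (cotensorRight M.toRComod N h.right).rco (cotensorLeft M N.toLComod h.left).lco
      (RComod.tensor M.mod N.toRComod).rco (LComod.tensor M.toLComod N.mod).lco
      (Bicomod.tensor M.toLComod N.toRComod).compat
      (cotensorRight_rco M.toRComod N h.right) (cotensorLeft_lco M N.toLComod h.left)

/-! ### Purity for flat and for coseparable corings -/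

theorem iso_injective {P Q : BiMod.{u} S T} (e : P ≅ Q) : Function.Injective e.hom.fn :=
  Function.LeftInverse.injective (g := e.inv.fn) fun x =>
    congrArg (fun k : P ⟶ P => k.fn x) e.hom_inv_id

theorem cotensorPureRight_of_flat {C : Coring A} {D : Coring B} (hD : LeftFlat D.bim)
    (M : RComod S C) (N : Bicomod C D) : CotensorPureRight M N where
  pure := hD.isPureRight _
  inj := by
    have n := assoc_naturality (cotensorι M N.toLComod) (𝟙 D.bim) (𝟙 D.bim)
    rw [tmap_id] at n
    have h : Function.Injective ((cotensorι M N.toLComod ⊠ₘ 𝟙 D.bim) ⊠ₘ 𝟙 D.bim).fn :=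
      hD.injective _ (hD.injective _ (kerι_injective _))
    have e : cotensorι M N.toLComod ⊠ₘ 𝟙 (D.bim ⊠ D.bim) =
        (assoc _ _ _).inv ≫ ((cotensorι M N.toLComod ⊠ₘ 𝟙 D.bim) ⊠ₘ 𝟙 D.bim) ≫
          (assoc _ _ _).hom := by
      rw [Iso.eq_inv_comp]; exact n.symm
    rw [e]
    exact (iso_injective (assoc _ _ _)).comp (h.comp (iso_injective (assoc _ _ _).symm))

theorem cotensorPureLeft_of_flat {C : Coring A} {D : Coring B} (hD : RightFlat D.bim)
    (M : Bicomod D C) (N : LComod C T) : CotensorPureLeft M N where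
  pure := hD.isPureLeft _
  inj := by
    have n := assoc_inv_naturality (𝟙 D.bim) (𝟙 D.bim) (cotensorι M.toRComod N)
    rw [tmap_id] at n
    have h : Function.Injective (𝟙 D.bim ⊠ₘ (𝟙 D.bim ⊠ₘ cotensorι M.toRComod N)).fn :=
      hD.injective _ (hD.injective _ (kerι_injective _))
    have e : 𝟙 (D.bim ⊠ D.bim) ⊠ₘ cotensorι M.toRComod N =
        (assoc _ _ _).hom ≫ (𝟙 D.bim ⊠ₘ (𝟙 D.bim ⊠ₘ cotensorι M.toRComod N)) ≫
          (assoc _ _ _).inv := by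
      rw [← Iso.inv_comp_eq]; exact n.symm
    rw [e]
    exact (iso_injective (assoc _ _ _).symm).comp (h.comp (iso_injective (assoc _ _ _)))

/-- If `D` is flat as a right module and `G` is flat as a left module, then cotensor products of
`D`-`C`-bicomodules and `C`-`G`-bicomodules are bicomodules. -/
theorem cotensorPure_of_flat {C : Coring A} {D : Coring B} {G : Coring E}
    (hD : RightFlat D.bim) (hG : LeftFlat G.bim) (M : Bicomod D C) (N : Bicomod C G) :
    CotensorPure M N where
  right := cotensorPureRight_of_flat hG _ _
  left := cotensorPureLeft_of_flat hD _ _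
  inj := hD.injective (Hom.l (cotensorι M.toRComod N.toLComod ⊠ₘ 𝟙 G.bim))
    (hG.injective _ (kerι_injective _))

/-- The coring `C` is coseparable: the comultiplication `C → C ⊗_A C` is a section in the category
of `C`-`C`-bicomodules. -/
def Coring.IsCoseparable (C : Coring A) : Prop :=
  ∃ σ : Bicomod.tensor C.regular.toLComod C.regular.toRComod ⟶ C.regular,
    C.comul ≫ σ.hom = 𝟙 C.bim

theorem kerι_sub_comp {P Q : BiMod.{u} S T} (a b : P ⟶ Q) :
    kerι (a - b) ≫ a = kerι (a - b) ≫ b :=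
  eq_of_sub_eq_zero (kerι_comp (a - b))

theorem exists_retraction_of_split {P Q : BiMod.{u} S T} (a b : P ⟶ Q) (θ : Q ⟶ P)
    (h₁ : b ≫ θ = 𝟙 P) (h₂ : a ≫ θ ≫ a = a ≫ θ ≫ b) :
    ∃ π : P ⟶ ker (a - b), kerι (a - b) ≫ π = 𝟙 _ ∧ π ≫ kerι (a - b) = a ≫ θ := by
  have hz : ∀ x, (a - b).fn ((a ≫ θ).fn x) = 0 := fun x =>
    sub_eq_zero.2 (congrArg (fun k : P ⟶ Q => k.fn x) h₂)
  have hz' : ∀ x, ∃ y, (kerι (a - b)).fn y = (a ≫ θ).fn x := fun x =>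
    (exact_kerι (a - b) _).1 (hz x)
  refine ⟨liftInj _ (kerι_injective _) (a ≫ θ) hz', ?_, liftInj_comp _ _ _ _⟩
  refine cancel_inj (kerι_injective (a - b)) ?_
  rw [Category.assoc, liftInj_comp, ← Category.assoc, kerι_sub_comp, Category.assoc, h₁,
    Category.comp_id, Category.id_comp]

theorem isPureRight_of_split {P Q : BiMod.{u} S T} (a b : P ⟶ Q) (θ : Q ⟶ P)
    (h₁ : b ≫ θ = 𝟙 P) (h₂ : a ≫ θ ≫ a = a ≫ θ ≫ b) (Z : BiMod.{u} T A) :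
    IsPureRight (a - b) Z.carrier := by
  obtain ⟨π, hπ, hπ'⟩ := exists_retraction_of_split a b θ h₁ h₂
  refine ⟨?_, ?_⟩
  · refine Function.LeftInverse.injective (g := (π ⊠ₘ 𝟙 Z).fn) fun x => ?_
    have : (kerι (a - b) ⊠ₘ 𝟙 Z) ≫ (π ⊠ₘ 𝟙 Z) = 𝟙 _ := by
      rw [tmap_comp, hπ, Category.comp_id, tmap_id]
    exact congrArg (fun k : ker (a - b) ⊠ Z ⟶ _ => k.fn x) this
  · intro (t : (P ⊠ Z).carrier)
    change ((a - b) ⊠ₘ 𝟙 Z).fn t = 0 ↔ t ∈ Set.range (kerι (a - b) ⊠ₘ 𝟙 Z).fn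
    constructor
    · intro ht
      refine ⟨(π ⊠ₘ 𝟙 Z).fn t, ?_⟩
      rw [sub_tmap, sub_fn, sub_eq_zero] at ht
      have e : (π ⊠ₘ 𝟙 Z) ≫ (kerι (a - b) ⊠ₘ 𝟙 Z) = (a ⊠ₘ 𝟙 Z) ≫ (θ ⊠ₘ 𝟙 Z) := by
        rw [tmap_comp, tmap_comp, hπ']
      have e' : (b ⊠ₘ 𝟙 Z) ≫ (θ ⊠ₘ 𝟙 Z) = 𝟙 _ := by
        rw [tmap_comp, h₁, Category.comp_id, tmap_id]
      have e₁ := congrArg (fun k : P ⊠ Z ⟶ P ⊠ Z => k.fn t) e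
      have e₂ := congrArg (fun k : P ⊠ Z ⟶ P ⊠ Z => k.fn t) e'
      simp only [comp_fn, id_fn] at e₁ e₂
      rw [e₁, ht, e₂]
    · rintro ⟨s, rfl⟩
      rw [sub_tmap, sub_fn, sub_eq_zero, ← comp_fn, ← comp_fn, tmap_comp, tmap_comp,
        kerι_sub_comp]

theorem isPureLeft_of_split {P Q : BiMod.{u} S T} (a b : P ⟶ Q) (θ : Q ⟶ P)
    (h₁ : b ≫ θ = 𝟙 P) (h₂ : a ≫ θ ≫ a = a ≫ θ ≫ b) (Z : BiMod.{u} A S) :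
    IsPureLeft (a - b) Z.carrier := by
  obtain ⟨π, hπ, hπ'⟩ := exists_retraction_of_split a b θ h₁ h₂
  refine ⟨?_, ?_⟩
  · refine Function.LeftInverse.injective (g := (𝟙 Z ⊠ₘ π).fn) fun x => ?_
    have : (𝟙 Z ⊠ₘ kerι (a - b)) ≫ (𝟙 Z ⊠ₘ π) = 𝟙 _ := by
      rw [tmap_comp, hπ, Category.comp_id, tmap_id]
    exact congrArg (fun k : Z ⊠ ker (a - b) ⟶ _ => k.fn x) this
  · intro (t : (Z ⊠ P).carrier)
    change (𝟙 Z ⊠ₘ (a - b)).fn t = 0 ↔ t ∈ Set.range (𝟙 Z ⊠ₘ kerι (a - b)).fn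
    constructor
    · intro ht
      refine ⟨(𝟙 Z ⊠ₘ π).fn t, ?_⟩
      rw [tmap_sub, sub_fn, sub_eq_zero] at ht
      have e : (𝟙 Z ⊠ₘ π) ≫ (𝟙 Z ⊠ₘ kerι (a - b)) = (𝟙 Z ⊠ₘ a) ≫ (𝟙 Z ⊠ₘ θ) := by
        rw [tmap_comp, tmap_comp, hπ']
      have e' : (𝟙 Z ⊠ₘ b) ≫ (𝟙 Z ⊠ₘ θ) = 𝟙 _ := by
        rw [tmap_comp, h₁, Category.comp_id, tmap_id]
      have e₁ := congrArg (fun k : Z ⊠ P ⟶ Z ⊠ P => k.fn t) e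
      have e₂ := congrArg (fun k : Z ⊠ P ⟶ Z ⊠ P => k.fn t) e'
      simp only [comp_fn, id_fn] at e₁ e₂
      rw [e₁, ht, e₂]
    · rintro ⟨s, rfl⟩
      rw [tmap_sub, sub_fn, sub_eq_zero, ← comp_fn, ← comp_fn, tmap_comp, tmap_comp,
        kerι_sub_comp]

theorem assoc_triangle (M : BiMod.{u} S A) (N : BiMod.{u} A T) :
    assocHom M (unit A) N ≫ (𝟙 M ⊠ₘ lunit N) = runit M ⊠ₘ 𝟙 N :=
  tensor_ext₃ fun m (a : A) n => (tmk_smul a m n).symm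

theorem lunit_naturality {M N : BiMod.{u} A T} (f : M ⟶ N) :
    lunit M ≫ f = (𝟙 (unit A) ⊠ₘ f) ≫ lunit N :=
  tensor_ext fun (_ : A) _ => f.map_lsmul _ _

/-- For coseparable `C` the map `ω` is the difference of a split pair. -/
theorem omega_split {C : Coring A} (hC : C.IsCoseparable) (M : RComod S C) (N : LComod C T) :
    ∃ θ : (M.mod ⊠ C.bim) ⊠ N.mod ⟶ M.mod ⊠ N.mod,
      ((𝟙 M.mod ⊠ₘ N.lco) ≫ assocInv M.mod C.bim N.mod) ≫ θ = 𝟙 _ ∧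
      (M.rco ⊠ₘ 𝟙 N.mod) ≫ θ ≫ (M.rco ⊠ₘ 𝟙 N.mod) =
        (M.rco ⊠ₘ 𝟙 N.mod) ≫ θ ≫ (𝟙 M.mod ⊠ₘ N.lco) ≫ assocInv M.mod C.bim N.mod := by
  obtain ⟨⟨σ, hl, hr⟩, hσ⟩ := hC
  change C.bim ⊠ C.bim ⟶ C.bim at σ
  change C.comul ≫ σ = 𝟙 C.bim at hσ
  change σ ≫ C.comul = ((C.comul ⊠ₘ 𝟙 C.bim) ≫ assocHom _ _ _) ≫ (𝟙 C.bim ⊠ₘ σ) at hl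
  change σ ≫ C.comul = ((𝟙 C.bim ⊠ₘ C.comul) ≫ assocInv _ _ _) ≫ (σ ⊠ₘ 𝟙 C.bim) at hr
  obtain ⟨s, hs⟩ : ∃ s : C.bim ⊠ N.mod ⟶ C.bim ⊠ N.mod,
    s = (𝟙 C.bim ⊠ₘ N.lco) ≫ assocInv C.bim C.bim N.mod ≫ (σ ⊠ₘ 𝟙 N.mod) := ⟨_, rfl⟩
  obtain ⟨t, ht⟩ : ∃ t : C.bim ⊠ N.mod ⟶ N.mod,
    t = s ≫ (C.counit ⊠ₘ 𝟙 N.mod) ≫ lunit N.mod := ⟨_, rfl⟩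
  have h1 : N.lco ≫ t = 𝟙 _ := by
    have h := N.lcoassoc
    rw [ht, hs]
    simp only [Category.assoc]
    rw [← reassoc_of% h, reassoc_of% assocHom_inv, tmap_comp_assoc, hσ, Category.comp_id,
      tmap_id, Category.id_comp]
    exact N.lcounit
  have hsc : s ≫ (𝟙 C.bim ⊠ₘ N.lco) = s ≫ (C.comul ⊠ₘ 𝟙 N.mod) ≫ assocHom _ _ _ := by
    have p : (𝟙 C.bim ⊠ₘ assocHom C.bim C.bim N.mod) ≫ assocInv C.bim C.bim (C.bim ⊠ N.mod) =
        assocInv C.bim (C.bim ⊠ C.bim) N.mod ≫ (assocInv C.bim C.bim C.bim ⊠ₘ 𝟙 N.mod) ≫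
          assocHom (C.bim ⊠ C.bim) C.bim N.mod := (pentagon_inv _ _ _ _).symm
    have e₁ := assoc_inv_naturality (𝟙 C.bim) (𝟙 C.bim) N.lco
    have e₂ := assoc_inv_naturality (𝟙 C.bim) C.comul (𝟙 N.mod)
    have e₃ := assoc_naturality σ (𝟙 C.bim) (𝟙 N.mod)
    rw [tmap_id] at e₁ e₃
    calc _ = (𝟙 C.bim ⊠ₘ N.lco) ≫ (𝟙 C.bim ⊠ₘ (𝟙 C.bim ⊠ₘ N.lco)) ≫
          assocInv C.bim C.bim (C.bim ⊠ N.mod) ≫ (σ ⊠ₘ 𝟙 (C.bim ⊠ N.mod)) := by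
          rw [reassoc_of% e₁, hs]
          simp only [Category.assoc, tmap_comp, Category.comp_id, Category.id_comp]
      _ = (𝟙 C.bim ⊠ₘ (N.lco ≫ (C.comul ⊠ₘ 𝟙 N.mod) ≫ assocHom _ _ _)) ≫
          assocInv C.bim C.bim (C.bim ⊠ N.mod) ≫ (σ ⊠ₘ 𝟙 (C.bim ⊠ N.mod)) := by
          rw [tmap_comp_assoc, N.lcoassoc, Category.comp_id]
      _ = (𝟙 C.bim ⊠ₘ N.lco) ≫ (𝟙 C.bim ⊠ₘ (C.comul ⊠ₘ 𝟙 N.mod)) ≫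
          ((𝟙 C.bim ⊠ₘ assocHom C.bim C.bim N.mod) ≫ assocInv C.bim C.bim (C.bim ⊠ N.mod)) ≫
            (σ ⊠ₘ 𝟙 (C.bim ⊠ N.mod)) := by
          simp only [Category.assoc, tmap_comp_assoc, Category.comp_id]
      _ = (𝟙 C.bim ⊠ₘ N.lco) ≫ assocInv C.bim C.bim N.mod ≫
          ((((𝟙 C.bim ⊠ₘ C.comul) ≫ assocInv _ _ _) ≫ (σ ⊠ₘ 𝟙 C.bim)) ⊠ₘ 𝟙 N.mod) ≫
            assocHom C.bim C.bim N.mod := by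
          rw [p, Category.assoc, Category.assoc, ← e₃, reassoc_of% e₂]
          simp only [Category.assoc, tmap_comp_assoc, Category.comp_id]
      _ = _ := by
          rw [← hr, hs]
          simp only [Category.assoc, tmap_comp_assoc, Category.comp_id]
  have h2 : t ≫ N.lco = s := by
    have e₁ := lunit_naturality N.lco
    have e₂ := assoc_naturality C.counit (𝟙 C.bim) (𝟙 N.mod)
    rw [tmap_id] at e₂
    calc _ = (s ≫ (𝟙 C.bim ⊠ₘ N.lco)) ≫ (C.counit ⊠ₘ 𝟙 (C.bim ⊠ N.mod)) ≫ lunit _ := by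
          rw [ht]
          simp only [Category.assoc]
          rw [e₁]
          simp only [tmap_comp_assoc, Category.comp_id, Category.id_comp]
      _ = s ≫ ((C.comul ≫ (C.counit ⊠ₘ 𝟙 C.bim) ≫ lunit C.bim) ⊠ₘ 𝟙 N.mod) := by
          rw [hsc, Category.assoc, Category.assoc, ← reassoc_of% e₂, assoc_lunit, tmap_comp,
            tmap_comp, Category.comp_id, Category.comp_id]
      _ = s := by rw [C.counit_left, tmap_id, Category.comp_id]
  have h3 : (C.comul ⊠ₘ 𝟙 N.mod) ≫ assocHom _ _ _ ≫ (𝟙 C.bim ⊠ₘ t) = s := by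
    have e₁ := assoc_naturality (𝟙 C.bim) (𝟙 C.bim) N.lco
    have e₂ := assoc_inv_naturality C.comul (𝟙 C.bim) (𝟙 N.mod)
    have e₃ := assoc_naturality (𝟙 C.bim) σ (𝟙 N.mod)
    have e₄ := assoc_naturality (𝟙 C.bim) C.counit (𝟙 N.mod)
    rw [tmap_id] at e₁ e₂
    have c : 𝟙 C.bim ⊠ₘ t = (𝟙 C.bim ⊠ₘ (𝟙 C.bim ⊠ₘ N.lco)) ≫
        (𝟙 C.bim ⊠ₘ assocInv C.bim C.bim N.mod) ≫ (𝟙 C.bim ⊠ₘ (σ ⊠ₘ 𝟙 N.mod)) ≫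
          (𝟙 C.bim ⊠ₘ (C.counit ⊠ₘ 𝟙 N.mod)) ≫ (𝟙 C.bim ⊠ₘ lunit N.mod) := by
      rw [ht, hs]
      simp only [tmap_comp, Category.comp_id, Category.assoc]
    calc _ = (𝟙 C.bim ⊠ₘ N.lco) ≫ (C.comul ⊠ₘ 𝟙 (C.bim ⊠ N.mod)) ≫
          (assocHom C.bim C.bim (C.bim ⊠ N.mod) ≫ (𝟙 C.bim ⊠ₘ assocInv C.bim C.bim N.mod)) ≫
          (𝟙 C.bim ⊠ₘ (σ ⊠ₘ 𝟙 N.mod)) ≫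
          (𝟙 C.bim ⊠ₘ (C.counit ⊠ₘ 𝟙 N.mod)) ≫ (𝟙 C.bim ⊠ₘ lunit N.mod) := by
          rw [c, ← reassoc_of% e₁]
          simp only [Category.assoc, tmap_comp_assoc, Category.comp_id, Category.id_comp]
      _ = (𝟙 C.bim ⊠ₘ N.lco) ≫ assocInv C.bim C.bim N.mod ≫
          ((((C.comul ⊠ₘ 𝟙 C.bim) ≫ assocHom _ _ _) ≫ (𝟙 C.bim ⊠ₘ σ)) ⊠ₘ 𝟙 N.mod) ≫
          ((𝟙 C.bim ⊠ₘ C.counit) ⊠ₘ 𝟙 N.mod) ≫ (runit C.bim ⊠ₘ 𝟙 N.mod) := by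
          rw [← pentagon_mid]
          simp only [Category.assoc]
          rw [← reassoc_of% e₃, ← reassoc_of% e₄, assoc_triangle, reassoc_of% e₂]
          simp only [Category.assoc, tmap_comp_assoc, tmap_comp, Category.comp_id]
      _ = s ≫ ((C.comul ≫ (𝟙 C.bim ⊠ₘ C.counit) ≫ runit C.bim) ⊠ₘ 𝟙 N.mod) := by
          rw [← hl, hs]
          simp only [Category.assoc, tmap_comp, Category.comp_id]
      _ = s := by rw [C.counit_right, tmap_id, Category.comp_id]
  refine ⟨assocHom _ _ _ ≫ (𝟙 M.mod ⊠ₘ t), ?_, ?_⟩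
  · rw [Category.assoc, reassoc_of% assocInv_hom, tmap_comp, h1, Category.comp_id, tmap_id]
  · have e₁ := assoc_naturality M.rco (𝟙 C.bim) (𝟙 N.mod)
    have e₂ := assoc_naturality (𝟙 M.mod) C.comul (𝟙 N.mod)
    have e₃ := assoc_inv_naturality (𝟙 M.mod) (𝟙 C.bim) t
    rw [tmap_id] at e₁ e₃
    have r : M.rco ≫ (M.rco ⊠ₘ 𝟙 C.bim) =
        M.rco ≫ (𝟙 M.mod ⊠ₘ C.comul) ≫ assocInv M.mod C.bim C.bim := by
      rw [← reassoc_of% M.rcoassoc, assocHom_inv, Category.comp_id]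
    calc _ = (M.rco ⊠ₘ 𝟙 N.mod) ≫ assocHom _ _ _ ≫ (M.rco ⊠ₘ 𝟙 (C.bim ⊠ N.mod)) ≫
          (𝟙 (M.mod ⊠ C.bim) ⊠ₘ t) := by
          simp only [Category.assoc, tmap_comp, Category.comp_id, Category.id_comp]
      _ = ((M.rco ≫ (M.rco ⊠ₘ 𝟙 C.bim)) ⊠ₘ 𝟙 N.mod) ≫ assocHom _ _ _ ≫
          (𝟙 (M.mod ⊠ C.bim) ⊠ₘ t) := by
          rw [← reassoc_of% e₁, tmap_comp_assoc, Category.comp_id]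
      _ = (M.rco ⊠ₘ 𝟙 N.mod) ≫ ((𝟙 M.mod ⊠ₘ C.comul) ⊠ₘ 𝟙 N.mod) ≫
          (assocInv M.mod C.bim C.bim ⊠ₘ 𝟙 N.mod) ≫ assocHom _ _ _ ≫
          (𝟙 (M.mod ⊠ C.bim) ⊠ₘ t) := by
          rw [r]
          simp only [tmap_comp_assoc, Category.comp_id]
      _ = (M.rco ⊠ₘ 𝟙 N.mod) ≫ ((𝟙 M.mod ⊠ₘ C.comul) ⊠ₘ 𝟙 N.mod) ≫
          assocHom _ _ _ ≫ (𝟙 M.mod ⊠ₘ assocHom C.bim C.bim N.mod) ≫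
          (𝟙 M.mod ⊠ₘ (𝟙 C.bim ⊠ₘ t)) ≫ assocInv _ _ _ := by
          have p : (assocInv M.mod C.bim C.bim ⊠ₘ 𝟙 N.mod) ≫ assocHom _ _ _ =
              assocHom M.mod (C.bim ⊠ C.bim) N.mod ≫
                (𝟙 M.mod ⊠ₘ assocHom C.bim C.bim N.mod) ≫ assocInv _ _ _ := by
            rw [← pentagon_inv, reassoc_of% assocHom_inv]
          rw [reassoc_of% p, e₃]
      _ = _ := by
          rw [reassoc_of% e₂]
          simp only [Category.assoc, tmap_comp_assoc, Category.comp_id]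
          rw [h3, h2]

theorem coseparable_retraction {C : Coring A} (hC : C.IsCoseparable) (M : RComod S C)
    (N : LComod C T) : ∃ π : M.mod ⊠ N.mod ⟶ cotensor M N, cotensorι M N ≫ π = 𝟙 _ := by
  obtain ⟨θ, h₁, h₂⟩ := omega_split hC M N
  obtain ⟨π, h, -⟩ := exists_retraction_of_split _ _ θ h₁ h₂
  exact ⟨π, h⟩

theorem injective_of_retraction {P Q : BiMod.{u} S T} {i : P ⟶ Q} {π : Q ⟶ P}
    (h : i ≫ π = 𝟙 P) : Function.Injective i.fn :=
  Function.LeftInverse.injective (g := π.fn) fun x => congrArg (fun k : P ⟶ P => k.fn x) h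

/-- If `C` is coseparable, then cotensor products over `C` of bicomodules are bicomodules. -/
theorem cotensorPure_of_coseparable {C : Coring A} {D : Coring B} {G : Coring E}
    (hC : C.IsCoseparable) (M : Bicomod D C) (N : Bicomod C G) : CotensorPure M N := by
  obtain ⟨θ, h₁, h₂⟩ := omega_split hC M.toRComod N.toLComod
  obtain ⟨π, h⟩ := coseparable_retraction hC M.toRComod N.toLComod
  refine ⟨⟨isPureRight_of_split _ _ θ h₁ h₂ _, ?_⟩, ⟨isPureLeft_of_split _ _ θ h₁ h₂ _, ?_⟩, ?_⟩
  · exact injective_of_retraction (π := π ⊠ₘ 𝟙 _) (by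
      rw [tmap_comp, h, Category.comp_id, tmap_id])
  · exact injective_of_retraction (π := 𝟙 _ ⊠ₘ π) (by
      rw [tmap_comp, h, Category.comp_id, tmap_id])
  · exact injective_of_retraction (π := 𝟙 _ ⊠ₘ (π ⊠ₘ 𝟙 _)) (by
      rw [tmap_comp, tmap_comp, h, Category.comp_id, Category.comp_id, tmap_id, tmap_id])

/-! ### Functoriality of the cotensor product -/

theorem omega_naturality {C : Coring A} {M M' : RComod S C} {N N' : LComod C T} (f : M ⟶ M')
    (g : N ⟶ N') : (f.hom ⊠ₘ g.hom) ≫ omega M' N' =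
      omega M N ≫ ((f.hom ⊠ₘ 𝟙 C.bim) ⊠ₘ g.hom) := by
  rw [omega, omega, comp_sub', sub_comp']
  congr 1
  · rw [tmap_comp, tmap_comp, f.colinear, Category.comp_id, Category.id_comp]
  · rw [tmap_comp_assoc, g.colinear, Category.comp_id, Category.assoc,
      ← assoc_inv_naturality f.hom (𝟙 C.bim) g.hom, tmap_comp_assoc, Category.id_comp]

/-- The map `f □_C g : M □_C N → M' □_C N'`, the restriction of `f ⊗ g`. -/
noncomputable def cotensorMap {C : Coring A} {M M' : RComod S C} {N N' : LComod C T} (f : M ⟶ M')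
    (g : N ⟶ N') : cotensor M N ⟶ cotensor M' N' :=
  liftInj (cotensorι M' N') (kerι_injective _) (cotensorι M N ≫ (f.hom ⊠ₘ g.hom)) fun x =>
    (exact_kerι (omega M' N') _).1 (by
      have e := congrArg (fun k => (cotensorι M N ≫ k).fn x) (omega_naturality f g)
      exact e.trans (cotensorι_omega M N _ x))

theorem cotensorMap_ι {C : Coring A} {M M' : RComod S C} {N N' : LComod C T} (f : M ⟶ M')
    (g : N ⟶ N') :
    cotensorMap f g ≫ cotensorι M' N' = cotensorι M N ≫ (f.hom ⊠ₘ g.hom) :=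
  liftInj_comp _ (kerι_injective _) _ _

theorem sub_colinear_aux {G : BiMod.{u} B B} {K K' P P' : BiMod.{u} S B} (i : K ⟶ P)
    (i' : K' ⟶ P') (c : K ⟶ K') (p : P ⟶ P') (r : K ⟶ K ⊠ G) (r' : K' ⟶ K' ⊠ G)
    (s : P ⟶ P ⊠ G) (s' : P' ⟶ P' ⊠ G) (e : c ≫ i' = i ≫ p)
    (hr : r ≫ (i ⊠ₘ 𝟙 G) = i ≫ s) (hr' : r' ≫ (i' ⊠ₘ 𝟙 G) = i' ≫ s')
    (n : p ≫ s' = s ≫ (p ⊠ₘ 𝟙 G)) :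
    (c ≫ r') ≫ (i' ⊠ₘ 𝟙 G) = (r ≫ (c ⊠ₘ 𝟙 G)) ≫ (i' ⊠ₘ 𝟙 G) := by
  rw [Category.assoc, hr', reassoc_of% e, n, ← reassoc_of% hr, Category.assoc, tmap_comp,
    tmap_comp, e]

/-- For a `C`-`D`-bicomodule `X` with `_B D` flat, the functor `- □_C X : M^C → M^D` from right
`C`-comodules to right `D`-comodules. -/
noncomputable def cotensorFunctor {C : Coring A} {D : Coring B} (hD : LeftFlat D.bim)
    (X : Bicomod C D) : RComod.{u} ℤ C ⥤ RComod.{u} ℤ D where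
  obj M := cotensorRight M X (cotensorPureRight_of_flat hD M X)
  map {M M'} f := ⟨cotensorMap f (𝟙 X.toLComod), by
    have e := cotensorMap_ι f (𝟙 X.toLComod)
    have r := cotensorRight_rco M X (cotensorPureRight_of_flat hD M X)
    have r' := cotensorRight_rco M' X (cotensorPureRight_of_flat hD M' X)
    have n : (f.hom ⊠ₘ 𝟙 X.mod) ≫ (RComod.tensor M'.mod X.toRComod).rco =
        (RComod.tensor M.mod X.toRComod).rco ≫ ((f.hom ⊠ₘ 𝟙 X.mod) ⊠ₘ 𝟙 D.bim) := by
      change (f.hom ⊠ₘ 𝟙 X.mod) ≫ (𝟙 M'.mod ⊠ₘ X.rco) ≫ assocInv M'.mod X.mod D.bim =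
        ((𝟙 M.mod ⊠ₘ X.rco) ≫ assocInv M.mod X.mod D.bim) ≫ ((f.hom ⊠ₘ 𝟙 X.mod) ⊠ₘ 𝟙 D.bim)
      rw [Category.assoc, ← assoc_inv_naturality, tmap_id, tmap_comp_assoc, tmap_comp_assoc]
      simp
    exact cancel_inj (i := cotensorι M' X.toLComod ⊠ₘ 𝟙 D.bim)
      (cotensorPureRight_of_flat hD M' X).pure.1 (sub_colinear_aux _ _ _ _ _ _ _ _ e r r' n)⟩
  map_id M := RComod.hom_ext (cancel_inj (kerι_injective _) ((cotensorMap_ι _ _).trans (by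
    simp only [RComod.id_hom, LComod.id_hom, tmap_id]
    rfl)))
  map_comp {M M' M''} f g := RComod.hom_ext (cancel_inj (i := cotensorι M'' X.toLComod)
    (kerι_injective _) (by
      change cotensorMap (f ≫ g) (𝟙 X.toLComod) ≫ cotensorι M'' X.toLComod =
        (cotensorMap f (𝟙 X.toLComod) ≫ cotensorMap g (𝟙 X.toLComod)) ≫ _
      rw [Category.assoc, cotensorMap_ι, cotensorMap_ι, reassoc_of% (cotensorMap_ι f),
        tmap_comp]
      simp))

/-- `(- □_C X, - □_D Λ)` is a pair of inverse equivalences between `M^C` and `M^D`. -/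
def IsInverseEquivalencePair {C : Coring A} {D : Coring B} (hC : LeftFlat C.bim)
    (hD : LeftFlat D.bim) (X : Bicomod C D) (Λ : Bicomod D C) : Prop :=
  Nonempty (𝟭 (RComod.{u} ℤ C) ≅ cotensorFunctor hD X ⋙ cotensorFunctor hC Λ) ∧
    Nonempty (cotensorFunctor hC Λ ⋙ cotensorFunctor hD X ≅ 𝟭 (RComod.{u} ℤ D))

/-- The left `C`-comodule `N` is coflat: the functor `- □_C N` from right `C`-comodules to abelian
groups preserves short exact sequences. -/
def LComod.IsCoflat {C : Coring A} (N : LComod C T) : Prop :=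
  ∀ (M M' M'' : RComod.{u} ℤ C) (f : M ⟶ M') (g : M' ⟶ M''),
    Function.Injective f.hom.fn → Function.Exact f.hom.fn g.hom.fn →
    Function.Surjective g.hom.fn →
    Function.Injective (cotensorMap f (𝟙 N)).fn ∧
      Function.Exact (cotensorMap f (𝟙 N)).fn (cotensorMap g (𝟙 N)).fn ∧
      Function.Surjective (cotensorMap g (𝟙 N)).fn

/-- The canonical map `M □_C C → M`, `m ⊗ c ↦ m ε(c)`. -/
def cotensorRegularRight {C : Coring A} (M : RComod S C) :
    cotensor M C.regular.toLComod ⟶ M.mod :=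
  cotensorι M C.regular.toLComod ≫ (𝟙 M.mod ⊠ₘ C.counit) ≫ runit M.mod

/-- The canonical map `C □_C N → N`, `c ⊗ n ↦ ε(c) n`. -/
def cotensorRegularLeft {C : Coring A} (N : LComod C T) :
    cotensor C.regular.toRComod N ⟶ N.mod :=
  cotensorι C.regular.toRComod N ≫ (C.counit ⊠ₘ 𝟙 N.mod) ≫ lunit N.mod

/-- Commutativity of the square with corner `Λ □_C X □_D Λ`, whose two paths are
`Λ □_C X □_D Λ → Λ □_C C ≅ Λ` (through `f`) and `Λ □_C X □_D Λ → D □_D Λ ≅ Λ` (through `g`).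
Here `(Λ □_C X) □_D Λ` and `Λ □_C (X □_D Λ)` are identified by the isomorphism `α` which is
compatible with the inclusions into `Λ ⊗ X ⊗ Λ`. -/
def SquareCommutes {C : Coring A} {D : Coring B} (X : Bicomod C D) (Λ : Bicomod D C)
    (hXΛ : CotensorPure X Λ) (hΛX : CotensorPure Λ X)
    (f : cotensorBicomod X Λ hXΛ ⟶ C.regular) (g : cotensorBicomod Λ X hΛX ⟶ D.regular) : Prop :=
  ∃ α : cotensor (cotensorBicomod Λ X hΛX).toRComod Λ.toLComod ≅
      cotensor Λ.toRComod (cotensorBicomod X Λ hXΛ).toLComod,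
    α.hom ≫ cotensorι Λ.toRComod (cotensorBicomod X Λ hXΛ).toLComod ≫
        (𝟙 Λ.mod ⊠ₘ cotensorι X.toRComod Λ.toLComod) =
      cotensorι (cotensorBicomod Λ X hΛX).toRComod Λ.toLComod ≫
        (cotensorι Λ.toRComod X.toLComod ⊠ₘ 𝟙 Λ.mod) ≫ assocHom Λ.mod X.mod Λ.mod ∧
    α.hom ≫ cotensorMap (𝟙 Λ.toRComod) f.toL ≫ cotensorRegularRight Λ.toRComod =
      cotensorMap g.toR (𝟙 Λ.toLComod) ≫ cotensorRegularLeft Λ.toLComod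

/-- The ring `R` is von Neumann regular. -/
def IsVonNeumannRegular (R : Type u) [Ring R] : Prop := ∀ a : R, ∃ x : R, a * x * a = a

end CoringTheory

open CoringTheory CoringTheory.BiMod

universe u

/-!
# Equivalences between comodule categories given by cotensor products

Write `S = - □_C X` and `T = - □_D Λ`. Everything is reduced to maps into plain tensor products:
`(M □_C X) □_D Λ` maps to `(M ⊗ X) ⊗ Λ` (`iterι`), and an isomorphism `f : X □_D Λ ≅ C` amounts to a
map `j : C → X ⊗ Λ` which is colinear on both sides and takes values in `X □_D Λ` (`IsCopairing`).
Such a `j` gives a natural map `theta M j : M → (M ⊗ X) ⊗ Λ`, `m ↦ m₀ ⊗ j(m₁)`.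

**Isomorphisms give an equivalence.** If `ω_{M,X}` and `ω_{X,Λ}` are pure enough for
`(M □_C X) □_D Λ = M □_C (X □_D Λ)` to hold inside `M ⊗ X ⊗ Λ` (`AssocPure`), then `theta M j` is an
isomorphism onto `(M □_C X) □_D Λ`, whence `1 ≅ T S` (`nonempty_natIso_of_iso`); `1 ≅ S T` follows
by symmetry. Condition (a) gives this purity at once, and so does coseparability, which splits all
the maps `ω`. Condition (b) implies (a): if `X` is coflat, then `W ⊗ X` embeds naturally into
`(W ⊗ C) □_C X`, which is exact in `W`, so that `X` is flat (`LComod.IsCoflat.leftFlat`); and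
comparing `W ⊗ (X □_D Λ)` with `(W ⊗ X) □_D Λ`, both right exact in `W`, along a free
presentation of `W` shows that `ω_{X,Λ}` is pure (`isPureLeftModuleMap_of_coflat`). Over a von
Neumann regular ring every module is flat, since all its character modules are injective by Baer's
criterion; hence (a) holds.

**An equivalence gives isomorphisms.** As `C` and `D` are left flat, monomorphisms of comodules are
injective and epimorphisms are surjective, so an equivalence `S` is exact, that is, `X` is coflat
(`isCoflat_of_isEquivalence`), and `iterι` is injective. By naturality with respect to the comodule
maps `m ⊗ - : C → M ⊗ C` and the coactions `M → M ⊗ C`, the unit `M → (M □_C X) □_D Λ`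
is `theta M j` for a unique candidate `j` (`exists_theta`); its properties at `M = C` show that `j`
is a copairing and an isomorphism onto `X □_D Λ` (`exists_iso_of_natIso`).

**The two squares.** Choose the unit `η` and the counit so that the triangle identities hold, and let
`l : D → Λ ⊗ X` belong to the inverse `ε` of the counit. The identity `η_{T N} = T(ε_N)` for
`N = D`, evaluated at `v₋₁ ⊗ v₀ ∈ D □_D Λ`, reads `v₀ ⊗ j(v₁) = l(v₋₁) ⊗ v₀` in `Λ ⊗ X ⊗ Λ`
(`compat_of_triangle`). Hence the isomorphisms from `Λ` to `Λ □_C (X □_D Λ)` and to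
`(Λ □_C X) □_D Λ` given by `f` and `g` agree inside `Λ ⊗ X ⊗ Λ`, and the isomorphism of the two
iterated cotensor products through `Λ` makes the square commute (`squareCommutes_of_compat`).
-/

open CategoryTheory
open scoped TensorProduct

namespace CoringTheory

universe v w

attribute [-instance] CategoryTheory.catToReflQuiver

variable {A B E : Type u} [Ring A] [Ring B] [Ring E] {S : Type v} [Ring S] {T : Type w} [Ring T]

/-! ### Contraction with the counit -/

theorem fn_congr {M N : BiMod.{u} S T} {f g : M ⟶ N} (h : f = g) (m : M.carrier) :
    f.fn m = g.fn m := by rw [h]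

theorem runit_naturality {M N : BiMod.{u} S A} (f : M ⟶ N) :
    runit M ≫ f = (f ⊠ₘ 𝟙 (unit A)) ≫ runit N :=
  tensor_ext fun _ (_ : A) => f.map_rsmul _ _

/-- The contraction `C ⊗ N → N`, `c ⊗ n ↦ ε(c) n`. -/
def counitLeft (C : Coring A) (N : BiMod.{u} A T) : C.bim ⊠ N ⟶ N :=
  (C.counit ⊠ₘ 𝟙 N) ≫ lunit N

/-- The contraction `M ⊗ C → M`, `m ⊗ c ↦ m ε(c)`. -/
def counitRight (C : Coring A) (M : BiMod.{u} S A) : M ⊠ C.bim ⟶ M :=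
  (𝟙 M ⊠ₘ C.counit) ≫ runit M

section counit

variable (C : Coring A)

theorem counitLeft_naturality {N N' : BiMod.{u} A T} (f : N ⟶ N') :
    (𝟙 C.bim ⊠ₘ f) ≫ counitLeft C N' = counitLeft C N ≫ f := by
  rw [counitLeft, counitLeft, Category.assoc, lunit_naturality, tmap_comp_assoc, tmap_comp_assoc]
  simp

theorem counitRight_naturality {M M' : BiMod.{u} S A} (f : M ⟶ M') :
    (f ⊠ₘ 𝟙 C.bim) ≫ counitRight C M' = counitRight C M ≫ f := by
  rw [counitRight, counitRight, Category.assoc, runit_naturality, tmap_comp_assoc,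
    tmap_comp_assoc]
  simp

theorem assocInv_counitLeft (N : BiMod.{u} A E) (P : BiMod.{u} E T) :
    assocInv C.bim N P ≫ (counitLeft C N ⊠ₘ 𝟙 P) = counitLeft C (N ⊠ P) :=
  tensor_ext₃' fun _ _ _ => rfl

theorem assocInv_counitRight (M : BiMod.{u} S E) (N : BiMod.{u} E A) :
    assocInv M N C.bim ≫ counitRight C (M ⊠ N) = 𝟙 M ⊠ₘ counitRight C N :=
  tensor_ext₃' fun _ _ _ => rfl

theorem assocInv_counit_mid (M : BiMod.{u} S A) (N : BiMod.{u} A T) :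
    assocInv M C.bim N ≫ (counitRight C M ⊠ₘ 𝟙 N) = 𝟙 M ⊠ₘ counitLeft C N :=
  tensor_ext₃' fun m c n => tmk_smul (M := M) (N := N) (C.counit.fn c : A) m n

theorem comul_counitLeft : C.comul ≫ counitLeft C C.bim = 𝟙 _ := C.counit_left

theorem comul_counitRight : C.comul ≫ counitRight C C.bim = 𝟙 _ := C.counit_right

variable {C}

theorem lco_counitLeft (N : LComod C T) : N.lco ≫ counitLeft C N.mod = 𝟙 _ := N.lcounit

theorem rco_counitRight (M : RComod S C) : M.rco ≫ counitRight C M.mod = 𝟙 _ := M.rcounit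

theorem rco_injective (M : RComod S C) : Function.Injective M.rco.fn :=
  injective_of_retraction (rco_counitRight M)

theorem id_tmap_comp {F : Type*} [Ring F] {N P Q : BiMod.{u} F T} (M : BiMod.{u} S F)
    (f : N ⟶ P) (g : P ⟶ Q) : 𝟙 M ⊠ₘ (f ≫ g) = (𝟙 M ⊠ₘ f) ≫ (𝟙 M ⊠ₘ g) := by
  rw [tmap_comp, Category.comp_id]

theorem comp_tmap_id {F : Type*} [Ring F] {N P Q : BiMod.{u} S F} (M : BiMod.{u} F T)
    (f : N ⟶ P) (g : P ⟶ Q) : (f ≫ g) ⊠ₘ 𝟙 M = (f ⊠ₘ 𝟙 M) ≫ (g ⊠ₘ 𝟙 M) := by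
  rw [tmap_comp, Category.comp_id]

theorem assocInv_id_tmap {F G : Type*} [Ring F] [Ring G] (M : BiMod.{u} S F) (N : BiMod.{u} F G)
    {P P' : BiMod.{u} G T} (h : P ⟶ P') :
    assocInv M N P ≫ (𝟙 (M ⊠ N) ⊠ₘ h) = (𝟙 M ⊠ₘ (𝟙 N ⊠ₘ h)) ≫ assocInv M N P' := by
  rw [assoc_inv_naturality, tmap_id]

theorem assocInv_tmap_id {F G : Type*} [Ring F] [Ring G] {M M' : BiMod.{u} S F} (h : M ⟶ M')
    (N : BiMod.{u} F G) (P : BiMod.{u} G T) :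
    (h ⊠ₘ 𝟙 (N ⊠ P)) ≫ assocInv M' N P = assocInv M N P ≫ ((h ⊠ₘ 𝟙 N) ⊠ₘ 𝟙 P) := by
  rw [← assoc_inv_naturality, tmap_id]

theorem assocInv_mid {F G : Type*} [Ring F] [Ring G] (M : BiMod.{u} S F)
    {N N' : BiMod.{u} F G} (h : N ⟶ N') (P : BiMod.{u} G T) :
    assocInv M N P ≫ ((𝟙 M ⊠ₘ h) ⊠ₘ 𝟙 P) = (𝟙 M ⊠ₘ (h ⊠ₘ 𝟙 P)) ≫ assocInv M N' P :=
  (assoc_inv_naturality _ _ _).symm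

theorem tmap_exchange {F : Type*} [Ring F] {M M' : BiMod.{u} S F} {N N' : BiMod.{u} F T}
    (f : M ⟶ M') (g : N ⟶ N') :
    (f ⊠ₘ 𝟙 N) ≫ (𝟙 M' ⊠ₘ g) = (𝟙 M ⊠ₘ g) ≫ (f ⊠ₘ 𝟙 N') := by
  simp [tmap_comp]

end counit

/-! ### Balanced maps into tensor products -/

section balanced

variable {F F' : Type*} [Ring F] [Ring F'] {G : BiMod.{u} F F}

/-- A map `k` into `M ⊗ N` is balanced with respect to `r : M → M ⊗ G` and `l : N → G ⊗ N` if
it equalizes `r ⊗ N` and `M ⊗ l`. For coactions `r` and `l` this says that `k` takes values in the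
cotensor product. -/
def Balanced {M : BiMod.{u} S F} {N : BiMod.{u} F T} {P : BiMod.{u} S T} (r : M ⟶ M ⊠ G)
    (l : N ⟶ G ⊠ N) (k : P ⟶ M ⊠ N) : Prop :=
  k ≫ (r ⊠ₘ 𝟙 N) = k ≫ (𝟙 M ⊠ₘ l) ≫ assocInv M G N

theorem Balanced.comp {M : BiMod.{u} S F} {N : BiMod.{u} F T} {P Q : BiMod.{u} S T}
    {r : M ⟶ M ⊠ G} {l : N ⟶ G ⊠ N} {k : P ⟶ M ⊠ N} (h : Balanced r l k) (q : Q ⟶ P) :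
    Balanced r l (q ≫ k) := by
  unfold Balanced at *
  rw [Category.assoc, h, Category.assoc]

theorem Balanced.map {M M' : BiMod.{u} S F} {N N' : BiMod.{u} F T} {P : BiMod.{u} S T}
    {r : M ⟶ M ⊠ G} {l : N ⟶ G ⊠ N} {r' : M' ⟶ M' ⊠ G} {l' : N' ⟶ G ⊠ N'} {k : P ⟶ M ⊠ N}
    (h : Balanced r l k) (f : M ⟶ M') (g : N ⟶ N') (hf : f ≫ r' = r ≫ (f ⊠ₘ 𝟙 G))
    (hg : g ≫ l' = l ≫ (𝟙 G ⊠ₘ g)) : Balanced r' l' (k ≫ (f ⊠ₘ g)) := by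
  unfold Balanced at *
  have e := congrArg (fun q => q ≫ ((f ⊠ₘ 𝟙 G) ⊠ₘ g)) h
  simp only [Category.assoc] at e
  rw [tmap_comp, Category.id_comp, ← hf, ← assoc_inv_naturality f (𝟙 G) g, tmap_comp_assoc,
    ← hg, Category.id_comp] at e
  rw [Category.assoc, Category.assoc, tmap_comp, tmap_comp_assoc, Category.comp_id,
    Category.comp_id]
  exact e

/-- If the map `G ⊗ - ` of the target is injective, balancedness is reflected. -/
theorem Balanced.of_map {M M' : BiMod.{u} S F} {N N' : BiMod.{u} F T} {P : BiMod.{u} S T}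
    {r : M ⟶ M ⊠ G} {l : N ⟶ G ⊠ N} {r' : M' ⟶ M' ⊠ G} {l' : N' ⟶ G ⊠ N'} {k : P ⟶ M ⊠ N}
    (f : M ⟶ M') (g : N ⟶ N') (hf : f ≫ r' = r ≫ (f ⊠ₘ 𝟙 G))
    (hg : g ≫ l' = l ≫ (𝟙 G ⊠ₘ g)) (hi : Function.Injective ((f ⊠ₘ 𝟙 G) ⊠ₘ g).fn)
    (h : Balanced r' l' (k ≫ (f ⊠ₘ g))) : Balanced r l k := by
  unfold Balanced at *
  refine cancel_inj hi ?_
  simp only [Category.assoc]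
  rw [tmap_comp, Category.id_comp, ← hf, ← assoc_inv_naturality f (𝟙 G) g, tmap_comp_assoc,
    ← hg, Category.id_comp]
  rw [Category.assoc, Category.assoc, tmap_comp, tmap_comp_assoc, Category.comp_id,
    Category.comp_id] at h
  exact h

theorem assocHom_injective {H : Type*} [Ring H] (M : BiMod.{u} S F) (N : BiMod.{u} F H)
    (P : BiMod.{u} H T) : Function.Injective (assocHom M N P).fn := iso_injective (assoc _ _ _)

theorem assocInv_injective {H : Type*} [Ring H] (M : BiMod.{u} S F) (N : BiMod.{u} F H)
    (P : BiMod.{u} H T) : Function.Injective (assocInv M N P).fn :=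
  iso_injective (assoc _ _ _).symm

/-- For the coaction `W ⊗ r` on `W ⊗ N`, being balanced can be tested in `W ⊗ (N ⊗ L)`. -/
theorem balanced_tensor_iff {W : BiMod.{u} S F'} {N : BiMod.{u} F' F} {L : BiMod.{u} F T}
    {P : BiMod.{u} S T} (r : N ⟶ N ⊠ G) (l : L ⟶ G ⊠ L) (k : P ⟶ W ⊠ (N ⊠ L)) :
    Balanced ((𝟙 W ⊠ₘ r) ≫ assocInv W N G) l (k ≫ assocInv W N L) ↔
      k ≫ (𝟙 W ⊠ₘ (r ⊠ₘ 𝟙 L)) = k ≫ (𝟙 W ⊠ₘ ((𝟙 N ⊠ₘ l) ≫ assocInv N G L)) := by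
  have e₁ : (assocInv W N L ≫ (((𝟙 W ⊠ₘ r) ≫ assocInv W N G) ⊠ₘ 𝟙 L)) ≫
      (assocHom W N G ⊠ₘ 𝟙 L) ≫ assocHom W (N ⊠ G) L = 𝟙 W ⊠ₘ (r ⊠ₘ 𝟙 L) := by
    rw [Category.assoc, tmap_comp_assoc, Category.assoc, assocInv_hom, Category.comp_id,
      Category.comp_id, assoc_naturality, reassoc_of% assocInv_hom]
  have e₂ : (assocInv W N L ≫ (𝟙 (W ⊠ N) ⊠ₘ l) ≫ assocInv (W ⊠ N) G L) ≫
      (assocHom W N G ⊠ₘ 𝟙 L) ≫ assocHom W (N ⊠ G) L =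
        𝟙 W ⊠ₘ ((𝟙 N ⊠ₘ l) ≫ assocInv N G L) := by
    rw [Category.assoc, Category.assoc, pentagon_mid, reassoc_of% (assocInv_id_tmap W N l),
      reassoc_of% assocInv_hom, id_tmap_comp]
  have i : Function.Injective ((assocHom W N G ⊠ₘ 𝟙 L) ≫ assocHom W (N ⊠ G) L).fn :=
    (assocHom_injective W (N ⊠ G) L).comp
      (injective_of_retraction (i := assocHom W N G ⊠ₘ 𝟙 L) (π := assocInv W N G ⊠ₘ 𝟙 L) (by
        rw [tmap_comp, assocHom_inv, Category.comp_id, tmap_id]))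
  rw [← e₁, ← e₂, Balanced]
  constructor
  · intro h
    rw [← Category.assoc, ← Category.assoc k, ← Category.assoc k, ← Category.assoc k]
    simp only [Category.assoc] at h ⊢
    rw [reassoc_of% h]
  · intro h
    refine cancel_inj i ?_
    simp only [Category.assoc] at h ⊢
    exact h

end balanced

/-! ### Cotensor products inside tensor products -/

theorem mem_cotensor_iff {C : Coring A} (M : RComod S C) (N : LComod C T)
    (t : (M.mod ⊠ N.mod).carrier) :
    (∃ y, (cotensorι M N).fn y = t) ↔
      (M.rco ⊠ₘ 𝟙 N.mod).fn t = ((𝟙 M.mod ⊠ₘ N.lco) ≫ assocInv M.mod C.bim N.mod).fn t :=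
  ((exact_kerι (omega M N) t).symm).trans sub_eq_zero

theorem cotensorι_balanced {C : Coring A} (M : RComod S C) (N : LComod C T) :
    Balanced M.rco N.lco (cotensorι M N) := cotensorι_eq M N

theorem cotensorι_injective {C : Coring A} (M : RComod S C) (N : LComod C T) :
    Function.Injective (cotensorι M N).fn := kerι_injective _

/-- The map into `M □ N` induced by a balanced map into `M ⊗ N`. -/
noncomputable def cotensorLift {C : Coring A} (M : RComod S C) (N : LComod C T)
    {P : BiMod.{u} S T} (k : P ⟶ M.mod ⊠ N.mod) (h : Balanced M.rco N.lco k) :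
    P ⟶ cotensor M N :=
  liftInj (cotensorι M N) (kerι_injective _) k fun x => (mem_cotensor_iff M N _).2 (fn_congr h x)

theorem cotensorLift_ι {C : Coring A} (M : RComod S C) (N : LComod C T)
    {P : BiMod.{u} S T} (k : P ⟶ M.mod ⊠ N.mod) (h : Balanced M.rco N.lco k) :
    cotensorLift M N k h ≫ cotensorι M N = k := liftInj_comp _ _ _ _

theorem cotensorMap_comp {C : Coring A} {M M' M'' : RComod S C} {N N' N'' : LComod C T}
    (f : M ⟶ M') (f' : M' ⟶ M'') (g : N ⟶ N') (g' : N' ⟶ N'') :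
    cotensorMap f g ≫ cotensorMap f' g' = cotensorMap (f ≫ f') (g ≫ g') :=
  cancel_inj (cotensorι_injective M'' N'') (by
    rw [Category.assoc, cotensorMap_ι, reassoc_of% cotensorMap_ι f g, cotensorMap_ι, tmap_comp]
    rfl)

theorem cotensorMap_id {C : Coring A} (M : RComod S C) (N : LComod C T) :
    cotensorMap (𝟙 M) (𝟙 N) = 𝟙 (cotensor M N) :=
  cancel_inj (cotensorι_injective M N) (by
    rw [cotensorMap_ι, Category.id_comp]
    exact (congrArg (cotensorι M N ≫ ·) (tmap_id M.mod N.mod)).trans (Category.comp_id _))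

/-! ### The iterated cotensor product -/

section iterated

variable {C : Coring A} {D : Coring B}

/-- The inclusion `M □_C X → M ⊗ X` as a morphism of right comodules. -/
noncomputable def cotensorRightι (M : RComod S C) (X : Bicomod C D) (h : CotensorPureRight M X) :
    cotensorRight M X h ⟶ RComod.tensor M.mod X.toRComod :=
  ⟨cotensorι M X.toLComod, (cotensorRight_rco M X h).symm⟩

/-- The canonical map `(M □_C X) □_D N → (M ⊗ X) ⊗ N`. -/
noncomputable def iterι (M : RComod S C) (X : Bicomod C D) (h : CotensorPureRight M X)
    (N : LComod D T) : cotensor (cotensorRight M X h) N ⟶ (M.mod ⊠ X.mod) ⊠ N.mod :=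
  cotensorι (cotensorRight M X h) N ≫ (cotensorι M X.toLComod ⊠ₘ 𝟙 N.mod)

variable (M : RComod S C) (X : Bicomod C D) (h : CotensorPureRight M X) (N : LComod D T)

theorem iterι_left : iterι M X h N ≫ ((M.rco ⊠ₘ 𝟙 X.mod) ⊠ₘ 𝟙 N.mod) =
    iterι M X h N ≫ (((𝟙 M.mod ⊠ₘ X.lco) ≫ assocInv _ _ _) ⊠ₘ 𝟙 N.mod) := by
  have e := congrArg (fun k => k ⊠ₘ 𝟙 N.mod) (cotensorι_eq M X.toLComod)
  rw [comp_tmap_id, comp_tmap_id] at e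
  exact congrArg (cotensorι (cotensorRight M X h) N ≫ ·) e

theorem iterι_right :
    Balanced ((𝟙 M.mod ⊠ₘ X.rco) ≫ assocInv _ _ _) N.lco (iterι M X h N) :=
  (cotensorι_balanced (cotensorRight M X h) N).map (cotensorι M X.toLComod) (𝟙 N.mod)
    (cotensorRightι M X h).colinear (by simp)

theorem iterι_map {M M' : RComod S C} {h : CotensorPureRight M X} {h' : CotensorPureRight M' X}
    (f : M ⟶ M') (g : cotensorRight M X h ⟶ cotensorRight M' X h')
    (hg : g.hom = cotensorMap f (𝟙 X.toLComod)) :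
    cotensorMap g (𝟙 N) ≫ iterι M' X h' N =
      iterι M X h N ≫ ((f.hom ⊠ₘ 𝟙 X.mod) ⊠ₘ 𝟙 N.mod) := by
  have e₁ : cotensorMap g (𝟙 N) ≫ cotensorι (cotensorRight M' X h') N =
      cotensorι (cotensorRight M X h) N ≫ (cotensorMap f (𝟙 X.toLComod) ⊠ₘ 𝟙 N.mod) := by
    have := cotensorMap_ι g (𝟙 N)
    rw [hg] at this
    exact this
  have e₂ := congrArg (fun k => k ⊠ₘ 𝟙 N.mod) (cotensorMap_ι f (𝟙 X.toLComod))
  rw [comp_tmap_id, comp_tmap_id] at e₂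
  exact (congrArg (· ≫ (cotensorι M' X.toLComod ⊠ₘ 𝟙 N.mod)) e₁).trans
    (congrArg (cotensorι (cotensorRight M X h) N ≫ ·) e₂)

end iterated

theorem tensor_coaction_naturality {F H : Type*} [Ring F] [Ring H] {G : BiMod.{u} H H}
    {K P : BiMod.{u} S F} {N : BiMod.{u} F H} (i : K ⟶ P) (r : N ⟶ N ⊠ G) :
    ((𝟙 K ⊠ₘ r) ≫ assocInv K N G) ≫ ((i ⊠ₘ 𝟙 N) ⊠ₘ 𝟙 G) =
      (i ⊠ₘ 𝟙 N) ≫ (𝟙 P ⊠ₘ r) ≫ assocInv P N G := by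
  rw [Category.assoc, ← assocInv_tmap_id, tmap_comp_assoc, tmap_comp_assoc]
  simp

section iteratedBicomod

variable {C : Coring A} {D : Coring B} {G : Coring E} (M : RComod S C) (X : Bicomod C D)
  (h : CotensorPureRight M X) (N : Bicomod D G)

/-- The canonical map `(M □_C X) □_D N → (M ⊗ X) ⊗ N` is right colinear. -/
theorem iterι_colinear (h' : CotensorPureRight (cotensorRight M X h) N) :
    (cotensorRight (cotensorRight M X h) N h').rco ≫ (iterι M X h N.toLComod ⊠ₘ 𝟙 G.bim) =
      iterι M X h N.toLComod ≫ (𝟙 (M.mod ⊠ X.mod) ⊠ₘ N.rco) ≫ assocInv _ _ _ := by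
  have e := cotensorRight_rco (cotensorRight M X h) N h'
  have e' := tensor_coaction_naturality (cotensorι M X.toLComod) N.rco
  have e'' := congrArg (· ≫ ((cotensorι M X.toLComod ⊠ₘ 𝟙 N.mod) ⊠ₘ 𝟙 G.bim)) e
  refine Eq.trans ?_ (e''.trans ?_)
  · exact (congrArg ((cotensorRight (cotensorRight M X h) N h').rco ≫ ·)
      (comp_tmap_id G.bim (cotensorι (cotensorRight M X h) N.toLComod)
        (cotensorι M X.toLComod ⊠ₘ 𝟙 N.mod)))
  · exact congrArg (cotensorι (cotensorRight M X h) N.toLComod ≫ ·) e'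

end iteratedBicomod

/-! ### Coherence for tensor products of four bimodules -/

section coherence

variable {F F' F'' : Type*} [Ring F] [Ring F'] [Ring F'']

theorem tensor_ext₄' {M : BiMod.{u} S F} {N : BiMod.{u} F F'} {P : BiMod.{u} F' F''}
    {R : BiMod.{u} F'' T} {Q : BiMod.{u} S T} {f g : M ⊠ (N ⊠ (P ⊠ R)) ⟶ Q}
    (h : ∀ m n p r, f.fn (tmk m (tmk n (tmk p r))) = g.fn (tmk m (tmk n (tmk p r)))) : f = g :=
  tensor_ext₃' fun m n x => DFunLike.congr_fun
    (f := f.fn.comp ((tmkHom (M := M) (N := N ⊠ (P ⊠ R)) m).comp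
      (tmkHom (M := N) (N := P ⊠ R) n)))
    (g := g.fn.comp ((tmkHom (M := M) (N := N ⊠ (P ⊠ R)) m).comp
      (tmkHom (M := N) (N := P ⊠ R) n)))
    (addHom_ext fun p r => h m n p r) x

theorem assocInv_pentagon (M : BiMod.{u} S F) (N : BiMod.{u} F F') (P : BiMod.{u} F' F'')
    (R : BiMod.{u} F'' T) : assocInv M N (P ⊠ R) ≫ assocInv (M ⊠ N) P R =
      (𝟙 M ⊠ₘ assocInv N P R) ≫ assocInv M (N ⊠ P) R ≫ (assocInv M N P ⊠ₘ 𝟙 R) :=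
  tensor_ext₄' fun _ _ _ _ => rfl

theorem assocInv_tmap_assocHom (M : BiMod.{u} S F) (N : BiMod.{u} F F') (P : BiMod.{u} F' F'')
    (R : BiMod.{u} F'' T) : (assocInv M N P ⊠ₘ 𝟙 R) ≫ assocHom (M ⊠ N) P R =
      assocHom M (N ⊠ P) R ≫ (𝟙 M ⊠ₘ assocHom N P R) ≫ assocInv M N (P ⊠ R) := by
  rw [← pentagon_inv, reassoc_of% assocHom_inv]

end coherence

theorem rco_rco {C : Coring A} (M : RComod S C) :
    M.rco ≫ (𝟙 M.mod ⊠ₘ C.comul) ≫ assocInv _ _ _ = M.rco ≫ (M.rco ⊠ₘ 𝟙 C.bim) := by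
  rw [← reassoc_of% M.rcoassoc, assocHom_inv, Category.comp_id]

/-! ### Copairings `C → X ⊗ Λ` -/

section theta

variable {C : Coring A} {D : Coring B}

/-- For `j : C → P ⊗ N`, the map `M → (M ⊗ P) ⊗ N`, `m ↦ m₀ ⊗ j(m₁)`. -/
def theta (M : RComod S C) {P : BiMod.{u} A E} {N : BiMod.{u} E A} (j : C.bim ⟶ P ⊠ N) :
    M.mod ⟶ (M.mod ⊠ P) ⊠ N :=
  M.rco ≫ (𝟙 M.mod ⊠ₘ j) ≫ assocInv M.mod P N

theorem theta_naturality {M M' : RComod S C} (f : M ⟶ M') {P : BiMod.{u} A E}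
    {N : BiMod.{u} E A} (j : C.bim ⟶ P ⊠ N) :
    f.hom ≫ theta M' j = theta M j ≫ ((f.hom ⊠ₘ 𝟙 P) ⊠ₘ 𝟙 N) := by
  rw [theta, theta, reassoc_of% f.colinear]
  simp only [Category.assoc]
  rw [← assocInv_tmap_id, tmap_comp_assoc, tmap_comp_assoc]
  simp

/-- The properties of the composite `j : C → X ⊗ Λ` of an isomorphism of bicomodules
`C ≅ X □_D Λ` with the inclusion: it is colinear on both sides and takes values in `X □_D Λ`. -/
structure IsCopairing (X : Bicomod C D) (Λ : Bicomod D C) (j : C.bim ⟶ X.mod ⊠ Λ.mod) :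
    Prop where
  left : C.comul ≫ (𝟙 C.bim ⊠ₘ j) = j ≫ (X.lco ⊠ₘ 𝟙 Λ.mod) ≫ assocHom _ _ _
  right : C.comul ≫ (j ⊠ₘ 𝟙 C.bim) = j ≫ (𝟙 X.mod ⊠ₘ Λ.rco) ≫ assocInv _ _ _
  balanced : Balanced X.rco Λ.lco j

variable {X : Bicomod C D} {Λ : Bicomod D C} {j : C.bim ⟶ X.mod ⊠ Λ.mod}

theorem IsCopairing.left' (hj : IsCopairing X Λ j) :
    C.comul ≫ (𝟙 C.bim ⊠ₘ j) ≫ assocInv _ _ _ = j ≫ (X.lco ⊠ₘ 𝟙 Λ.mod) := by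
  rw [reassoc_of% hj.left, assocHom_inv, Category.comp_id]

theorem IsCopairing.theta_colinear (hj : IsCopairing X Λ j) (M : RComod S C) :
    theta M j ≫ (𝟙 (M.mod ⊠ X.mod) ⊠ₘ Λ.rco) ≫ assocInv _ _ _ =
      M.rco ≫ (theta M j ⊠ₘ 𝟙 C.bim) := by
  simp only [theta, comp_tmap_id, Category.assoc]
  rw [reassoc_of% (assocInv_id_tmap M.mod X.mod Λ.rco), assocInv_pentagon, ← reassoc_of% rco_rco M,
    tmap_comp_assoc, tmap_comp_assoc, reassoc_of% (assocInv_mid M.mod j C.bim), tmap_comp_assoc,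
    hj.right]
  simp only [Category.assoc, Category.comp_id]

theorem IsCopairing.theta_left (hj : IsCopairing X Λ j) (M : RComod S C) :
    theta M j ≫ ((M.rco ⊠ₘ 𝟙 X.mod) ⊠ₘ 𝟙 Λ.mod) =
      theta M j ≫ (((𝟙 M.mod ⊠ₘ X.lco) ≫ assocInv _ _ _) ⊠ₘ 𝟙 Λ.mod) := by
  simp only [theta, comp_tmap_id, Category.assoc]
  rw [← assocInv_tmap_id, reassoc_of% (assocInv_mid M.mod X.lco Λ.mod),
    ← reassoc_of% (tmap_exchange M.rco j), ← reassoc_of% rco_rco M,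
    reassoc_of% (assocInv_id_tmap M.mod C.bim j), assocInv_pentagon, tmap_comp_assoc,
    tmap_comp_assoc, tmap_comp_assoc]
  simp only [Category.assoc, Category.comp_id]
  rw [hj.left']

theorem IsCopairing.theta_right (hj : IsCopairing X Λ j) (M : RComod S C) :
    Balanced ((𝟙 M.mod ⊠ₘ X.rco) ≫ assocInv _ _ _) Λ.lco (theta M j) := by
  have h := (balanced_tensor_iff X.rco Λ.lco (M.rco ≫ (𝟙 M.mod ⊠ₘ j))).2 (by
    have := hj.balanced
    unfold Balanced at this
    rw [Category.assoc, Category.assoc, tmap_comp, tmap_comp, this])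
  rwa [Category.assoc] at h

theorem isCopairing_of_iso {h : CotensorPure X Λ} (f : cotensorBicomod X Λ h ≅ C.regular) :
    IsCopairing X Λ (f.inv.hom ≫ cotensorι X.toRComod Λ.toLComod) where
  left := by
    have e₁ : f.inv.hom ≫ (cotensorLeft X Λ.toLComod h.left).lco =
      C.comul ≫ (𝟙 C.bim ⊠ₘ f.inv.hom) := f.inv.lcolinear
    have e₂ := cotensorLeft_lco X Λ.toLComod h.left
    have e₃ := congrArg (· ≫ (𝟙 C.bim ⊠ₘ cotensorι X.toRComod Λ.toLComod)) e₁
    have e₄ := congrArg (f.inv.hom ≫ ·) e₂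
    refine (congrArg (C.comul ≫ ·) (id_tmap_comp _ _ _)).trans ?_
    exact e₃.symm.trans e₄
  right := by
    have e₁ : f.inv.hom ≫ (cotensorRight X.toRComod Λ h.right).rco =
      C.comul ≫ (f.inv.hom ⊠ₘ 𝟙 C.bim) := f.inv.rcolinear
    have e₂ := cotensorRight_rco X.toRComod Λ h.right
    have e₃ := congrArg (· ≫ (cotensorι X.toRComod Λ.toLComod ⊠ₘ 𝟙 C.bim)) e₁
    have e₄ := congrArg (f.inv.hom ≫ ·) e₂
    refine (congrArg (C.comul ≫ ·) (comp_tmap_id _ _ _)).trans ?_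
    exact e₃.symm.trans e₄
  balanced := (cotensorι_balanced X.toRComod Λ.toLComod).comp f.inv.hom

end theta

/-! ### From isomorphisms of bicomodules to an equivalence -/

/-- A colinear map with a two-sided inverse is an isomorphism of comodules. -/
def RComod.isoMk {C : Coring A} {M N : RComod S C} (f : M ⟶ N) (g : N.mod ⟶ M.mod)
    (h : f.hom ≫ g = 𝟙 _) (h' : g ≫ f.hom = 𝟙 _) : M ≅ N where
  hom := f
  inv := ⟨g, by
    have : M.rco = f.hom ≫ N.rco ≫ (g ⊠ₘ 𝟙 C.bim) := by
      rw [reassoc_of% f.colinear, tmap_comp, h, Category.comp_id, tmap_id, Category.comp_id]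
    rw [this, reassoc_of% h']⟩
  hom_inv_id := RComod.hom_ext h
  inv_hom_id := RComod.hom_ext h'

section associativity

variable {C : Coring A} {D : Coring B} {X : Bicomod C D} {Λ : Bicomod D C}

/-- The purity conditions under which `(M □ X) □ Λ` and `M □ (X □ Λ)` agree. -/
structure AssocPure (M : RComod S C) (X : Bicomod C D) (Λ : Bicomod D C) : Prop where
  right : IsPureRight (omega M X.toLComod) Λ.mod.carrier
  right_inj : Function.Injective ((cotensorι M X.toLComod ⊠ₘ 𝟙 D.bim) ⊠ₘ 𝟙 Λ.mod).fn
  left : IsPureLeft (omega X.toRComod Λ.toLComod) M.mod.carrier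
  left_inj : Function.Injective
    (𝟙 (M.mod ⊠ C.bim) ⊠ₘ cotensorι X.toRComod Λ.toLComod).fn

theorem AssocPure.iterι_injective {M : RComod S C} (hM : AssocPure M X Λ)
    (h : CotensorPureRight M X) : Function.Injective (iterι M X h Λ.toLComod).fn :=
  Function.Injective.comp (g := (cotensorι M X.toLComod ⊠ₘ 𝟙 Λ.mod).fn)
    (f := (cotensorι (cotensorRight M X h) Λ.toLComod).fn) hM.right.1 (cotensorι_injective _ _)

/-- The map `theta M j` takes values in `(M □_C X) □_D Λ`. -/
theorem AssocPure.exists_lift {M : RComod S C} (hM : AssocPure M X Λ)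
    (h : CotensorPureRight M X) {j : C.bim ⟶ X.mod ⊠ Λ.mod} (hj : IsCopairing X Λ j) :
    ∃ k : M.mod ⟶ cotensor (cotensorRight M X h) Λ.toLComod,
      k ≫ iterι M X h Λ.toLComod = theta M j := by
  have e : ∀ m, (omega M X.toLComod ⊠ₘ 𝟙 Λ.mod).fn ((theta M j).fn m) = 0 := fun m => by
    have := fn_congr (hj.theta_left M) m
    rw [omega, sub_tmap, sub_fn, sub_eq_zero]
    exact this
  obtain ⟨k, hk⟩ : ∃ k : M.mod ⟶ cotensor M X.toLComod ⊠ Λ.mod,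
      k ≫ (cotensorι M X.toLComod ⊠ₘ 𝟙 Λ.mod) = theta M j :=
    ⟨liftInj (cotensorι M X.toLComod ⊠ₘ 𝟙 Λ.mod) hM.right.1 (theta M j)
      fun m => (hM.right.2 _).1 (e m), liftInj_comp _ _ _ _⟩
  have hb : Balanced (cotensorRight M X h).rco Λ.lco k :=
    Balanced.of_map (l' := Λ.lco) (r' := (𝟙 M.mod ⊠ₘ X.rco) ≫ assocInv _ _ _)
      (cotensorι M X.toLComod) (𝟙 Λ.mod) (cotensorRightι M X h).colinear (by simp)
      hM.right_inj (hk ▸ hj.theta_right M)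
  refine ⟨cotensorLift (cotensorRight M X h) Λ.toLComod k hb, ?_⟩
  have e' := cotensorLift_ι (cotensorRight M X h) Λ.toLComod k hb
  exact (congrArg (· ≫ (cotensorι M X.toLComod ⊠ₘ 𝟙 Λ.mod)) e').trans hk

/-- The image of `(M □_C X) □_D Λ` in `M ⊗ (X ⊗ Λ)` lies in `M □_C (X ⊗ Λ)`. -/
theorem iterι_balanced (M : RComod S C) (h : CotensorPureRight M X) :
    Balanced M.rco ((X.lco ⊠ₘ 𝟙 Λ.mod) ≫ assocHom _ _ _)
      (iterι M X h Λ.toLComod ≫ assocHom _ _ _) := by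
  have e := congrArg (· ≫ assocHom _ _ _) (iterι_left M X h Λ.toLComod)
  simp only [Category.assoc, comp_tmap_id] at e
  rw [assoc_naturality, tmap_id, assocInv_tmap_assocHom, reassoc_of% assoc_naturality] at e
  unfold Balanced
  simp only [Category.assoc, id_tmap_comp]
  exact e

/-- Elements of `(M □_C X) □_D Λ` lie in `M □_C (X □_D Λ) ≅ M □_C C ≅ M`, whence they are values of
`theta M j`. -/
theorem AssocPure.exists_inverse {M : RComod S C} (hM : AssocPure M X Λ)
    (h : CotensorPureRight M X) (f : C.bim ≅ cotensor X.toRComod Λ.toLComod)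
    (hj : IsCopairing X Λ (f.hom ≫ cotensorι X.toRComod Λ.toLComod)) :
    ∃ m : cotensor (cotensorRight M X h) Λ.toLComod ⟶ M.mod,
      m ≫ theta M (f.hom ≫ cotensorι X.toRComod Λ.toLComod) = iterι M X h Λ.toLComod := by
  have hb := iterι_right M X h Λ.toLComod
  rw [← Category.comp_id (iterι M X h Λ.toLComod), ← assocHom_inv, ← Category.assoc,
    balanced_tensor_iff] at hb
  obtain ⟨κ, hκ⟩ : ∃ κ : cotensor (cotensorRight M X h) Λ.toLComod ⟶
      M.mod ⊠ cotensor X.toRComod Λ.toLComod,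
      κ ≫ (𝟙 M.mod ⊠ₘ cotensorι X.toRComod Λ.toLComod) =
        iterι M X h Λ.toLComod ≫ assocHom _ _ _ :=
    ⟨liftInj (𝟙 M.mod ⊠ₘ cotensorι X.toRComod Λ.toLComod) hM.left.1 _ fun t =>
      (hM.left.2 _).1 (by
        have := fn_congr hb t
        change (𝟙 M.mod ⊠ₘ omega X.toRComod Λ.toLComod).fn _ = 0
        rw [omega, tmap_sub, sub_fn, sub_eq_zero]
        exact this), liftInj_comp _ _ _ _⟩
  have hu : (κ ≫ (𝟙 M.mod ⊠ₘ f.inv)) ≫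
      (𝟙 M.mod ⊠ₘ (f.hom ≫ cotensorι X.toRComod Λ.toLComod)) =
        iterι M X h Λ.toLComod ≫ assocHom _ _ _ := by
    rw [Category.assoc, tmap_comp, f.inv_hom_id_assoc, Category.comp_id, hκ]
  have hu' : Balanced M.rco C.comul (κ ≫ (𝟙 M.mod ⊠ₘ f.inv)) := by
    refine Balanced.of_map (𝟙 M.mod) _ (by simp) hj.left.symm ?_ (r' := M.rco) ?_
    · rw [tmap_id, id_tmap_comp]
      exact hM.left_inj.comp (injective_of_retraction (i := 𝟙 (M.mod ⊠ C.bim) ⊠ₘ f.hom)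
        (π := 𝟙 _ ⊠ₘ f.inv) (by rw [tmap_comp, f.hom_inv_id, Category.comp_id, tmap_id]))
    · rw [hu]
      exact iterι_balanced M h
  set k := κ ≫ (𝟙 M.mod ⊠ₘ f.inv)
  refine ⟨k ≫ counitRight C M.mod, ?_⟩
  have hk : (k ≫ counitRight C M.mod) ≫ M.rco = k := by
    unfold Balanced at hu'
    rw [Category.assoc, ← counitRight_naturality, reassoc_of% hu', assocInv_counitRight,
      tmap_comp, comul_counitRight]
    simp
  rw [theta, ← Category.assoc, hk, reassoc_of% hu, assocHom_inv, Category.comp_id]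

/-- The natural map `theta M j` is an isomorphism onto `(M □_C X) □_D Λ`, seen inside
`(M ⊗ X) ⊗ Λ`. -/
theorem nonempty_natIso_of_copairing (hC : LeftFlat C.bim) (hD : LeftFlat D.bim)
    (f : C.bim ≅ cotensor X.toRComod Λ.toLComod)
    (hj : IsCopairing X Λ (f.hom ≫ cotensorι X.toRComod Λ.toLComod))
    (hM : ∀ M : RComod.{u} ℤ C, AssocPure M X Λ) :
    Nonempty (𝟭 (RComod.{u} ℤ C) ≅ cotensorFunctor hD X ⋙ cotensorFunctor hC Λ) := by
  have hp := fun M : RComod.{u} ℤ C => cotensorPureRight_of_flat hD M X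
  choose k hk using fun M => (hM M).exists_lift (hp M) hj
  choose m hm using fun M => (hM M).exists_inverse (hp M) f hj
  have hθ : ∀ M : RComod.{u} ℤ C,
      Function.Injective (theta M (f.hom ≫ cotensorι X.toRComod Λ.toLComod)).fn := fun M => by
    refine (assocInv_injective _ _ _).comp (Function.Injective.comp ?_ (rco_injective M))
    rw [id_tmap_comp]
    exact Function.Injective.comp
      (g := (𝟙 M.mod ⊠ₘ cotensorι X.toRComod Λ.toLComod).fn) (hM M).left.1
      (injective_of_retraction (i := 𝟙 M.mod ⊠ₘ f.hom) (π := 𝟙 M.mod ⊠ₘ f.inv) (by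
        rw [tmap_comp, f.hom_inv_id, Category.comp_id, tmap_id]))
  obtain ⟨j, hj'⟩ : ∃ j, j = f.hom ≫ cotensorι X.toRComod Λ.toLComod := ⟨_, rfl⟩
  rw [← hj'] at hj
  simp only [← hj'] at hk hm hθ
  have hi := fun M => (hM M).iterι_injective (hp M)
  have hmk : ∀ M, m M ≫ k M = 𝟙 _ := fun M => cancel_inj (hi M) (by
    rw [Category.assoc, hk, Category.id_comp]; exact hm M)
  have hkm : ∀ M : RComod.{u} ℤ C, k M ≫ m M = 𝟙 _ := fun M => cancel_inj (hθ M) (by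
    rw [Category.assoc, hm, Category.id_comp, hk M])
  refine ⟨NatIso.ofComponents (fun M => RComod.isoMk ⟨k M, ?_⟩ (m M) (hkm M) (hmk M)) ?_⟩
  · have hp' := cotensorPureRight_of_flat hC (cotensorRight M X (hp M)) Λ
    have e := iterι_colinear M X (hp M) Λ hp'
    have hi' : Function.Injective (iterι M X (hp M) Λ.toLComod ⊠ₘ 𝟙 C.bim).fn :=
      hC.injective _ (hi M)
    refine cancel_inj (i := iterι M X (hp M) Λ.toLComod ⊠ₘ 𝟙 C.bim) hi' ?_
    have e₁ : (M.rco ≫ (k M ⊠ₘ 𝟙 C.bim)) ≫ (iterι M X (hp M) Λ.toLComod ⊠ₘ 𝟙 C.bim) =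
        M.rco ≫ (theta M j ⊠ₘ 𝟙 C.bim) := by
      rw [Category.assoc, tmap_comp, hk, Category.comp_id]
    refine Eq.trans ?_ e₁.symm
    rw [← hj.theta_colinear, ← hk]
    exact congrArg (k M ≫ ·) e
  · intro M M' φ
    refine RComod.hom_ext (cancel_inj (i := iterι M' X (hp M') Λ.toLComod) (hi M') ?_)
    have e := iterι_map (h := hp M) (h' := hp M') X Λ.toLComod φ ((cotensorFunctor hD X).map φ) rfl
    have e₁ : (φ.hom ≫ k M') ≫ iterι M' X (hp M') Λ.toLComod =
        k M ≫ iterι M X (hp M) Λ.toLComod ≫ ((φ.hom ⊠ₘ 𝟙 X.mod) ⊠ₘ 𝟙 Λ.mod) := by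
      rw [Category.assoc, hk, theta_naturality, ← hk M, Category.assoc]
    exact e₁.trans (congrArg (k M ≫ ·) e.symm)

/-- The isomorphism of bimodules underlying an isomorphism of bicomodules `X □_D Λ ≅ C`. -/
noncomputable def bimIso {h : CotensorPure X Λ} (f : cotensorBicomod X Λ h ≅ C.regular) :
    C.bim ≅ cotensor X.toRComod Λ.toLComod where
  hom := f.inv.hom
  inv := f.hom.hom
  hom_inv_id := congrArg Bicomod.Hom.hom f.inv_hom_id
  inv_hom_id := congrArg Bicomod.Hom.hom f.hom_inv_id

/-- An isomorphism of bicomodules `X □_D Λ ≅ C` and enough purity make `- □_C X □_D Λ` isomorphic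
to the identity. -/
theorem nonempty_natIso_of_iso (hC : LeftFlat C.bim) (hD : LeftFlat D.bim)
    {h : CotensorPure X Λ} (f : cotensorBicomod X Λ h ≅ C.regular)
    (hM : ∀ M : RComod.{u} ℤ C, AssocPure M X Λ) :
    Nonempty (𝟭 (RComod.{u} ℤ C) ≅ cotensorFunctor hD X ⋙ cotensorFunctor hC Λ) :=
  nonempty_natIso_of_copairing hC hD (bimIso f) (isCopairing_of_iso f) hM

end associativity

/-! ### Sufficient conditions for associativity -/

section assocPure

variable {C : Coring A} {D : Coring B} {X : Bicomod C D} {Λ : Bicomod D C}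

theorem assocPure_of_flat (hD : LeftFlat D.bim) (hΛ : LeftFlat Λ.mod)
    (hp : IsPureLeftModuleMap (omega X.toRComod Λ.toLComod)) (M : RComod S C) :
    AssocPure M X Λ where
  right := hΛ.isPureRight _
  right_inj := hΛ.injective _ (hD.injective _ (cotensorι_injective M X.toLComod))
  left := hp M.mod.carrier
  left_inj := (hp (M.mod ⊠ C.bim).carrier).1

/-- Over a coseparable coring `ω` splits, so that its kernel is preserved by every additive
functor. -/
theorem isPureLeft_omega_of_coseparable (hD : D.IsCoseparable) (M : RComod A D) (N : LComod D T)
    (W : Type u) [AddCommGroup W] [Module Aᵐᵒᵖ W] : IsPureLeft (omega M N) W := by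
  obtain ⟨θ, h₁, h₂⟩ := omega_split hD M N
  -- `isPureLeft_of_split` needs a bimodule over rings in `Type u`, whereas `ℤ` lies in `Type`.
  let Z : BiMod.{u} (ULift.{u} ℤ) A :=
    { carrier := W
      comm := ⟨fun n a w => (smul_comm n.down a w : n.down • a • w = a • n.down • w)⟩ }
  exact isPureLeft_of_split _ _ θ h₁ h₂ Z

theorem assocPure_of_coseparable (hC : C.IsCoseparable) (hD : D.IsCoseparable) (M : RComod S C) :
    AssocPure M X Λ := by
  obtain ⟨θ, h₁, h₂⟩ := omega_split hC M X.toLComod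
  obtain ⟨π, h⟩ := coseparable_retraction hC M X.toLComod
  obtain ⟨π', h'⟩ := coseparable_retraction hD X.toRComod Λ.toLComod
  refine ⟨isPureRight_of_split _ _ θ h₁ h₂ _, ?_, isPureLeft_omega_of_coseparable hD _ _ _, ?_⟩
  · exact injective_of_retraction (π := (π ⊠ₘ 𝟙 _) ⊠ₘ 𝟙 _) (by
      rw [tmap_comp, tmap_comp, h, Category.comp_id, Category.comp_id, tmap_id, tmap_id])
  · exact injective_of_retraction (π := 𝟙 _ ⊠ₘ π') (by
      rw [tmap_comp, h', Category.comp_id, tmap_id])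

end assocPure

/-! ### Character modules and exactness of tensor products -/

section character

/-- The additive group of characters `V → ℚ/ℤ`. -/
abbrev Chars (V : Type*) [AddCommGroup V] := V →+ AddCircle (1 : ℚ)

theorem exists_char_ne_zero {V : Type*} [AddCommGroup V] {v : V} (hv : v ≠ 0) :
    ∃ χ : Chars V, χ v ≠ 0 :=
  CharacterModule.exists_character_apply_ne_zero_of_ne_zero hv

theorem exists_char_extension {V W : Type*} [AddCommGroup V] [AddCommGroup W] (f : V →+ W)
    (hf : Function.Injective f) (χ : Chars V) : ∃ ψ : Chars W, ψ.comp f = χ := by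
  obtain ⟨ψ, hψ⟩ := CharacterModule.dual_surjective_of_injective f.toIntLinearMap hf χ
  exact ⟨ψ, hψ⟩

/-- A character on `V` vanishing on the kernel of `f : V → W` extends along `f`. -/
theorem exists_char_extension_of_ker {V W : Type*} [AddCommGroup V] [AddCommGroup W]
    (f : V →+ W) (χ : Chars V) (h : ∀ v, f v = 0 → χ v = 0) : ∃ ψ : Chars W, ψ.comp f = χ := by
  obtain ⟨ψ, hψ⟩ := exists_char_extension (QuotientAddGroup.kerLift f)
    (QuotientAddGroup.kerLift_injective f) (QuotientAddGroup.lift f.ker χ fun v hv => h v hv)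
  refine ⟨ψ, ?_⟩
  ext v
  exact DFunLike.congr_fun hψ (QuotientAddGroup.mk v)

/-- A complex of abelian groups is exact in the middle if every character which vanishes on the
image of the first map extends along the second. -/
theorem exact_of_chars {U V W : Type*} [AddCommGroup U] [AddCommGroup V] [AddCommGroup W]
    (f : U →+ V) (g : V →+ W) (hfg : ∀ u, g (f u) = 0)
    (h : ∀ χ : Chars V, χ.comp f = 0 → ∃ ψ : Chars W, ψ.comp g = χ) : Function.Exact f g := by
  intro v
  constructor
  · intro hv
    by_contra hn
    have hne : (QuotientAddGroup.mk v : V ⧸ f.range) ≠ 0 := fun h0 =>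
      hn ((QuotientAddGroup.eq_zero_iff v).1 h0)
    obtain ⟨χ, hχ⟩ := exists_char_ne_zero hne
    obtain ⟨ψ, hψ⟩ := h (χ.comp (QuotientAddGroup.mk' f.range)) (by
      ext u
      have : (QuotientAddGroup.mk (f u) : V ⧸ f.range) = 0 :=
        (QuotientAddGroup.eq_zero_iff _).2 ⟨u, rfl⟩
      simp [this])
    apply hχ
    have := DFunLike.congr_fun hψ v
    simp only [AddMonoidHom.comp_apply, hv, map_zero] at this
    exact this.symm
  · rintro ⟨u, rfl⟩
    exact hfg u

/-- The action `(r φ)(v) = φ(v r)` of `R` on the characters of a right `R`-module. -/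
@[reducible] def charModule (R V : Type*) [Ring R] [AddCommGroup V] [Module Rᵐᵒᵖ V] :
    Module R (Chars V) where
  smul r φ := φ.comp (DistribSMul.toAddMonoidHom V (MulOpposite.op r))
  one_smul φ := by ext v; exact congrArg φ (one_smul Rᵐᵒᵖ v)
  mul_smul r s φ := by
    ext v; exact congrArg φ (mul_smul (MulOpposite.op s) (MulOpposite.op r) v)
  smul_zero r := rfl
  smul_add r φ ψ := rfl
  add_smul r s φ := by
    ext v
    exact (congrArg φ (add_smul (MulOpposite.op r) (MulOpposite.op s) v)).trans (map_add φ _ _)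
  zero_smul φ := by ext v; exact (congrArg φ (zero_smul Rᵐᵒᵖ v)).trans (map_zero φ)

variable {R : Type u} [Ring R]

/-- Any two elements of a left ideal of a von Neumann regular ring have a common right unit in this
ideal. -/
theorem IsVonNeumannRegular.exists_right_unit (hR : IsVonNeumannRegular R) (I : Submodule R R)
    {a b : R} (ha : a ∈ I) (hb : b ∈ I) : ∃ e ∈ I, a * e = a ∧ b * e = b := by
  have key : ∀ c ∈ I, ∃ f ∈ I, c * f = c ∧ f * f = f := fun c hc => by
    obtain ⟨x, hx⟩ := hR c
    refine ⟨x * c, I.smul_mem x hc, by rw [← mul_assoc, hx], ?_⟩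
    rw [mul_assoc, ← mul_assoc c, hx]
  obtain ⟨f, hf, haf, hff⟩ := key a ha
  obtain ⟨x, hx⟩ := hR (b - b * f)
  have hy : b - b * f ∈ I := I.sub_mem hb (I.smul_mem b hf)
  obtain ⟨g, hg⟩ : ∃ g, g = x * (b - b * f) := ⟨_, rfl⟩
  have hgI : g ∈ I := hg ▸ I.smul_mem x hy
  have hgf : g * f = 0 := by rw [hg, mul_assoc, sub_mul, mul_assoc, hff, sub_self, mul_zero]
  have hyg : (b - b * f) * g = b - b * f := by rw [hg, ← mul_assoc, hx]
  have hgg : g * g = g := by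
    calc g * g = x * ((b - b * f) * g) := by rw [← mul_assoc, ← hg]
      _ = g := by rw [hyg, hg]
  have hfe : f * (f + g - f * g) = f := by
    rw [mul_sub, mul_add, ← mul_assoc, hff, add_sub_cancel_right]
  have hge : g * (f + g - f * g) = g := by
    rw [mul_sub, mul_add, ← mul_assoc, hgf, hgg]; simp
  -- `f` is an idempotent right unit of `a`, and `g` is one of `b - b f` with `g f = 0`.
  refine ⟨f + g - f * g, I.sub_mem (I.add_mem hf hgI) (I.smul_mem f hgI), ?_, ?_⟩
  · rw [← haf, mul_assoc, hfe]
  · have e₁ : (b - b * f) * (f + g - f * g) = b - b * f := by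
      rw [← hyg, mul_assoc, hge]
    have e₂ : b * f * (f + g - f * g) = b * f := by rw [mul_assoc, hfe]
    rw [sub_mul, e₂] at e₁
    exact sub_left_injective e₁

/-- Over a von Neumann regular ring all character modules are injective, by Baer's criterion. -/
theorem IsVonNeumannRegular.baer_charModule (hR : IsVonNeumannRegular R) (V : Type u)
    [AddCommGroup V] [Module Rᵐᵒᵖ V] :
    letI := charModule R V
    Module.Baer R (Chars V) := by
  let := charModule R V
  intro I φ
  -- `μ` is the multiplication `v ⊗ i ↦ v i`, and `χ` is `φ` as a character of `V ⊗ I`; an extension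
  -- of `φ` to `R` is a character `ψ` of `V` with `χ = ψ ∘ μ`.
  let β : V →+ I →+ V :=
    AddMonoidHom.mk' (fun v => AddMonoidHom.mk' (fun i : I => MulOpposite.op (i : R) • v)
      (fun i i' => by simp [add_smul])) (fun v v' => by ext i; simp)
  let μ : V ⊗[ℤ] I →+ V := TensorProduct.liftAddHom β fun r v i =>
    (DFunLike.congr_fun (map_zsmul β r v) i).trans (map_zsmul (β v) r i).symm
  let χ : V ⊗[ℤ] I →+ AddCircle (1 : ℚ) := TensorProduct.liftAddHom
    (AddMonoidHom.mk' (fun v => AddMonoidHom.mk' (fun i : I => φ i v)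
      (fun i i' => by simp)) (fun v v' => by ext i; simp)) (fun r v i => by simp)
  -- `χ` factors through `μ`: on finitely many elements of `I` with common right unit `e`
  -- it is given by evaluation of `φ e`.
  have key : ∀ t, ∃ e : I, ∀ e' : I, (e : R) * e' = e → χ t = φ e' (μ t) := by
    intro t
    induction t using TensorProduct.induction_on with
    | zero => exact ⟨0, fun e' _ => by simp⟩
    | tmul v i =>
      refine ⟨i, fun e' he => ?_⟩
      have : i = (i : R) • e' := Subtype.ext he.symm
      change φ i v = φ e' (MulOpposite.op (i : R) • v)
      conv_lhs => rw [this, map_smul]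
      rfl
    | add s t hs ht =>
      obtain ⟨e₁, h₁⟩ := hs
      obtain ⟨e₂, h₂⟩ := ht
      obtain ⟨e, he, he₁, he₂⟩ := hR.exists_right_unit I e₁.2 e₂.2
      refine ⟨⟨e, he⟩, fun e' h => ?_⟩
      rw [map_add, map_add, map_add, h₁ e', h₂ e']
      · rw [← he₂, mul_assoc, h]
      · rw [← he₁, mul_assoc, h]
  obtain ⟨ψ, hψ⟩ := exists_char_extension_of_ker μ χ fun t ht => by
    obtain ⟨e, he⟩ := key t
    obtain ⟨e', he', h, -⟩ := hR.exists_right_unit I e.2 e.2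
    rw [he ⟨e', he'⟩ h, ht, map_zero]
  refine ⟨LinearMap.toSpanSingleton R _ ψ, fun x hx => ?_⟩
  ext v
  exact DFunLike.congr_fun hψ (v ⊗ₜ ⟨x, hx⟩)

/-- A linear map into an injective module extends along `g` if it vanishes on the kernel of `g`. -/
theorem exists_extension_of_baer {Q P P' : Type u} [AddCommGroup Q] [Module R Q]
    (hQ : Module.Baer R Q) [AddCommGroup P] [Module R P] [AddCommGroup P'] [Module R P']
    (g : P →ₗ[R] P') (φ : P →ₗ[R] Q) (h : ∀ p, g p = 0 → φ p = 0) :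
    ∃ ψ : P' →ₗ[R] Q, ψ ∘ₗ g = φ := by
  obtain ⟨ψ, hψ⟩ := hQ.extension_property ((LinearMap.ker g).liftQ g le_rfl)
    (LinearMap.ker_eq_bot.1 (Submodule.ker_liftQ_eq_bot _ _ _ le_rfl))
    ((LinearMap.ker g).liftQ φ h)
  refine ⟨ψ, LinearMap.ext fun p => ?_⟩
  exact LinearMap.congr_fun hψ (Submodule.Quotient.mk p)

end character

section exactness

/-- The action `(φ a)(m) = φ(a m)` of `A` on the characters of a left `A`-module. It is the action
of `charModule` for the opposite ring, as a left `A`-module is a right `Aᵐᵒᵖ`-module. -/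
@[reducible] def rightCharModule (A M : Type*) [Ring A] [AddCommGroup M] [Module A M] :
    Module Aᵐᵒᵖ (Chars M) :=
  letI : Module Aᵐᵒᵖᵐᵒᵖ M := Module.compHom M (RingEquiv.opOp A).symm.toRingHom
  charModule Aᵐᵒᵖ M

/-- Characters of `P ⊗_A M` are linear maps from `P` to the characters of `M`, so exactness of
`- ⊗_A M` amounts to an extension property for the latter. -/
theorem tens_exact_right (M : Type*) [AddCommGroup M] [Module A M] {P P' P'' : Type*}
    [AddCommGroup P] [AddCommGroup P'] [AddCommGroup P''] [Module Aᵐᵒᵖ P] [Module Aᵐᵒᵖ P']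
    [Module Aᵐᵒᵖ P''] (f : P →ₗ[Aᵐᵒᵖ] P') (g : P' →ₗ[Aᵐᵒᵖ] P'') (hfg : ∀ p, g (f p) = 0)
    (h : letI := rightCharModule A M; ∀ φ : P' →ₗ[Aᵐᵒᵖ] Chars M, (∀ p, φ (f p) = 0) →
      ∃ ψ : P'' →ₗ[Aᵐᵒᵖ] Chars M, ψ ∘ₗ g = φ) :
    Function.Exact (Tens.map f (.id : M →ₗ[A] M)) (Tens.map g (.id : M →ₗ[A] M)) := by
  let := rightCharModule A M
  refine exact_of_chars _ _ (DFunLike.congr_fun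
    (f := (Tens.map g (.id : M →ₗ[A] M)).comp (Tens.map f .id)) (g := 0)
    (Tens.hom_ext fun p m => by simp [hfg])) fun χ hχ => ?_
  let φ : P' →ₗ[Aᵐᵒᵖ] Chars M :=
    { toFun := fun p => χ.comp (Tens.mkHom p)
      map_add' := fun p p' => by ext m; simp
      map_smul' := fun a p => by
        ext m
        exact congrArg χ (Tens.mk_smul a.unop p m) }
  obtain ⟨ψ, hψ⟩ := h φ fun p => by ext m; exact DFunLike.congr_fun hχ (Tens.mk p m)
  refine ⟨Tens.lift ψ.toAddMonoidHom fun p a m => ?_, Tens.hom_ext fun p m => ?_⟩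
  · exact DFunLike.congr_fun (ψ.map_smul (MulOpposite.op a) p) m
  · exact DFunLike.congr_fun (LinearMap.congr_fun hψ p) m

/-- The mirror image of `tens_exact_right`. -/
theorem tens_exact_left (W : Type*) [AddCommGroup W] [Module Aᵐᵒᵖ W] {N N' N'' : Type*}
    [AddCommGroup N] [AddCommGroup N'] [AddCommGroup N''] [Module A N] [Module A N']
    [Module A N''] (f : N →ₗ[A] N') (g : N' →ₗ[A] N'') (hfg : ∀ n, g (f n) = 0)
    (h : letI := charModule A W; ∀ φ : N' →ₗ[A] Chars W, (∀ n, φ (f n) = 0) →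
      ∃ ψ : N'' →ₗ[A] Chars W, ψ ∘ₗ g = φ) :
    Function.Exact (Tens.map (.id : W →ₗ[Aᵐᵒᵖ] W) f) (Tens.map (.id : W →ₗ[Aᵐᵒᵖ] W) g) := by
  let := charModule A W
  refine exact_of_chars _ _ (DFunLike.congr_fun
    (f := (Tens.map (.id : W →ₗ[Aᵐᵒᵖ] W) g).comp (Tens.map .id f)) (g := 0)
    (Tens.hom_ext fun w n => by simp [hfg])) fun χ hχ => ?_
  let φ : N' →ₗ[A] Chars W :=
    { toFun := fun n => χ.comp (Tens.mkHom.flip n)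
      map_add' := fun n n' => by ext w; simp
      map_smul' := fun a n => by
        ext w
        exact congrArg χ (Tens.mk_smul a w n).symm }
  obtain ⟨ψ, hψ⟩ := h φ fun n => by ext w; exact DFunLike.congr_fun hχ (Tens.mk w n)
  refine ⟨Tens.lift (AddMonoidHom.flip ψ.toAddMonoidHom) fun w a n => ?_,
    Tens.hom_ext fun w n => ?_⟩
  · exact (DFunLike.congr_fun (ψ.map_smul a n) w).symm
  · exact DFunLike.congr_fun (LinearMap.congr_fun hψ n) w

theorem tens_map_surjective {P P' : Type*} [AddCommGroup P] [AddCommGroup P'] [Module Aᵐᵒᵖ P]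
    [Module Aᵐᵒᵖ P'] (M : Type*) [AddCommGroup M] [Module A M] (g : P →ₗ[Aᵐᵒᵖ] P')
    (hg : Function.Surjective g) : Function.Surjective (Tens.map g (.id : M →ₗ[A] M)) := by
  intro t
  induction t using Tens.induction with
  | h0 => exact ⟨0, map_zero _⟩
  | hmk p m =>
    obtain ⟨q, rfl⟩ := hg p
    exact ⟨Tens.mk q m, by simp⟩
  | hadd s t hs ht =>
    obtain ⟨s, rfl⟩ := hs
    obtain ⟨t, rfl⟩ := ht
    exact ⟨s + t, map_add _ _ _⟩

/-- The functor `- ⊗_A M` is right exact. -/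
theorem tens_right_exact (M : Type*) [AddCommGroup M] [Module A M] {P P' P'' : Type*}
    [AddCommGroup P] [AddCommGroup P'] [AddCommGroup P''] [Module Aᵐᵒᵖ P] [Module Aᵐᵒᵖ P']
    [Module Aᵐᵒᵖ P''] (f : P →ₗ[Aᵐᵒᵖ] P') (g : P' →ₗ[Aᵐᵒᵖ] P'') (hfg : Function.Exact f g)
    (hg : Function.Surjective g) :
    Function.Exact (Tens.map f (.id : M →ₗ[A] M)) (Tens.map g (.id : M →ₗ[A] M)) := by
  let := rightCharModule A M
  refine tens_exact_right M f g (fun p => (hfg _).2 ⟨p, rfl⟩) fun φ hφ => ?_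
  have hk : LinearMap.ker g ≤ LinearMap.ker φ := fun p hp => by
    obtain ⟨q, rfl⟩ := (hfg p).1 hp
    exact hφ q
  refine ⟨(LinearMap.ker g).liftQ φ hk ∘ₗ (g.quotKerEquivOfSurjective hg).symm, ?_⟩
  ext1 p
  have : (g.quotKerEquivOfSurjective hg).symm (g p) = Submodule.Quotient.mk p := by
    rw [LinearEquiv.symm_apply_eq]; rfl
  simp [this]

/-- A left module is flat as soon as tensoring with it preserves injectivity. -/
theorem leftFlat_of_injective (M : BiMod.{u} A T)
    (h : ∀ (P P' : Type u) [AddCommGroup P] [AddCommGroup P'] [Module Aᵐᵒᵖ P] [Module Aᵐᵒᵖ P']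
      (f : P →ₗ[Aᵐᵒᵖ] P'), Function.Injective f →
        Function.Injective (Tens.map f (.id : M.carrier →ₗ[A] M.carrier))) : LeftFlat M := by
  intro P P' P'' _ _ _ _ _ _ f g hfg
  have e : Function.Exact f g.rangeRestrict := fun p => by
    rw [← hfg p, ← Subtype.coe_inj]; rfl
  have e' := tens_right_exact M.carrier f g.rangeRestrict e g.surjective_rangeRestrict
  have i := h _ _ (LinearMap.range g).subtype (Submodule.subtype_injective _)
  intro t
  rw [← e' t, ← map_eq_zero_iff _ i, Tens.map_map]
  rfl

theorem IsVonNeumannRegular.op (hA : IsVonNeumannRegular A) : IsVonNeumannRegular Aᵐᵒᵖ :=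
  fun a => by
    obtain ⟨x, hx⟩ := hA a.unop
    exact ⟨MulOpposite.op x, MulOpposite.unop_injective (by simpa [mul_assoc] using hx)⟩

theorem IsVonNeumannRegular.leftFlat (hA : IsVonNeumannRegular A) (M : BiMod.{u} A T) :
    LeftFlat M := by
  intro P P' P'' _ _ _ _ _ _ f g hfg
  let : Module Aᵐᵒᵖᵐᵒᵖ M.carrier := Module.compHom M.carrier (RingEquiv.opOp A).symm.toRingHom
  let := charModule Aᵐᵒᵖ M.carrier
  exact tens_exact_right M.carrier f g (fun p => (hfg _).2 ⟨p, rfl⟩) fun φ hφ =>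
    exists_extension_of_baer (hA.op.baer_charModule M.carrier) g φ fun p hp => by
      obtain ⟨q, rfl⟩ := (hfg p).1 hp
      exact hφ q

theorem IsVonNeumannRegular.rightFlat (hA : IsVonNeumannRegular A) (M : BiMod.{u} S A) :
    RightFlat M := by
  intro P P' P'' _ _ _ _ _ _ f g hfg
  let := charModule A M.carrier
  exact tens_exact_left M.carrier f g (fun p => (hfg _).2 ⟨p, rfl⟩) fun φ hφ =>
    exists_extension_of_baer (hA.baer_charModule M.carrier) g φ fun p hp => by
      obtain ⟨q, rfl⟩ := (hfg p).1 hp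
      exact hφ q

/-- A right `A`-module as a `(ℤ, A)`-bimodule. -/
def BiMod.ofRight (A : Type*) [Ring A] (W : Type u) [AddCommGroup W] [Module Aᵐᵒᵖ W] :
    BiMod.{u} ℤ A where
  carrier := W

theorem IsVonNeumannRegular.isPureLeftModuleMap (hA : IsVonNeumannRegular A)
    {M N : BiMod.{u} A T} (f : M ⟶ N) : IsPureLeftModuleMap f := fun W _ _ =>
  (hA.rightFlat (BiMod.ofRight A W)).isPureLeft f

end exactness

/-! ### Coflat comodules -/

section coflat

theorem injective_of_comp {M N P : BiMod.{u} S T} {f : M ⟶ N} {g : N ⟶ P}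
    (h : Function.Injective (f ≫ g).fn) : Function.Injective f.fn :=
  Function.Injective.of_comp (f := g.fn) h

/-- A right linear map of `(ℤ, A)`-bimodules as a bimodule map: additivity gives linearity
over `ℤ`. -/
def BiMod.homOfRight {M N : BiMod.{u} ℤ A} (f : M.carrier →+ N.carrier)
    (h : ∀ (a : Aᵐᵒᵖ) m, f (a • m) = a • f m) : M ⟶ N where
  fn := f
  map_lsmul s m := (congrArg f (int_smul_eq_zsmul M.left s m)).trans
    ((map_zsmul f s m).trans (int_smul_eq_zsmul N.left s (f m)).symm)
  map_rsmul := h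

/-- A right linear map as a map of `(ℤ, A)`-bimodules. -/
def BiMod.ofRightMap {W W' : Type u} [AddCommGroup W] [Module Aᵐᵒᵖ W] [AddCommGroup W']
    [Module Aᵐᵒᵖ W'] (f : W →ₗ[Aᵐᵒᵖ] W') : BiMod.ofRight A W ⟶ BiMod.ofRight A W' :=
  BiMod.homOfRight f.toAddMonoidHom f.map_smul

/-- The comodule map `f ⊗ N`. -/
def RComod.tensorMap {D : Coring B} {W W' : BiMod.{u} S E} (f : W ⟶ W') (N : RComod E D) :
    RComod.tensor W N ⟶ RComod.tensor W' N where
  hom := f ⊠ₘ 𝟙 N.mod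
  colinear := (tensor_coaction_naturality f N.rco).symm

/-- If `N` is flat and `L` is coflat, then `(- ⊗_A N) □_D L` is exact. -/
theorem LComod.IsCoflat.tensor_exact {D : Coring B} {L : LComod D T} (hL : L.IsCoflat)
    {N : RComod A D} (hN : LeftFlat N.mod) {P P' P'' : Type u} [AddCommGroup P]
    [AddCommGroup P'] [AddCommGroup P''] [Module Aᵐᵒᵖ P] [Module Aᵐᵒᵖ P'] [Module Aᵐᵒᵖ P'']
    (f : P →ₗ[Aᵐᵒᵖ] P') (g : P' →ₗ[Aᵐᵒᵖ] P'') (hf : Function.Injective f)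
    (hfg : Function.Exact f g) (hg : Function.Surjective g) :
    Function.Injective (cotensorMap (RComod.tensorMap (BiMod.ofRightMap f) N) (𝟙 L)).fn ∧
      Function.Exact (cotensorMap (RComod.tensorMap (BiMod.ofRightMap f) N) (𝟙 L)).fn
        (cotensorMap (RComod.tensorMap (BiMod.ofRightMap g) N) (𝟙 L)).fn ∧
      Function.Surjective (cotensorMap (RComod.tensorMap (BiMod.ofRightMap g) N) (𝟙 L)).fn :=
  hL _ _ _ (RComod.tensorMap (BiMod.ofRightMap f) N) (RComod.tensorMap (BiMod.ofRightMap g) N)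
    (hN.injective f hf) (tens_right_exact N.mod.carrier f g hfg hg)
    (tens_map_surjective N.mod.carrier g hg)

/-- The embedding `W ⊗ X → (W ⊗ C) □_C X`, `w ⊗ x ↦ w ⊗ x₋₁ ⊗ x₀`. -/
theorem exists_tensor_embedding {C : Coring A} (X : LComod C T) (W : BiMod.{u} S A) :
    ∃ k : W ⊠ X.mod ⟶ cotensor (RComod.tensor W C.regular.toRComod) X,
      k ≫ cotensorι (RComod.tensor W C.regular.toRComod) X =
        (𝟙 W ⊠ₘ X.lco) ≫ assocInv W C.bim X.mod := by
  have h : Balanced ((𝟙 W ⊠ₘ C.comul) ≫ assocInv W C.bim C.bim) X.lco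
      ((𝟙 W ⊠ₘ X.lco) ≫ assocInv W C.bim X.mod) := by
    rw [balanced_tensor_iff, tmap_comp, tmap_comp, ← reassoc_of% X.lcoassoc, assocHom_inv,
      Category.comp_id, Category.comp_id]
  exact ⟨_, cotensorLift_ι (RComod.tensor W C.regular.toRComod) X _ h⟩

/-- A coflat comodule over a left flat coring is flat, since `W ⊗ X` embeds naturally into
`(W ⊗ C) □_C X`, which is exact in `W`. -/
theorem LComod.IsCoflat.leftFlat {C : Coring A} (hC : LeftFlat C.bim) {X : LComod C T}
    (hX : X.IsCoflat) : LeftFlat X.mod := by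
  refine leftFlat_of_injective _ fun P P' _ _ _ _ f hf => ?_
  obtain ⟨k, hk⟩ := exists_tensor_embedding X (BiMod.ofRight A P)
  obtain ⟨k', hk'⟩ := exists_tensor_embedding X (BiMod.ofRight A P')
  let q := (LinearMap.range f).mkQ
  have hq : Function.Surjective q := Submodule.mkQ_surjective _
  have he : Function.Exact f q := LinearMap.exact_map_mkQ_range f
  let c := cotensorMap (RComod.tensorMap (BiMod.ofRightMap f) C.regular.toRComod) (𝟙 X)
  have hc : Function.Injective c.fn :=
    (hX.tensor_exact (N := C.regular.toRComod) hC f q hf he hq).1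
  have hk_inj : Function.Injective k.fn := by
    have i : Function.Injective ((𝟙 (BiMod.ofRight A P) ⊠ₘ X.lco) ≫
        assocInv (BiMod.ofRight A P) C.bim X.mod).fn :=
      (assocInv_injective _ _ _).comp (injective_of_retraction
        (i := 𝟙 (BiMod.ofRight A P) ⊠ₘ X.lco) (π := 𝟙 _ ⊠ₘ counitLeft C X.mod) (by
          rw [tmap_comp, lco_counitLeft, Category.comp_id, tmap_id]))
    rw [← hk] at i
    exact injective_of_comp i
  have e : k ≫ c = (BiMod.ofRightMap f ⊠ₘ 𝟙 X.mod) ≫ k' := by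
    refine cancel_inj (cotensorι_injective _ _) ?_
    have e₁ := cotensorMap_ι (RComod.tensorMap (BiMod.ofRightMap f) C.regular.toRComod) (𝟙 X)
    have e₂ := congrArg (· ≫ ((BiMod.ofRightMap f ⊠ₘ 𝟙 C.bim) ⊠ₘ 𝟙 X.mod)) hk
    have e₃ : ((𝟙 (BiMod.ofRight A P) ⊠ₘ X.lco) ≫ assocInv _ C.bim X.mod) ≫
        ((BiMod.ofRightMap f ⊠ₘ 𝟙 C.bim) ⊠ₘ 𝟙 X.mod) = (BiMod.ofRightMap f ⊠ₘ 𝟙 X.mod) ≫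
          (𝟙 (BiMod.ofRight A P') ⊠ₘ X.lco) ≫ assocInv _ C.bim X.mod := by
      rw [Category.assoc, ← assocInv_tmap_id, tmap_comp_assoc, tmap_comp_assoc]
      simp
    rw [Category.assoc, Category.assoc, hk']
    exact (congrArg (k ≫ ·) e₁).trans (e₂.trans e₃)
  have i : Function.Injective (k ≫ c).fn := hc.comp hk_inj
  rw [e] at i
  exact injective_of_comp i

end coflat

/-! ### Tensor products with free modules -/

section free

/-- The canonical map `N^(ι) → A^(ι) ⊗_A N`. -/
noncomputable def tensFinsuppHom (ι : Type*) (N : Type*) [AddCommGroup N] [Module A N] :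
    (ι →₀ N) →+ Tens A (ι →₀ Aᵐᵒᵖ) N :=
  Finsupp.liftAddHom fun i => Tens.mkHom (Finsupp.single i 1)

theorem tensFinsuppHom_surjective (ι : Type*) (N : Type*) [AddCommGroup N] [Module A N] :
    Function.Surjective (tensFinsuppHom (A := A) ι N) := by
  intro t
  induction t using Tens.induction with
  | h0 => exact ⟨0, map_zero _⟩
  | hmk s n =>
    induction s using Finsupp.induction_linear with
    | zero => exact ⟨0, by simp⟩
    | add s s' hs hs' =>
      obtain ⟨x, hx⟩ := hs
      obtain ⟨y, hy⟩ := hs'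
      exact ⟨x + y, by rw [map_add, hx, hy, Tens.mk_add_left]⟩
    | single i a =>
      refine ⟨Finsupp.single i (a.unop • n), ?_⟩
      have : (Finsupp.single i a : ι →₀ Aᵐᵒᵖ) =
          MulOpposite.op a.unop • Finsupp.single i (1 : Aᵐᵒᵖ) := by simp
      rw [this, Tens.mk_smul]
      simp [tensFinsuppHom]
  | hadd s t hs ht =>
    obtain ⟨x, rfl⟩ := hs
    obtain ⟨y, rfl⟩ := ht
    exact ⟨x + y, map_add _ _ _⟩

/-- The `i`-th coordinate `A^(ι) ⊗_A N → N`. -/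
noncomputable def tensFinsuppCoord {ι : Type*} (N : Type*) [AddCommGroup N] [Module A N] (i : ι) :
    Tens A (ι →₀ Aᵐᵒᵖ) N →+ N :=
  Tens.lift (AddMonoidHom.mk' (fun s => DistribSMul.toAddMonoidHom N (s i).unop)
    (fun s s' => by ext n; simp [add_smul])) (fun s a n => by simp [mul_smul])

theorem tensFinsuppCoord_hom {ι : Type*} (N : Type*) [AddCommGroup N] [Module A N] (i : ι)
    (x : ι →₀ N) : tensFinsuppCoord N i (tensFinsuppHom (A := A) ι N x) = x i := by
  classical
  refine DFunLike.congr_fun (f := (tensFinsuppCoord N i).comp (tensFinsuppHom (A := A) ι N))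
    (g := Finsupp.applyAddHom i) (Finsupp.addHom_ext fun k n => ?_) x
  by_cases h : k = i <;> simp [tensFinsuppHom, tensFinsuppCoord, h]

theorem tensFinsuppCoord_map {ι : Type*} {N N' : Type*} [AddCommGroup N] [Module A N]
    [AddCommGroup N'] [Module A N'] (i : ι) (g : N →ₗ[A] N') (t : Tens A (ι →₀ Aᵐᵒᵖ) N) :
    tensFinsuppCoord N' i (Tens.map .id g t) = g (tensFinsuppCoord N i t) :=
  DFunLike.congr_fun (f := (tensFinsuppCoord N' i).comp (Tens.map .id g))
    (g := g.toAddMonoidHom.comp (tensFinsuppCoord N i))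
    (Tens.hom_ext fun s n => by simp [tensFinsuppCoord]) t

theorem rightFlat_finsupp (ι : Type u) : RightFlat (BiMod.ofRight A (ι →₀ Aᵐᵒᵖ)) := by
  intro N N' N'' _ _ _ _ _ _ f g hfg (t : Tens A (ι →₀ Aᵐᵒᵖ) N')
  change Tens.map (M := ι →₀ Aᵐᵒᵖ) .id g t = 0 ↔
    t ∈ Set.range (Tens.map (M := ι →₀ Aᵐᵒᵖ) .id f)
  constructor
  · intro ht
    obtain ⟨x, rfl⟩ := tensFinsuppHom_surjective ι N' t
    refine (AddMonoidHom.range (Tens.map (M := ι →₀ Aᵐᵒᵖ) .id f)).sum_mem fun i _ => ?_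
    have hx : g (x i) = 0 := by
      rw [← tensFinsuppCoord_hom (A := A) N' i x, ← tensFinsuppCoord_map, ht, map_zero]
    obtain ⟨n, hn⟩ := (hfg _).1 hx
    exact ⟨Tens.mk (Finsupp.single i 1) n, by simp [hn]⟩
  · rintro ⟨s, rfl⟩
    exact DFunLike.congr_fun (f := (Tens.map (M := ι →₀ Aᵐᵒᵖ) .id g).comp (Tens.map .id f))
      (g := 0) (Tens.hom_ext fun s n => by simp [hfg.apply_apply_eq_zero]) s

end free

/-! ### Purity from coflatness -/

section pure

variable {D : Coring B}

/-- The canonical map `W ⊗_A (N □_D L) → (W ⊗_A N) □_D L`. -/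
noncomputable def tensorCotensor (W : BiMod.{u} S A) (N : RComod A D) (L : LComod D T) :
    W ⊠ cotensor N L ⟶ cotensor (RComod.tensor W N) L :=
  cotensorLift (RComod.tensor W N) L ((𝟙 W ⊠ₘ cotensorι N L) ≫ assocInv _ _ _) (by
    refine (balanced_tensor_iff N.rco L.lco _).2 ?_
    rw [tmap_comp, tmap_comp, cotensorι_eq])

theorem tensorCotensor_ι (W : BiMod.{u} S A) (N : RComod A D) (L : LComod D T) :
    tensorCotensor W N L ≫ cotensorι (RComod.tensor W N) L =
      (𝟙 W ⊠ₘ cotensorι N L) ≫ assocInv _ _ _ := cotensorLift_ι _ _ _ _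

theorem tensorCotensor_naturality {W W' : BiMod.{u} S A} (f : W ⟶ W') (N : RComod A D)
    (L : LComod D T) : tensorCotensor W N L ≫ cotensorMap (RComod.tensorMap f N) (𝟙 L) =
      (f ⊠ₘ 𝟙 _) ≫ tensorCotensor W' N L := by
  refine cancel_inj (cotensorι_injective _ _) ?_
  have e₁ := cotensorMap_ι (RComod.tensorMap f N) (𝟙 L)
  have e₂ := congrArg (· ≫ ((f ⊠ₘ 𝟙 N.mod) ⊠ₘ 𝟙 L.mod)) (tensorCotensor_ι W N L)
  have e₃ : ((𝟙 W ⊠ₘ cotensorι N L) ≫ assocInv _ _ _) ≫ ((f ⊠ₘ 𝟙 N.mod) ⊠ₘ 𝟙 L.mod) =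
      (f ⊠ₘ 𝟙 _) ≫ (𝟙 W' ⊠ₘ cotensorι N L) ≫ assocInv _ _ _ := by
    rw [Category.assoc, ← assocInv_tmap_id, tmap_comp_assoc, tmap_comp_assoc]
    simp
  rw [Category.assoc, Category.assoc, tensorCotensor_ι]
  exact (congrArg (tensorCotensor W N L ≫ ·) e₁).trans (e₂.trans e₃)

/-- Purity of `ω_{N,L}` with respect to `W` says that `W ⊗ -` commutes with the cotensor product
of `N` and `L`. -/
theorem isPureLeft_iff_bijective (W : BiMod.{u} S A) (N : RComod A D) (L : LComod D T) :
    IsPureLeft (omega N L) W.carrier ↔ Function.Bijective (tensorCotensor W N L).fn := by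
  have e := tensorCotensor_ι W N L
  have hω : ∀ (P : BiMod.{u} S T) (k : P ⟶ W ⊠ (N.mod ⊠ L.mod)),
      Balanced ((𝟙 W ⊠ₘ N.rco) ≫ assocInv W N.mod D.bim) L.lco (k ≫ assocInv _ _ _) ↔
        ∀ x, (𝟙 W ⊠ₘ omega N L).fn (k.fn x) = 0 := fun P k => by
    rw [balanced_tensor_iff]
    constructor
    · intro h x
      rw [omega, tmap_sub, sub_fn, sub_eq_zero]
      exact fn_congr h x
    · intro h
      refine BiMod.hom_ext fun x => ?_
      have := h x
      rw [omega, tmap_sub, sub_fn, sub_eq_zero] at this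
      exact this
  constructor
  · rintro ⟨hi, hx⟩
    have i : Function.Injective ((𝟙 W ⊠ₘ cotensorι N L) ≫ assocInv _ _ _).fn :=
      (assocInv_injective _ _ _).comp hi
    have hb : Balanced ((𝟙 W ⊠ₘ N.rco) ≫ assocInv W N.mod D.bim) L.lco
        ((cotensorι (RComod.tensor W N) L ≫ assocHom W N.mod L.mod) ≫ assocInv _ _ _) := by
      have h := congrArg (cotensorι (RComod.tensor W N) L ≫ ·) (assocHom_inv W N.mod L.mod)
      exact Eq.mpr (congrArg (Balanced _ _) h) (cotensorι_balanced (RComod.tensor W N) L)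
    refine ⟨?_, fun z => ?_⟩
    · rw [← e] at i
      exact injective_of_comp i
    · obtain ⟨y, hy⟩ := (hx ((assocHom W N.mod L.mod).fn
          ((cotensorι (RComod.tensor W N) L).fn z))).1
        ((hω _ (cotensorι (RComod.tensor W N) L ≫ assocHom W N.mod L.mod)).1 hb z)
      refine ⟨y, cotensorι_injective _ _ (assocHom_injective W N.mod L.mod ?_)⟩
      refine Eq.trans ?_ hy
      have e' := congrArg (· ≫ assocHom W N.mod L.mod) e
      simp only [Category.assoc, assocInv_hom, Category.comp_id] at e'
      exact fn_congr e' y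
  · rintro ⟨hi, hs⟩
    have e' := congrArg (· ≫ assocHom W N.mod L.mod) e
    simp only [Category.assoc, assocInv_hom, Category.comp_id] at e'
    have i : Function.Injective (𝟙 W ⊠ₘ cotensorι N L).fn := by
      rw [← e']
      exact (assocHom_injective W N.mod L.mod).comp ((cotensorι_injective _ _).comp hi)
    refine ⟨i, fun (x : (W ⊠ (N.mod ⊠ L.mod)).carrier) => ?_⟩
    change (𝟙 W ⊠ₘ omega N L).fn x = 0 ↔ x ∈ Set.range (𝟙 W ⊠ₘ cotensorι N L).fn
    constructor
    · intro hx
      have hb := (hω _ (kerι (𝟙 W ⊠ₘ omega N L))).2 fun x => x.2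
      obtain ⟨y, hy⟩ := hs ((cotensorLift (RComod.tensor W N) L _ hb).fn ⟨x, hx⟩)
      refine ⟨y, (fn_congr e' y).symm.trans ?_⟩
      have e₁ := fn_congr (cotensorLift_ι (RComod.tensor W N) L _ hb) ⟨x, hx⟩
      have e₂ := (congrArg (cotensorι (RComod.tensor W N) L).fn hy).trans e₁
      exact (congrArg (assocHom W N.mod L.mod).fn e₂).trans
        (fn_congr (assocInv_hom W N.mod L.mod) x)
    · rintro ⟨y, rfl⟩
      refine (hω _ (𝟙 W ⊠ₘ cotensorι N L)).1 ?_ y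
      rw [balanced_tensor_iff, tmap_comp, tmap_comp, cotensorι_eq]

theorem exists_free_presentation (W : Type u) [AddCommGroup W] [Module Aᵐᵒᵖ W] :
    ∃ (K : Type u) (_ : AddCommGroup K) (_ : Module Aᵐᵒᵖ K) (i : K →ₗ[Aᵐᵒᵖ] (W →₀ Aᵐᵒᵖ))
      (p : (W →₀ Aᵐᵒᵖ) →ₗ[Aᵐᵒᵖ] W), Function.Injective i ∧ Function.Exact i p ∧
        Function.Surjective p :=
  let p : (W →₀ Aᵐᵒᵖ) →ₗ[Aᵐᵒᵖ] W := Finsupp.linearCombination Aᵐᵒᵖ id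
  ⟨LinearMap.ker p, (LinearMap.ker p).addCommGroup, (LinearMap.ker p).module,
    (LinearMap.ker p).subtype, p, (LinearMap.ker p).subtype_injective,
    LinearMap.exact_subtype_ker_map p, Finsupp.linearCombination_id_surjective Aᵐᵒᵖ W⟩

/-- If `N` is flat over `A` and `L` is coflat, then `ω_{N,L}` is pure: `- ⊗_A (N □ L)` and
`(- ⊗_A N) □ L` are right exact and agree on free modules. -/
theorem isPureLeftModuleMap_of_coflat {N : RComod A D} {L : LComod D T} (hN : LeftFlat N.mod)
    (hL : L.IsCoflat) : IsPureLeftModuleMap (omega N L) := by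
  have free : ∀ W : Type u, Function.Bijective
      (tensorCotensor (BiMod.ofRight A (W →₀ Aᵐᵒᵖ)) N L).fn := fun W =>
    (isPureLeft_iff_bijective _ N L).1 ((rightFlat_finsupp W).isPureLeft _)
  -- A free presentation of `W`, tensored with `N` and cotensored with `L`, stays exact.
  have main : ∀ (W : Type u) [AddCommGroup W] [Module Aᵐᵒᵖ W],
      ∃ (K : Type u) (_ : AddCommGroup K) (_ : Module Aᵐᵒᵖ K)
        (i : BiMod.ofRight A K ⟶ BiMod.ofRight A (W →₀ Aᵐᵒᵖ))
        (p : BiMod.ofRight A (W →₀ Aᵐᵒᵖ) ⟶ BiMod.ofRight A W),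
        i ≫ p = 0 ∧ Function.Surjective p.fn ∧
        Function.Exact (cotensorMap (RComod.tensorMap i N) (𝟙 L)).fn
          (cotensorMap (RComod.tensorMap p N) (𝟙 L)).fn ∧
        Function.Surjective (cotensorMap (RComod.tensorMap p N) (𝟙 L)).fn := by
    intro W _ _
    obtain ⟨K, _, _, i, p, hi, he, hp⟩ := exists_free_presentation (A := A) W
    obtain ⟨-, h₁, h₂⟩ := hL.tensor_exact hN i p hi he hp
    exact ⟨K, _, _, BiMod.ofRightMap i, BiMod.ofRightMap p,
      BiMod.hom_ext fun x => he.apply_apply_eq_zero x, hp, h₁, h₂⟩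
  have surj : ∀ (W : Type u) [AddCommGroup W] [Module Aᵐᵒᵖ W], Function.Surjective
      (tensorCotensor (BiMod.ofRight A W) N L).fn := fun W _ _ => by
    obtain ⟨K, _, _, i, p, -, -, -, hs⟩ := main W
    intro z
    obtain ⟨z, rfl⟩ := hs z
    obtain ⟨y, rfl⟩ := (free W).2 z
    exact ⟨_, (fn_congr (tensorCotensor_naturality p N L) y).symm⟩
  intro W _ _
  -- Injectivity follows by a diagram chase from bijectivity for the free module and surjectivity
  -- for the kernel `K` of the presentation.
  refine (isPureLeft_iff_bijective (BiMod.ofRight A W) N L).2 ⟨?_, surj W⟩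
  obtain ⟨K, _, _, i, p, hip, hp, he, -⟩ := main W
  rw [injective_iff_map_eq_zero]
  intro x hx
  obtain ⟨y, rfl⟩ : ∃ y, (p ⊠ₘ 𝟙 (cotensor N L)).fn y = x :=
    tens_map_surjective (cotensor N L).carrier (Hom.r p) hp x
  obtain ⟨z, hz⟩ := (he _).1 ((fn_congr (tensorCotensor_naturality p N L) y).trans hx)
  obtain ⟨z, rfl⟩ := surj K z
  have hy : (i ⊠ₘ 𝟙 (cotensor N L)).fn z = y :=
    (free W).1 ((fn_congr (tensorCotensor_naturality i N L) z).symm.trans hz)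
  have h0 : (i ⊠ₘ 𝟙 (cotensor N L)) ≫ (p ⊠ₘ 𝟙 (cotensor N L)) = 0 := by
    rw [← comp_tmap_id, hip]
    exact tensor_ext fun k x => Tens.mk_zero_left _
  rw [← hy]
  exact fn_congr h0 z

end pure

/-! ### Kernels and cokernels of comodules -/

section kernels

variable {C : Coring A}

theorem injective_tmap_tensor {Z : BiMod.{u} A A} (hZ : LeftFlat Z) {K P : BiMod.{u} S A}
    (i : K ⟶ P) (hi : Function.Injective i.fn) : Function.Injective (i ⊠ₘ 𝟙 (Z ⊠ Z)).fn := by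
  have h : Function.Injective ((i ⊠ₘ 𝟙 Z) ⊠ₘ 𝟙 Z).fn := hZ.injective _ (hZ.injective _ hi)
  have e : (i ⊠ₘ 𝟙 (Z ⊠ Z)) ≫ assocInv _ _ _ = assocInv _ _ _ ≫ ((i ⊠ₘ 𝟙 Z) ⊠ₘ 𝟙 Z) :=
    assocInv_tmap_id i Z Z
  have h' : Function.Injective (assocInv _ _ _ ≫ ((i ⊠ₘ 𝟙 Z) ⊠ₘ 𝟙 Z)).fn :=
    h.comp (assocInv_injective _ _ _)
  rw [← e] at h'
  exact injective_of_comp h'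

/-- Over a left flat coring, the kernel of a comodule map is a comodule. -/
noncomputable def RComod.kernel (hC : LeftFlat C.bim) {M N : RComod S C} (f : M ⟶ N) :
    RComod S C :=
  RComod.sub M (kerι f.hom) (kerι_injective _) (hC.injective _ (kerι_injective _))
    (injective_tmap_tensor hC _ (kerι_injective _)) fun x => ((hC.isPureRight f.hom).2 _).1 (by
      have e := fn_congr f.colinear ((kerι f.hom).fn x)
      refine e.symm.trans ?_
      have : f.hom.fn ((kerι f.hom).fn x) = 0 := x.2
      rw [comp_fn, this, map_zero]
      rfl)

/-- The inclusion of the kernel. -/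
noncomputable def RComod.kernelι (hC : LeftFlat C.bim) {M N : RComod S C} (f : M ⟶ N) :
    RComod.kernel hC f ⟶ M where
  hom := kerι f.hom
  colinear := (liftInj_comp _ (hC.injective _ (kerι_injective f.hom)) _ _).symm

/-- The zero map of comodules. -/
def RComod.zeroHom (M N : RComod S C) : M ⟶ N where
  hom := 0
  colinear := by
    refine BiMod.hom_ext fun x => ?_
    have : ((0 : M.mod ⟶ N.mod) ⊠ₘ 𝟙 C.bim) = 0 := tensor_ext fun a b => Tens.mk_zero_left _
    rw [this, comp_fn, zero_fn, map_zero]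
    rfl

/-- A monomorphism has zero kernel, as the kernel is a comodule. -/
theorem RComod.injective_of_mono (hC : LeftFlat C.bim) {M N : RComod S C} (f : M ⟶ N) [Mono f] :
    Function.Injective f.hom.fn := by
  rw [injective_iff_map_eq_zero]
  intro m hm
  have h : RComod.kernelι hC f = RComod.zeroHom _ _ := by
    rw [← cancel_mono f]
    exact RComod.hom_ext (BiMod.hom_ext fun x =>
      (show f.hom.fn x.1 = 0 from x.2).trans (map_zero f.hom.fn).symm)
  exact congrArg (fun k : RComod.kernel hC f ⟶ M => k.hom.fn ⟨m, hm⟩) h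

theorem RComod.mono_of_injective {M N : RComod S C} (f : M ⟶ N)
    (hf : Function.Injective f.hom.fn) : Mono f where
  right_cancellation _ _ h := RComod.hom_ext (cancel_inj hf (congrArg RComod.Hom.hom h))

theorem RComod.epi_of_surjective {M N : RComod S C} (f : M ⟶ N)
    (hf : Function.Surjective f.hom.fn) : Epi f where
  left_cancellation g h e := RComod.hom_ext (BiMod.hom_ext fun n => by
    obtain ⟨m, rfl⟩ := hf n
    exact fn_congr (congrArg RComod.Hom.hom e) m)

theorem cancel_surj {M N P : BiMod.{u} S T} {p : M ⟶ N} (hp : Function.Surjective p.fn)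
    {f g : N ⟶ P} (h : p ≫ f = p ≫ g) : f = g :=
  BiMod.hom_ext fun n => by
    obtain ⟨m, rfl⟩ := hp n
    exact fn_congr h m

/-- A coaction passes to a quotient to which it descends. -/
def RComod.quotient (M : RComod S C) {Q : BiMod.{u} S A} (p : M.mod ⟶ Q)
    (hp : Function.Surjective p.fn) (r : Q ⟶ Q ⊠ C.bim) (h : p ≫ r = M.rco ≫ (p ⊠ₘ 𝟙 C.bim)) :
    RComod S C where
  mod := Q
  rco := r
  rcoassoc := by
    refine cancel_surj hp ?_
    have n := assoc_naturality p (𝟙 C.bim) (𝟙 C.bim)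
    rw [tmap_id] at n
    rw [reassoc_of% h, reassoc_of% h, tmap_comp_assoc, h, tmap_exchange,
      ← reassoc_of% M.rcoassoc, ← n, tmap_comp_assoc, Category.comp_id]
  rcounit := by
    refine cancel_surj hp ?_
    have := counitRight_naturality C p
    unfold counitRight at this
    rw [reassoc_of% h, this, Category.assoc, reassoc_of% M.rcounit, Category.comp_id]

/-- The cokernel of a comodule map is a comodule, since `- ⊗ C` is right exact; an epimorphism has
zero cokernel. -/
theorem RComod.surjective_of_epi {M N : RComod.{u} ℤ C} (f : M ⟶ N) [Epi f] :
    Function.Surjective f.hom.fn := by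
  let R := LinearMap.range (Hom.r f.hom)
  let Q : BiMod.{u} ℤ A := BiMod.ofRight A (N.mod.carrier ⧸ R)
  let p : N.mod ⟶ Q := BiMod.homOfRight R.mkQ.toAddMonoidHom R.mkQ.map_smul
  have hp : Function.Surjective p.fn := R.mkQ_surjective
  have hfp : ∀ m, p.fn (f.hom.fn m) = 0 := fun m =>
    (Submodule.Quotient.mk_eq_zero R).2 ⟨m, rfl⟩
  have h0 : f.hom ≫ p = 0 := BiMod.hom_ext hfp
  have hk : R ≤ LinearMap.ker (Hom.r (N.rco ≫ (p ⊠ₘ 𝟙 C.bim))) := by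
    rintro _ ⟨m, rfl⟩
    have e : f.hom ≫ N.rco ≫ (p ⊠ₘ 𝟙 C.bim) = 0 := by
      rw [reassoc_of% f.colinear, ← comp_tmap_id, h0]
      have : ((0 : M.mod ⟶ Q) ⊠ₘ 𝟙 C.bim) = 0 := tensor_ext fun a b => Tens.mk_zero_left _
      rw [this]; rfl
    exact fn_congr e m
  let r : Q ⟶ Q ⊠ C.bim := BiMod.homOfRight (R.liftQ _ hk).toAddMonoidHom (R.liftQ _ hk).map_smul
  have hr : p ≫ r = N.rco ≫ (p ⊠ₘ 𝟙 C.bim) := rfl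
  let q : N ⟶ RComod.quotient N p hp r hr := ⟨p, hr⟩
  have hq : q = RComod.zeroHom _ _ := by
    rw [← cancel_epi f]
    exact RComod.hom_ext h0
  intro n
  exact (Submodule.Quotient.mk_eq_zero R).1
    (congrArg (fun k : N ⟶ RComod.quotient N p hp r hr => k.hom.fn n) hq)

end kernels

/-! ### Equivalences given by cotensor products -/

section equivalence

variable {C : Coring A} {D : Coring B}

theorem cotensorMap_zeroHom (M M' : RComod S C) (N : LComod C T) :
    cotensorMap (RComod.zeroHom M M') (𝟙 N) = 0 := by
  refine cancel_inj (cotensorι_injective M' N) (BiMod.hom_ext fun x => ?_)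
  have : ((0 : M.mod ⟶ M'.mod) ⊠ₘ 𝟙 N.mod) = 0 := tensor_ext fun a b => Tens.mk_zero_left _
  rw [cotensorMap_ι]
  refine (congrArg (fun k : _ ⟶ M'.mod ⊠ N.mod => k.fn ((cotensorι M N).fn x)) this).trans ?_
  exact (map_zero (cotensorι M' N).fn).symm

/-- If `- □_C X` is an equivalence, then it is exact, since exactness of comodules over left flat
corings can be tested on the underlying groups. -/
theorem isCoflat_of_isEquivalence (hC : LeftFlat C.bim) (hD : LeftFlat D.bim) (X : Bicomod C D)
    [(cotensorFunctor hD X).IsEquivalence] : X.toLComod.IsCoflat := by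
  intro M M' M'' f g hf hfg hg
  have := RComod.mono_of_injective f hf
  have := RComod.epi_of_surjective g hg
  let F := cotensorFunctor hD X
  have hz : ∀ {K : RComod.{u} ℤ C} (k : K ⟶ M'), k ≫ g = RComod.zeroHom _ _ ↔
      (F.map k).hom ≫ (F.map g).hom = 0 := fun {K} k => by
    have e : (F.map (RComod.zeroHom K M'')).hom = 0 := cotensorMap_zeroHom _ _ _
    rw [← F.map_injective.eq_iff (f := F.map), F.map_comp]
    constructor
    · intro h
      exact (congrArg RComod.Hom.hom h).trans e
    · intro h
      exact RComod.hom_ext (h.trans e.symm)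
  refine ⟨RComod.injective_of_mono hD (F.map f), fun y => ⟨fun hy => ?_, ?_⟩,
    RComod.surjective_of_epi (F.map g)⟩
  · let K := RComod.kernel hD (F.map g)
    -- The kernel of `F g` is the image under `F` of some comodule, which maps to `M'` with
    -- composite zero to `M''`, and hence factors through `f`.
    let k := F.preimage ((F.objObjPreimageIso K).hom ≫ RComod.kernelι hD (F.map g))
    have hk : F.map k = (F.objObjPreimageIso K).hom ≫ RComod.kernelι hD (F.map g) :=
      F.map_preimage _
    have hkg : k ≫ g = RComod.zeroHom _ _ := (hz k).2 (by
      rw [hk]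
      exact congrArg ((F.objObjPreimageIso K).hom.hom ≫ ·) (kerι_comp (F.map g).hom))
    have hl : ∀ x, ∃ m, f.hom.fn m = k.hom.fn x := fun x =>
      (hfg _).1 (fn_congr (congrArg RComod.Hom.hom hkg) x)
    let l : F.objPreimage K ⟶ M := ⟨liftInj f.hom hf k.hom hl, by
      refine cancel_inj (i := f.hom ⊠ₘ 𝟙 C.bim) (hC.injective _ hf) ?_
      rw [Category.assoc, Category.assoc, tmap_comp, liftInj_comp, ← f.colinear,
        ← Category.assoc, liftInj_comp, k.colinear, Category.comp_id]⟩
    have hlf : l ≫ f = k := RComod.hom_ext (liftInj_comp _ hf _ _)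
    have e : RComod.kernelι hD (F.map g) = (F.objObjPreimageIso K).inv ≫ F.map l ≫ F.map f := by
      rw [← F.map_comp, hlf, hk, Iso.inv_hom_id_assoc]
    exact ⟨_, (fn_congr (congrArg RComod.Hom.hom e) ⟨y, hy⟩).symm⟩
  · rintro ⟨x, rfl⟩
    exact fn_congr ((hz f).1 (RComod.hom_ext (BiMod.hom_ext fun m =>
      hfg.apply_apply_eq_zero m))) x

/-- If `- □_D Λ` is an equivalence, then `(M □_C X) □_D Λ → (M ⊗ X) ⊗ Λ` is injective. -/
theorem iterι_injective_of_isEquivalence (hC : LeftFlat C.bim) (hD : LeftFlat D.bim)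
    (X : Bicomod C D) (Λ : Bicomod D C) [(cotensorFunctor hC Λ).IsEquivalence]
    (M : RComod.{u} ℤ C) :
    Function.Injective
      (iterι M X (cotensorPureRight_of_flat hD M X) Λ.toLComod).fn := by
  let i := cotensorRightι M X (cotensorPureRight_of_flat hD M X)
  have : Mono i := RComod.mono_of_injective i (cotensorι_injective _ _)
  have h := RComod.injective_of_mono hC ((cotensorFunctor hC Λ).map i)
  have e : iterι M X (cotensorPureRight_of_flat hD M X) Λ.toLComod =
    cotensorMap i (𝟙 Λ.toLComod) ≫ cotensorι _ _ := (cotensorMap_ι i (𝟙 Λ.toLComod)).symm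
  rw [e]
  exact (cotensorι_injective _ _).comp h

end equivalence

/-! ### Natural transformations from the identity -/

section natural

variable {C : Coring A}

/-- The underlying right comodule of a comodule with a left action, in the category on which the
functors `- □_C X` are defined. -/
def RComod.restrict (N : RComod S C) : RComod.{u} ℤ C where
  mod := BiMod.ofRight A N.mod.carrier
  rco := BiMod.homOfRight N.rco.fn N.rco.map_rsmul
  rcoassoc := BiMod.hom_ext fun x => fn_congr N.rcoassoc x
  rcounit := BiMod.hom_ext fun x => fn_congr N.rcounit x

/-- The left action of `s` as a comodule endomorphism. -/
def RComod.actHom (N : RComod S C) (s : S) : N.restrict ⟶ N.restrict where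
  hom := BiMod.homOfRight (M := BiMod.ofRight A N.mod.carrier) (N := BiMod.ofRight A N.mod.carrier)
    (DistribSMul.toAddMonoidHom N.mod.carrier s) fun a m => smul_comm (α := N.mod.carrier) s a m
  colinear := BiMod.hom_ext fun x => N.rco.map_lsmul s x

/-- The comodule map `N → W ⊗ N`, `n ↦ w ⊗ n`. -/
def RComod.insertHom (W : BiMod.{u} ℤ A) (N : RComod A C) (w : W.carrier) :
    N.restrict ⟶ RComod.tensor W N where
  hom := BiMod.homOfRight (M := BiMod.ofRight A N.mod.carrier) (N := W ⊠ N.mod)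
    (tmkHom w) fun _ _ => rfl
  colinear := by
    refine BiMod.hom_ext fun x => ?_
    have e : ∀ z : (N.mod ⊠ C.bim).carrier, (assocInv W N.mod C.bim).fn (tmk w z) =
        Tens.map (Hom.r (BiMod.homOfRight (M := BiMod.ofRight A N.mod.carrier) (N := W ⊠ N.mod)
          (tmkHom w) fun _ _ => rfl)) .id z := fun z => DFunLike.congr_fun
      (f := (assocInv W N.mod C.bim).fn.comp (tmkHom (M := W) (N := N.mod ⊠ C.bim) w))
      (addHom_ext fun _ _ => rfl) z
    exact e (N.rco.fn x)

/-- The coaction of `M` as a comodule map `M → M ⊗ C`. -/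
def RComod.rcoHom (M : RComod S C) : M ⟶ RComod.tensor M.mod C.regular.toRComod :=
  ⟨M.rco, rco_rco M⟩

/-- A natural transformation `M → (M ⊗ P) ⊗ Q` on right `C`-comodules is of the form
`m ↦ m₀ ⊗ j(m₁)`. It is determined by its component at `C`, since every `M` embeds into `M ⊗ C` by
its coaction, and `m ⊗ c` is the image of `c` under the comodule map `m ⊗ -`. -/
theorem exists_theta {P : BiMod.{u} A E} {Q : BiMod.{u} E A}
    (t : ∀ M : RComod.{u} ℤ C, M.mod ⟶ (M.mod ⊠ P) ⊠ Q)
    (ht : ∀ {M M' : RComod.{u} ℤ C} (f : M ⟶ M'),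
      f.hom ≫ t M' = t M ≫ ((f.hom ⊠ₘ 𝟙 P) ⊠ₘ 𝟙 Q)) :
    ∃ j : C.bim ⟶ P ⊠ Q, ∀ M, t M = theta M j := by
  let R := C.regular.toRComod
  -- The component of `t` at `C` is left linear by naturality with respect to the left actions.
  let J : C.bim ⟶ (C.bim ⊠ P) ⊠ Q :=
    { fn := (t R.restrict).fn
      map_lsmul := fun a x => fn_congr (ht (R.actHom a)) x
      map_rsmul := (t R.restrict).map_rsmul }
  have hT : ∀ W : BiMod.{u} ℤ A, t (RComod.tensor W R) =
      (𝟙 W ⊠ₘ J) ≫ assocInv W (C.bim ⊠ P) Q ≫ (assocInv W C.bim P ⊠ₘ 𝟙 Q) := fun W => by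
    refine tensor_ext (M := W) (N := C.bim) fun w c => ?_
    refine (fn_congr (ht (RComod.insertHom W R w)) c).trans ?_
    have h : ∀ z : ((C.bim ⊠ P) ⊠ Q).carrier,
        Tens.map (Hom.r ((RComod.insertHom W R w).hom ⊠ₘ 𝟙 P)) (.id : Q.carrier →ₗ[E] _) z =
          (assocInv W (C.bim ⊠ P) Q ≫ (assocInv W C.bim P ⊠ₘ 𝟙 Q)).fn (tmk w z) := fun z => by
      refine tensor_ind z ?_ (fun y q => ?_) (fun x y hx hy => ?_)
      · exact (map_zero _).trans (by
          have : (tmk w 0 : (W ⊠ ((C.bim ⊠ P) ⊠ Q)).carrier) = 0 := Tens.mk_zero_right _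
          rw [this, map_zero]
          rfl)
      · refine tensor_ind y ?_ (fun c p => rfl) (fun x y hx hy => ?_)
        · have h₁ : (tmk 0 q : ((C.bim ⊠ P) ⊠ Q).carrier) = 0 := Tens.mk_zero_left _
          rw [h₁]
          exact (map_zero _).trans (by
            have : (tmk w 0 : (W ⊠ ((C.bim ⊠ P) ⊠ Q)).carrier) = 0 := Tens.mk_zero_right _
            rw [this, map_zero]
            rfl)
        · rw [tmk_add_left, tmk_add_right, map_add]
          exact (map_add _ _ _).trans (congrArg₂ (· + ·) hx hy)
      · rw [tmk_add_right, map_add]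
        exact (map_add _ _ _).trans (congrArg₂ (· + ·) hx hy)
    exact h (J.fn c)
  refine ⟨J ≫ (counitLeft C P ⊠ₘ 𝟙 Q), fun M => ?_⟩
  have e₁ : M.rco ≫ (𝟙 M.mod ⊠ₘ J) ≫ assocInv M.mod (C.bim ⊠ P) Q ≫
      (assocInv M.mod C.bim P ⊠ₘ 𝟙 Q) = t M ≫ ((M.rco ⊠ₘ 𝟙 P) ⊠ₘ 𝟙 Q) :=
    (congrArg (M.rco ≫ ·) (hT M.mod)).symm.trans (ht M.rcoHom)
  have e₂ := congrArg (· ≫ ((counitRight C M.mod ⊠ₘ 𝟙 P) ⊠ₘ 𝟙 Q)) e₁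
  simp only [Category.assoc] at e₂
  rw [tmap_comp, tmap_comp, tmap_comp, rco_counitRight, assocInv_counit_mid] at e₂
  simp only [Category.comp_id, tmap_id] at e₂
  rw [← e₂, theta, assocInv_mid, id_tmap_comp, Category.assoc]

end natural

/-! ### Recovering the copairing from a natural transformation -/

section copairing

variable {C : Coring A} {D : Coring B} {X : Bicomod C D} {Λ : Bicomod D C}
  {j : C.bim ⟶ X.mod ⊠ Λ.mod}

/-- The properties of the transformation `m ↦ m₀ ⊗ j(m₁)` at `M = C` make `j` a copairing. -/
theorem isCopairing_of_theta {θ : C.bim ⟶ (C.bim ⊠ X.mod) ⊠ Λ.mod}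
    (hθ' : θ = C.comul ≫ (𝟙 C.bim ⊠ₘ j) ≫ assocInv C.bim X.mod Λ.mod)
    (h₁ : θ ≫ ((C.comul ⊠ₘ 𝟙 X.mod) ⊠ₘ 𝟙 Λ.mod) =
      θ ≫ (((𝟙 C.bim ⊠ₘ X.lco) ≫ assocInv _ _ _) ⊠ₘ 𝟙 Λ.mod))
    (h₂ : Balanced ((𝟙 C.bim ⊠ₘ X.rco) ≫ assocInv _ _ _) Λ.lco θ)
    (h₃ : θ ≫ (𝟙 (C.bim ⊠ X.mod) ⊠ₘ Λ.rco) ≫ assocInv _ _ _ = C.comul ≫ (θ ⊠ₘ 𝟙 C.bim)) :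
    IsCopairing X Λ j ∧ θ = j ≫ (X.lco ⊠ₘ 𝟙 Λ.mod) := by
  have hθ : θ ≫ (counitLeft C X.mod ⊠ₘ 𝟙 Λ.mod) = j := by
    rw [hθ', Category.assoc, Category.assoc, assocInv_counitLeft, counitLeft_naturality,
      reassoc_of% comul_counitLeft]
  have e : θ = j ≫ (X.lco ⊠ₘ 𝟙 Λ.mod) := by
    have h := congrArg (· ≫ ((counitLeft C C.bim ⊠ₘ 𝟙 X.mod) ⊠ₘ 𝟙 Λ.mod)) h₁
    simp only [Category.assoc] at h
    rw [tmap_comp, tmap_comp, tmap_comp, Category.assoc, assocInv_counitLeft,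
      counitLeft_naturality, comul_counitLeft] at h
    simp only [Category.comp_id, tmap_id] at h
    rw [comp_tmap_id, ← Category.assoc, hθ] at h
    exact h
  refine ⟨⟨?_, ?_, ?_⟩, e⟩
  · have := congrArg (· ≫ assocHom _ _ _) (hθ'.symm.trans e)
    simpa only [Category.assoc, assocInv_hom, Category.comp_id] using this
  · have h := congrArg (· ≫ ((counitLeft C X.mod ⊠ₘ 𝟙 Λ.mod) ⊠ₘ 𝟙 C.bim)) h₃
    simp only [Category.assoc] at h
    rw [tmap_comp, Category.comp_id, hθ, ← assocInv_tmap_id, ← reassoc_of% tmap_exchange,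
      reassoc_of% hθ] at h
    exact h.symm
  · have h := h₂.map (r' := X.rco) (l' := Λ.lco) (counitLeft C X.mod) (𝟙 Λ.mod)
      (by rw [Category.assoc, assocInv_counitLeft, counitLeft_naturality]) (by simp)
    rwa [hθ] at h

/-- A bijective bimodule map is an isomorphism. -/
theorem exists_inverse_of_bijective {M N : BiMod.{u} S T} (f : M ⟶ N)
    (hf : Function.Bijective f.fn) : ∃ g : N ⟶ M, f ≫ g = 𝟙 M ∧ g ≫ f = 𝟙 N := by
  have h : liftInj f hf.1 (𝟙 N) hf.2 ≫ f = 𝟙 N := liftInj_comp f hf.1 _ _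
  exact ⟨_, cancel_inj hf.1 (by rw [Category.assoc, h, Category.comp_id, Category.id_comp]), h⟩

/-- A bicolinear map with a two-sided inverse is an isomorphism of bicomodules. -/
def Bicomod.isoMk {M N : Bicomod C D} (f : M ⟶ N) (g : N.mod ⟶ M.mod)
    (h : f.hom ≫ g = 𝟙 _) (h' : g ≫ f.hom = 𝟙 _) : M ≅ N where
  hom := f
  inv := ⟨g, by
    have : M.lco = f.hom ≫ N.lco ≫ (𝟙 C.bim ⊠ₘ g) := by
      rw [reassoc_of% f.lcolinear, tmap_comp, h, Category.comp_id, tmap_id, Category.comp_id]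
    rw [this, reassoc_of% h'], by
    have : M.rco = f.hom ≫ N.rco ≫ (g ⊠ₘ 𝟙 D.bim) := by
      rw [reassoc_of% f.rcolinear, tmap_comp, h, Category.comp_id, tmap_id, Category.comp_id]
    rw [this, reassoc_of% h']⟩
  hom_inv_id := Bicomod.Hom.ext h
  inv_hom_id := Bicomod.Hom.ext h'

/-- A copairing which identifies `C` with `X □_D Λ` is an isomorphism of bicomodules. -/
theorem IsCopairing.exists_iso (hj : IsCopairing X Λ j) (h : CotensorPure X Λ)
    (hb : Function.Bijective (cotensorLift X.toRComod Λ.toLComod j hj.balanced).fn) :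
    ∃ f : cotensorBicomod X Λ h ≅ C.regular,
      f.inv.hom ≫ cotensorι X.toRComod Λ.toLComod = j := by
  obtain ⟨g, hg, hg'⟩ := exists_inverse_of_bijective _ hb
  have hι := cotensorLift_ι X.toRComod Λ.toLComod j hj.balanced
  let k : C.regular ⟶ cotensorBicomod X Λ h :=
    { hom := cotensorLift X.toRComod Λ.toLComod j hj.balanced
      lcolinear := by
        have e : cotensorLift X.toRComod Λ.toLComod j hj.balanced ≫
            (cotensorLeft X Λ.toLComod h.left).lco = C.comul ≫
              (𝟙 C.bim ⊠ₘ cotensorLift X.toRComod Λ.toLComod j hj.balanced) := by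
          refine cancel_inj (i := 𝟙 C.bim ⊠ₘ cotensorι X.toRComod Λ.toLComod) h.left.pure.1 ?_
          have e₁ := congrArg (cotensorLift X.toRComod Λ.toLComod j hj.balanced ≫ ·)
            (cotensorLeft_lco X Λ.toLComod h.left)
          refine e₁.trans ?_
          have e₂ := congrArg (· ≫ (LComod.tensor X.toLComod Λ.mod).lco) hι
          refine e₂.trans ?_
          rw [Category.assoc, tmap_comp, hι, Category.comp_id]
          exact hj.left.symm
        exact e
      rcolinear := by
        have e : cotensorLift X.toRComod Λ.toLComod j hj.balanced ≫
            (cotensorRight X.toRComod Λ h.right).rco = C.comul ≫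
              (cotensorLift X.toRComod Λ.toLComod j hj.balanced ⊠ₘ 𝟙 C.bim) := by
          refine cancel_inj (i := cotensorι X.toRComod Λ.toLComod ⊠ₘ 𝟙 C.bim) h.right.pure.1 ?_
          have e₁ := congrArg (cotensorLift X.toRComod Λ.toLComod j hj.balanced ≫ ·)
            (cotensorRight_rco X.toRComod Λ h.right)
          refine e₁.trans ?_
          have e₂ := congrArg (· ≫ (RComod.tensor X.mod Λ.toRComod).rco) hι
          refine e₂.trans ?_
          rw [Category.assoc, tmap_comp, hι, Category.comp_id]
          exact hj.right.symm
        exact e }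
  exact ⟨(Bicomod.isoMk k g hg hg').symm, hι⟩

/-- The left coaction of `X`, as a map of right modules. -/
def Bicomod.lcoRight (X : Bicomod C D) :
    X.toRComod.restrict.mod ⟶ C.regular.toRComod.restrict.mod ⊠ X.mod :=
  BiMod.homOfRight X.lco.fn X.lco.map_rsmul

theorem Bicomod.balanced_lcoRight (X : Bicomod C D) :
    Balanced C.regular.toRComod.restrict.rco X.lco X.lcoRight := by
  refine BiMod.hom_ext fun x => ?_
  have e : X.lco ≫ (C.comul ⊠ₘ 𝟙 X.mod) = X.lco ≫ (𝟙 C.bim ⊠ₘ X.lco) ≫ assocInv _ _ _ := by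
    rw [← reassoc_of% X.lcoassoc, assocHom_inv, Category.comp_id]
  exact fn_congr e x

/-- The coaction of `X` as a comodule map `X → C □_C X`. -/
noncomputable def Bicomod.lcoHom (X : Bicomod C D)
    (h : CotensorPureRight C.regular.toRComod.restrict X) :
    X.toRComod.restrict ⟶ cotensorRight C.regular.toRComod.restrict X h where
  hom := cotensorLift C.regular.toRComod.restrict X.toLComod X.lcoRight X.balanced_lcoRight
  colinear := by
      refine cancel_inj (i := cotensorι C.regular.toRComod.restrict X.toLComod ⊠ₘ 𝟙 D.bim)
        h.pure.1 ?_
      have hι := cotensorLift_ι C.regular.toRComod.restrict X.toLComod X.lcoRight X.balanced_lcoRight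
      have e₁ := congrArg (cotensorLift C.regular.toRComod.restrict X.toLComod X.lcoRight X.balanced_lcoRight ≫ ·)
        (cotensorRight_rco C.regular.toRComod.restrict X h)
      refine e₁.trans ?_
      have e₂ := congrArg (· ≫ (RComod.tensor C.regular.toRComod.restrict.mod X.toRComod).rco) hι
      refine e₂.trans ?_
      have e₃ : (X.toRComod.restrict.rco ≫
          (cotensorLift C.regular.toRComod.restrict X.toLComod X.lcoRight X.balanced_lcoRight ⊠ₘ 𝟙 D.bim)) ≫
          (cotensorι C.regular.toRComod.restrict X.toLComod ⊠ₘ 𝟙 D.bim) =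
          X.toRComod.restrict.rco ≫ (X.lcoRight ⊠ₘ 𝟙 D.bim) := by
        rw [Category.assoc, tmap_comp, hι, Category.comp_id]
      refine Eq.trans ?_ e₃.symm
      have e : X.lco ≫ (𝟙 C.bim ⊠ₘ X.rco) ≫ assocInv _ _ _ = X.rco ≫ (X.lco ⊠ₘ 𝟙 D.bim) := by
        rw [← reassoc_of% X.compat, assocHom_inv, Category.comp_id]
      exact BiMod.hom_ext fun x => fn_congr e x

theorem Bicomod.lcoHom_ι (X : Bicomod C D)
    (h : CotensorPureRight C.regular.toRComod.restrict X) :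
    (X.lcoHom h).hom ≫ cotensorι C.regular.toRComod.restrict X.toLComod = X.lcoRight :=
  cotensorLift_ι C.regular.toRComod.restrict X.toLComod X.lcoRight X.balanced_lcoRight

/-- The map `X □_D Λ → (C □_C X) □_D Λ` induced by the coaction of `X`, seen inside
`(C ⊗ X) ⊗ Λ`. -/
theorem exists_iterι_eq (h : CotensorPureRight C.regular.toRComod.restrict X)
    (z : (cotensor X.toRComod Λ.toLComod).carrier) :
    ∃ y, (iterι C.regular.toRComod.restrict X h Λ.toLComod).fn y =
      (X.lco ⊠ₘ 𝟙 Λ.mod).fn ((cotensorι X.toRComod Λ.toLComod).fn z) := by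
  let z' : (cotensor X.toRComod.restrict Λ.toLComod).carrier := ⟨z.1, z.2⟩
  refine ⟨(cotensorMap (X.lcoHom h) (𝟙 Λ.toLComod)).fn z', ?_⟩
  have e := cotensorMap_ι (X.lcoHom h) (𝟙 Λ.toLComod)
  have e₁ := congrArg (· ≫ (cotensorι C.regular.toRComod.restrict X.toLComod ⊠ₘ 𝟙 Λ.mod)) e
  have e₂ : ((X.lcoHom h).hom ⊠ₘ 𝟙 Λ.mod) ≫
      (cotensorι C.regular.toRComod.restrict X.toLComod ⊠ₘ 𝟙 Λ.mod) = X.lcoRight ⊠ₘ 𝟙 Λ.mod := by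
    have := comp_tmap_id Λ.mod (X.lcoHom h).hom
      (cotensorι C.regular.toRComod.restrict X.toLComod)
    rw [X.lcoHom_ι h] at this
    exact this.symm
  refine (fn_congr e₁ z').trans ?_
  exact fn_congr e₂ ((cotensorι X.toRComod.restrict Λ.toLComod).fn z')

/-- If the functor `- □_C X □_D Λ` is isomorphic to the identity, by an isomorphism `η`, and embeds
into `- ⊗ X ⊗ Λ`, then `X □_D Λ ≅ C`, by an isomorphism which induces `η`. -/
theorem exists_iso_of_natIso (hC : LeftFlat C.bim) (hD : LeftFlat D.bim)
    (hι : ∀ M : RComod.{u} ℤ C, Function.Injective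
      (iterι M X (cotensorPureRight_of_flat hD M X) Λ.toLComod).fn)
    (η : 𝟭 (RComod.{u} ℤ C) ≅ cotensorFunctor hD X ⋙ cotensorFunctor hC Λ)
    (h : CotensorPure X Λ) :
    ∃ f : cotensorBicomod X Λ h ≅ C.regular, ∀ M : RComod.{u} ℤ C,
      (η.hom.app M).hom ≫ iterι M X (cotensorPureRight_of_flat hD M X) Λ.toLComod =
        theta M (f.inv.hom ≫ cotensorι X.toRComod Λ.toLComod) := by
  have hp := fun M : RComod.{u} ℤ C => cotensorPureRight_of_flat hD M X
  let t : ∀ M : RComod.{u} ℤ C, M.mod ⟶ (M.mod ⊠ X.mod) ⊠ Λ.mod := fun M =>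
    (η.hom.app M).hom ≫ iterι M X (hp M) Λ.toLComod
  obtain ⟨j, hj⟩ := exists_theta t fun {M M'} f => by
    have e₁ := congrArg (fun k => RComod.Hom.hom k ≫ iterι M' X (hp M') Λ.toLComod)
      (η.hom.naturality f)
    have e₂ := congrArg ((η.hom.app M).hom ≫ ·) (iterι_map (h := hp M) (h' := hp M') X Λ.toLComod f
      ((cotensorFunctor hD X).map f) rfl)
    exact e₁.trans e₂
  let R := C.regular.toRComod.restrict
  -- The component of `t` at the underlying right comodule of `C` is the function `c ↦ c₁ ⊗ j(c₂)`.
  let θ : C.bim ⟶ (C.bim ⊠ X.mod) ⊠ Λ.mod := C.comul ≫ (𝟙 C.bim ⊠ₘ j) ≫ assocInv _ _ _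
  have hθ : ∀ x, (t R).fn x = θ.fn x := fun x => fn_congr (hj R) x
  have h₁ : t R ≫ ((R.rco ⊠ₘ 𝟙 X.mod) ⊠ₘ 𝟙 Λ.mod) =
      t R ≫ (((𝟙 R.mod ⊠ₘ X.lco) ≫ assocInv _ _ _) ⊠ₘ 𝟙 Λ.mod) :=
    congrArg ((η.hom.app R).hom ≫ ·) (iterι_left R X (hp R) Λ.toLComod)
  have h₂ : Balanced ((𝟙 R.mod ⊠ₘ X.rco) ≫ assocInv _ _ _) Λ.lco (t R) :=
    (iterι_right R X (hp R) Λ.toLComod).comp (η.hom.app R).hom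
  have h₃ : t R ≫ (𝟙 (R.mod ⊠ X.mod) ⊠ₘ Λ.rco) ≫ assocInv _ _ _ =
      R.rco ≫ (t R ⊠ₘ 𝟙 C.bim) := by
    have e₁ := congrArg ((η.hom.app R).hom ≫ ·) (iterι_colinear R X (hp R) Λ
      (cotensorPureRight_of_flat hC _ Λ))
    have e₂ := congrArg (· ≫ (iterι R X (hp R) Λ.toLComod ⊠ₘ 𝟙 C.bim)) (η.hom.app R).colinear
    refine e₁.symm.trans (e₂.trans ?_)
    exact congrArg (R.rco ≫ ·) (comp_tmap_id C.bim (η.hom.app R).hom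
      (iterι R X (hp R) Λ.toLComod)).symm
  rw [hj R] at h₁ h₂ h₃
  obtain ⟨hc, hl⟩ := isCopairing_of_theta (X := X) (Λ := Λ) (j := j) (θ := θ) rfl
    (BiMod.hom_ext fun x => fn_congr h₁ x) (BiMod.hom_ext fun x => fn_congr h₂ x)
    (BiMod.hom_ext fun x => fn_congr h₃ x)
  have hinv : ∀ y, (η.hom.app R).hom.fn ((η.inv.app R).hom.fn y) = y := fun y =>
    fn_congr (congrArg RComod.Hom.hom (η.inv_hom_id_app R)) y
  have hinv' : ∀ y, (η.inv.app R).hom.fn ((η.hom.app R).hom.fn y) = y := fun y =>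
    fn_congr (congrArg RComod.Hom.hom (η.hom_inv_id_app R)) y
  have hlift := cotensorLift_ι X.toRComod Λ.toLComod j hc.balanced
  have hb : Function.Bijective (cotensorLift X.toRComod Λ.toLComod j hc.balanced).fn := by
    constructor
    · have ht : Function.Injective θ.fn := by
        have : Function.Injective (t R).fn :=
          (hι R).comp (Function.LeftInverse.injective hinv')
        intro x y hxy
        exact this ((hθ x).trans (hxy.trans (hθ y).symm))
      rw [hl, ← hlift] at ht
      exact injective_of_comp (injective_of_comp (by rwa [Category.assoc] at ht))
    · intro z
      obtain ⟨y, hy⟩ := exists_iterι_eq (X := X) (Λ := Λ) (hp R) z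
      refine ⟨(η.inv.app R).hom.fn y, cotensorι_injective _ _ ?_⟩
      have hi : Function.Injective (X.lco ⊠ₘ 𝟙 Λ.mod).fn :=
        injective_of_retraction (π := counitLeft C X.mod ⊠ₘ 𝟙 Λ.mod) (by
          rw [tmap_comp, lco_counitLeft, Category.comp_id, tmap_id])
      refine hi ?_
      refine Eq.trans ?_ hy
      refine (fn_congr (congrArg (· ≫ (X.lco ⊠ₘ 𝟙 Λ.mod)) hlift) _).trans ?_
      refine (fn_congr hl.symm ((η.inv.app R).hom.fn y)).trans ?_
      refine (hθ _).symm.trans ?_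
      exact congrArg (iterι R X (hp R) Λ.toLComod).fn (hinv y)
  obtain ⟨f, hf⟩ := hc.exists_iso h hb
  refine ⟨f, fun M => ?_⟩
  exact (hj M).trans (congrArg (fun k => theta M k) hf.symm)

end copairing

/-! ### The compatibility of the two isomorphisms -/

section compat

variable {C : Coring A} {D : Coring B} {X : Bicomod C D} {Λ : Bicomod D C}

/-- If `v₋₁ ⊗ v₀ ⊗ j(v₁) = v₋₂ ⊗ l(v₋₁) ⊗ v₀` for all `v` in `Λ`, then applying the counit of `D` gives
`v₀ ⊗ j(v₁) = l(v₋₁) ⊗ v₀`. -/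
theorem compat_of_contract {j : C.bim ⟶ X.mod ⊠ Λ.mod} {l : D.bim ⟶ Λ.mod ⊠ X.mod}
    (h : Λ.lco ≫ ((𝟙 D.bim ⊠ₘ Λ.rco) ≫ assocInv _ _ _) ≫ (𝟙 (D.bim ⊠ Λ.mod) ⊠ₘ j) ≫
        assocInv (D.bim ⊠ Λ.mod) X.mod Λ.mod =
      Λ.lco ≫ ((D.comul ≫ (𝟙 D.bim ⊠ₘ l) ≫ assocInv _ _ _) ⊠ₘ 𝟙 Λ.mod)) :
    Λ.rco ≫ (𝟙 Λ.mod ⊠ₘ j) ≫ assocInv _ _ _ = Λ.lco ≫ (l ⊠ₘ 𝟙 Λ.mod) := by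
  have e := congrArg (· ≫ ((counitLeft D Λ.mod ⊠ₘ 𝟙 X.mod) ⊠ₘ 𝟙 Λ.mod)) h
  simp only [Category.assoc] at e
  rw [← assocInv_tmap_id, ← reassoc_of% tmap_exchange, reassoc_of% assocInv_counitLeft,
    reassoc_of% counitLeft_naturality, reassoc_of% lco_counitLeft, tmap_comp, Category.assoc,
    Category.assoc, assocInv_counitLeft, counitLeft_naturality, reassoc_of% comul_counitLeft,
    Category.comp_id] at e
  exact e

/-- If `η` and `ε` are induced by `j` and `l`, then the triangle identity `η_{N □ Λ} = ε_N □ Λ`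
relates `j` and `l`. -/
theorem compat_of_triangle (hC : LeftFlat C.bim) (hD : LeftFlat D.bim)
    {j : C.bim ⟶ X.mod ⊠ Λ.mod} {l : D.bim ⟶ Λ.mod ⊠ X.mod}
    (η : 𝟭 (RComod.{u} ℤ C) ⟶ cotensorFunctor hD X ⋙ cotensorFunctor hC Λ)
    (ε : 𝟭 (RComod.{u} ℤ D) ⟶ cotensorFunctor hC Λ ⋙ cotensorFunctor hD X)
    (hη : ∀ M : RComod.{u} ℤ C, (η.app M).hom ≫
      iterι M X (cotensorPureRight_of_flat hD M X) Λ.toLComod = theta M j)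
    (hε : ∀ N : RComod.{u} ℤ D, (ε.app N).hom ≫
      iterι N Λ (cotensorPureRight_of_flat hC N Λ) X.toLComod = theta N l)
    (h : ∀ N : RComod.{u} ℤ D,
      η.app ((cotensorFunctor hC Λ).obj N) = (cotensorFunctor hC Λ).map (ε.app N)) :
    Λ.rco ≫ (𝟙 Λ.mod ⊠ₘ j) ≫ assocInv _ _ _ = Λ.lco ≫ (l ⊠ₘ 𝟙 Λ.mod) := by
  have key : ∀ N : RComod.{u} ℤ D, cotensorι N Λ.toLComod ≫
      ((𝟙 N.mod ⊠ₘ Λ.rco) ≫ assocInv _ _ _) ≫ (𝟙 (N.mod ⊠ Λ.mod) ⊠ₘ j) ≫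
        assocInv (N.mod ⊠ Λ.mod) X.mod Λ.mod =
      cotensorι N Λ.toLComod ≫ (theta N l ⊠ₘ 𝟙 Λ.mod) := fun N => by
    have hN := cotensorPureRight_of_flat hC N Λ
    let M := cotensorRight N Λ hN
    have hM := cotensorPureRight_of_flat hD M X
    have e₁ : cotensorι N Λ.toLComod ≫ theta (RComod.tensor N.mod Λ.toRComod) j =
        theta M j ≫ ((cotensorι N Λ.toLComod ⊠ₘ 𝟙 X.mod) ⊠ₘ 𝟙 Λ.mod) :=
      theta_naturality (cotensorRightι N Λ hN) j
    have e₂ := congrArg (fun k => RComod.Hom.hom k ≫ iterι M X hM Λ.toLComod) (h N)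
    have e₃ := cotensorMap_ι (ε.app N) (𝟙 Λ.toLComod)
    have e₄ : (cotensorι M X.toLComod ⊠ₘ 𝟙 Λ.mod) ≫
        ((cotensorι N Λ.toLComod ⊠ₘ 𝟙 X.mod) ⊠ₘ 𝟙 Λ.mod) =
          iterι N Λ hN X.toLComod ⊠ₘ 𝟙 Λ.mod := (comp_tmap_id _ _ _).symm
    have e₅ : ((ε.app N).hom ⊠ₘ 𝟙 Λ.mod) ≫ (iterι N Λ hN X.toLComod ⊠ₘ 𝟙 Λ.mod) =
        theta N l ⊠ₘ 𝟙 Λ.mod := by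
      refine (comp_tmap_id _ _ _).symm.trans ?_
      exact congrArg (· ⊠ₘ 𝟙 Λ.mod) (hε N)
    have e₆ := congrArg (· ≫ ((cotensorι N Λ.toLComod ⊠ₘ 𝟙 X.mod) ⊠ₘ 𝟙 Λ.mod))
      ((hη M).symm.trans e₂)
    have e₇ := congrArg (· ≫ (iterι N Λ hN X.toLComod ⊠ₘ 𝟙 Λ.mod)) e₃
    refine e₁.trans (e₆.trans ?_)
    refine Eq.trans ?_ (e₇.trans (congrArg (cotensorι N Λ.toLComod ≫ ·) e₅))
    exact congrArg (fun k => cotensorMap (ε.app N) (𝟙 Λ.toLComod) ≫ cotensorι _ _ ≫ k) e₄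
  let R := D.regular.toRComod.restrict
  have hR := cotensorPureRight_of_flat hC R Λ
  have e₁ := congrArg ((Λ.lcoHom hR).hom ≫ ·) (key R)
  have e₂ := Λ.lcoHom_ι hR
  have e₃ : Λ.lcoRight ≫ ((𝟙 R.mod ⊠ₘ Λ.rco) ≫ assocInv _ _ _) ≫ (𝟙 (R.mod ⊠ Λ.mod) ⊠ₘ j) ≫
        assocInv (R.mod ⊠ Λ.mod) X.mod Λ.mod =
      Λ.lcoRight ≫ (theta R l ⊠ₘ 𝟙 Λ.mod) := by
    rw [← e₂]
    exact e₁
  exact compat_of_contract (BiMod.hom_ext fun x => fn_congr e₃ x)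

/-- The isomorphism `f □ g`. -/
@[simps]
noncomputable def cotensorMapIso {M M' : RComod S C} {N N' : LComod C T} (f : M ≅ M')
    (g : N ≅ N') : cotensor M N ≅ cotensor M' N' where
  hom := cotensorMap f.hom g.hom
  inv := cotensorMap f.inv g.inv
  hom_inv_id := by rw [cotensorMap_comp, f.hom_inv_id, g.hom_inv_id, cotensorMap_id]
  inv_hom_id := by rw [cotensorMap_comp, f.inv_hom_id, g.inv_hom_id, cotensorMap_id]

/-- The isomorphism of right comodules underlying an isomorphism of bicomodules. -/
@[simps]
def Bicomod.toRIso {M N : Bicomod C D} (f : M ≅ N) : M.toRComod ≅ N.toRComod where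
  hom := f.hom.toR
  inv := f.inv.toR
  hom_inv_id := RComod.hom_ext (congrArg Bicomod.Hom.hom f.hom_inv_id)
  inv_hom_id := RComod.hom_ext (congrArg Bicomod.Hom.hom f.inv_hom_id)

/-- The isomorphism of left comodules underlying an isomorphism of bicomodules. -/
@[simps]
def Bicomod.toLIso {M N : Bicomod C D} (f : M ≅ N) : M.toLComod ≅ N.toLComod where
  hom := f.hom.toL
  inv := f.inv.toL
  hom_inv_id := LComod.hom_ext (congrArg Bicomod.Hom.hom f.hom_inv_id)
  inv_hom_id := LComod.hom_ext (congrArg Bicomod.Hom.hom f.inv_hom_id)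

theorem balanced_lco (N : LComod C T) : Balanced C.comul N.lco N.lco := by
  unfold Balanced
  rw [← reassoc_of% N.lcoassoc, assocHom_inv, Category.comp_id]

theorem balanced_rco (M : RComod S C) : Balanced M.rco C.comul M.rco := (rco_rco M).symm

/-- The isomorphism `C □_C N ≅ N`, with inverse the coaction. -/
noncomputable def cotensorRegularLeftIso (N : LComod C T) :
    cotensor C.regular.toRComod N ≅ N.mod where
  hom := cotensorRegularLeft N
  inv := cotensorLift C.regular.toRComod N N.lco (balanced_lco N)
  hom_inv_id := by
    refine cancel_inj (cotensorι_injective C.regular.toRComod N) ?_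
    have h : cotensorι C.regular.toRComod N ≫ counitLeft C N.mod ≫ N.lco =
        cotensorι C.regular.toRComod N ≫ 𝟙 (C.bim ⊠ N.mod) := by
      have e₁ : counitLeft C N.mod ≫ N.lco = ((𝟙 C.bim ⊠ₘ N.lco) ≫ assocInv _ _ _) ≫
          (counitLeft C C.bim ⊠ₘ 𝟙 N.mod) := by
        rw [Category.assoc, assocInv_counitLeft, counitLeft_naturality]
      have e₂ : (C.comul ⊠ₘ 𝟙 N.mod) ≫ (counitLeft C C.bim ⊠ₘ 𝟙 N.mod) = 𝟙 _ := by
        rw [tmap_comp, comul_counitLeft, Category.comp_id, tmap_id]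
      exact (congrArg (cotensorι C.regular.toRComod N ≫ ·) e₁).trans
        ((congrArg (· ≫ (counitLeft C C.bim ⊠ₘ 𝟙 N.mod))
          (cotensorι_eq C.regular.toRComod N)).symm.trans
            (congrArg (cotensorι C.regular.toRComod N ≫ ·) e₂))
    have e := cotensorLift_ι C.regular.toRComod N N.lco (balanced_lco N)
    exact (congrArg (cotensorRegularLeft N ≫ ·) e).trans (h.trans (Category.comp_id _))
  inv_hom_id := by
    have e := cotensorLift_ι C.regular.toRComod N N.lco (balanced_lco N)
    exact (congrArg (· ≫ counitLeft C N.mod) e).trans (lco_counitLeft N)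

/-- The isomorphism `M □_C C ≅ M`, with inverse the coaction. -/
noncomputable def cotensorRegularRightIso (M : RComod S C) :
    cotensor M C.regular.toLComod ≅ M.mod where
  hom := cotensorRegularRight M
  inv := cotensorLift M C.regular.toLComod M.rco (balanced_rco M)
  hom_inv_id := by
    refine cancel_inj (cotensorι_injective M C.regular.toLComod) ?_
    have h : cotensorι M C.regular.toLComod ≫ counitRight C M.mod ≫ M.rco =
        cotensorι M C.regular.toLComod ≫ 𝟙 (M.mod ⊠ C.bim) := by
      have e₁ : counitRight C M.mod ≫ M.rco = (M.rco ⊠ₘ 𝟙 C.bim) ≫ counitRight C _ :=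
        (counitRight_naturality C M.rco).symm
      have e₂ : ((𝟙 M.mod ⊠ₘ C.comul) ≫ assocInv _ _ _) ≫ counitRight C (M.mod ⊠ C.bim) =
          𝟙 _ := by
        rw [Category.assoc, assocInv_counitRight, tmap_comp, comul_counitRight,
          Category.comp_id, tmap_id]
      exact (congrArg (cotensorι M C.regular.toLComod ≫ ·) e₁).trans
        ((congrArg (· ≫ counitRight C (M.mod ⊠ C.bim))
          (cotensorι_eq M C.regular.toLComod)).trans
            (congrArg (cotensorι M C.regular.toLComod ≫ ·) e₂))
    have e := cotensorLift_ι M C.regular.toLComod M.rco (balanced_rco M)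
    exact (congrArg (cotensorRegularRight M ≫ ·) e).trans (h.trans (Category.comp_id _))
  inv_hom_id := by
    have e := cotensorLift_ι M C.regular.toLComod M.rco (balanced_rco M)
    exact (congrArg (· ≫ counitRight C M.mod) e).trans (rco_counitRight M)

/-- The maps `v ↦ v₀ ⊗ j(v₁)` and `v ↦ l(v₋₁) ⊗ v₀` are the inverses of the two composites of the
square, seen inside `Λ ⊗ X ⊗ Λ`. If they agree, then the composites differ by the canonical
identification of the iterated cotensor products. -/
theorem squareCommutes_of_compat {hXΛ : CotensorPure X Λ} {hΛX : CotensorPure Λ X}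
    (f : cotensorBicomod X Λ hXΛ ≅ C.regular) (g : cotensorBicomod Λ X hΛX ≅ D.regular)
    (h : Λ.rco ≫ (𝟙 Λ.mod ⊠ₘ (f.inv.hom ≫ cotensorι X.toRComod Λ.toLComod)) ≫ assocInv _ _ _ =
      Λ.lco ≫ ((g.inv.hom ≫ cotensorι Λ.toRComod X.toLComod) ⊠ₘ 𝟙 Λ.mod)) :
    SquareCommutes X Λ hXΛ hΛX f.hom g.hom := by
  let P := cotensorMapIso (Bicomod.toRIso g) (Iso.refl Λ.toLComod) ≪≫
    cotensorRegularLeftIso Λ.toLComod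
  let Q := cotensorMapIso (Iso.refl Λ.toRComod) (Bicomod.toLIso f) ≪≫
    cotensorRegularRightIso Λ.toRComod
  have hP : P.inv ≫ cotensorι (cotensorBicomod Λ X hΛX).toRComod Λ.toLComod ≫
      (cotensorι Λ.toRComod X.toLComod ⊠ₘ 𝟙 Λ.mod) =
        Λ.lco ≫ ((g.inv.hom ≫ cotensorι Λ.toRComod X.toLComod) ⊠ₘ 𝟙 Λ.mod) := by
    have e₁ := cotensorMap_ι g.inv.toR (𝟙 Λ.toLComod)
    have e₂ := cotensorLift_ι D.regular.toRComod Λ.toLComod Λ.lco (balanced_lco Λ.toLComod)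
    have e₃ := congrArg (fun k => cotensorLift D.regular.toRComod Λ.toLComod Λ.lco
      (balanced_lco Λ.toLComod) ≫ k ≫ (cotensorι Λ.toRComod X.toLComod ⊠ₘ 𝟙 Λ.mod)) e₁
    have e₄ := congrArg (· ≫ (g.inv.hom ⊠ₘ 𝟙 Λ.mod) ≫
      (cotensorι Λ.toRComod X.toLComod ⊠ₘ 𝟙 Λ.mod)) e₂
    exact e₃.trans (e₄.trans (congrArg (Λ.lco ≫ ·) (comp_tmap_id _ _ _).symm))
  have hQ : Q.inv ≫ cotensorι Λ.toRComod (cotensorBicomod X Λ hXΛ).toLComod ≫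
      (𝟙 Λ.mod ⊠ₘ cotensorι X.toRComod Λ.toLComod) =
        Λ.rco ≫ (𝟙 Λ.mod ⊠ₘ (f.inv.hom ≫ cotensorι X.toRComod Λ.toLComod)) := by
    have e₁ := cotensorMap_ι (𝟙 Λ.toRComod) f.inv.toL
    have e₂ := cotensorLift_ι Λ.toRComod C.regular.toLComod Λ.rco (balanced_rco Λ.toRComod)
    have e₃ := congrArg (fun k => cotensorLift Λ.toRComod C.regular.toLComod Λ.rco
      (balanced_rco Λ.toRComod) ≫ k ≫ (𝟙 Λ.mod ⊠ₘ cotensorι X.toRComod Λ.toLComod)) e₁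
    have e₄ := congrArg (· ≫ (𝟙 Λ.mod ⊠ₘ f.inv.hom) ≫
      (𝟙 Λ.mod ⊠ₘ cotensorι X.toRComod Λ.toLComod)) e₂
    exact e₃.trans (e₄.trans (congrArg (Λ.rco ≫ ·) (id_tmap_comp _ _ _).symm))
  refine ⟨P ≪≫ Q.symm, ?_, ?_⟩
  · have e₁ := congrArg (· ≫ assocHom _ _ _) (h.trans hP.symm)
    simp only [Category.assoc] at e₁
    rw [assocInv_hom, Category.comp_id, ← hQ] at e₁
    have e₂ := congrArg (P.hom ≫ ·) e₁
    refine (Category.assoc _ _ _).trans (e₂.trans ?_)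
    exact Iso.hom_inv_id_assoc P _
  · refine (Category.assoc P.hom Q.inv Q.hom).trans ?_
    exact (congrArg (P.hom ≫ ·) Q.inv_hom_id).trans (Category.comp_id _)

/-- An equivalence given by cotensor products comes from compatible isomorphisms of bicomodules. -/
theorem IsInverseEquivalencePair.exists_iso {hC : LeftFlat C.bim} {hD : LeftFlat D.bim}
    (h : IsInverseEquivalencePair hC hD X Λ) (hXΛ : CotensorPure X Λ) (hΛX : CotensorPure Λ X) :
    ∃ (f : cotensorBicomod X Λ hXΛ ≅ C.regular) (g : cotensorBicomod Λ X hΛX ≅ D.regular),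
      SquareCommutes X Λ _ _ f.hom g.hom ∧ SquareCommutes Λ X _ _ g.hom f.hom := by
  obtain ⟨⟨η₀⟩, ⟨ε₀⟩⟩ := h
  let e := CategoryTheory.Equivalence.mk (cotensorFunctor hD X) (cotensorFunctor hC Λ) η₀ ε₀
  have : (cotensorFunctor hD X).IsEquivalence := e.isEquivalence_functor
  have : (cotensorFunctor hC Λ).IsEquivalence := e.isEquivalence_inverse
  let η : 𝟭 (RComod.{u} ℤ C) ≅ cotensorFunctor hD X ⋙ cotensorFunctor hC Λ := e.unitIso
  let ε : 𝟭 (RComod.{u} ℤ D) ≅ cotensorFunctor hC Λ ⋙ cotensorFunctor hD X := e.counitIso.symm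
  obtain ⟨f, hf⟩ := exists_iso_of_natIso hC hD
    (iterι_injective_of_isEquivalence hC hD X Λ) η hXΛ
  obtain ⟨g, hg⟩ := exists_iso_of_natIso hD hC
    (iterι_injective_of_isEquivalence hD hC Λ X) ε hΛX
  refine ⟨f, g, squareCommutes_of_compat f g ?_, squareCommutes_of_compat g f ?_⟩
  · refine compat_of_triangle hC hD η.hom ε.hom hf hg fun N => ?_
    exact e.unit_app_inverse N
  · refine compat_of_triangle hD hC ε.hom η.hom hg hf fun M => ?_
    exact e.counitInv_app_functor M

end compat

/-! ### The criteria -/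

section criteria

variable {C : Coring A} {D : Coring B} {X : Bicomod C D} {Λ : Bicomod D C}

theorem IsInverseEquivalencePair.isCoflat {hC : LeftFlat C.bim} {hD : LeftFlat D.bim}
    (h : IsInverseEquivalencePair hC hD X Λ) : X.toLComod.IsCoflat ∧ Λ.toLComod.IsCoflat := by
  obtain ⟨⟨η⟩, ⟨ε⟩⟩ := h
  let e := CategoryTheory.Equivalence.mk (cotensorFunctor hD X) (cotensorFunctor hC Λ) η ε
  have : (cotensorFunctor hD X).IsEquivalence := e.isEquivalence_functor
  have : (cotensorFunctor hC Λ).IsEquivalence := e.isEquivalence_inverse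
  exact ⟨isCoflat_of_isEquivalence hC hD X, isCoflat_of_isEquivalence hD hC Λ⟩

theorem isInverseEquivalencePair_of_assocPure (hC : LeftFlat C.bim) (hD : LeftFlat D.bim)
    {hXΛ : CotensorPure X Λ} {hΛX : CotensorPure Λ X}
    (f : cotensorBicomod X Λ hXΛ ≅ C.regular) (g : cotensorBicomod Λ X hΛX ≅ D.regular)
    (hM : ∀ M : RComod.{u} ℤ C, AssocPure M X Λ) (hN : ∀ N : RComod.{u} ℤ D, AssocPure N Λ X) :
    IsInverseEquivalencePair hC hD X Λ :=
  ⟨nonempty_natIso_of_iso hC hD f hM, (nonempty_natIso_of_iso hD hC g hN).map Iso.symm⟩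

theorem isInverseEquivalencePair_of_flat (hC : LeftFlat C.bim) (hD : LeftFlat D.bim)
    {hXΛ : CotensorPure X Λ} {hΛX : CotensorPure Λ X}
    (f : cotensorBicomod X Λ hXΛ ≅ C.regular) (g : cotensorBicomod Λ X hΛX ≅ D.regular)
    (hX : LeftFlat X.mod) (hΛ : LeftFlat Λ.mod)
    (hp : IsPureLeftModuleMap (omega X.toRComod Λ.toLComod))
    (hp' : IsPureLeftModuleMap (omega Λ.toRComod X.toLComod)) :
    IsInverseEquivalencePair hC hD X Λ :=
  isInverseEquivalencePair_of_assocPure hC hD f g (assocPure_of_flat hD hΛ hp)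
    (assocPure_of_flat hC hX hp')

end criteria

end CoringTheory

theorem proposition3p1 {A B : Type u} [Ring A] [Ring B] (C : Coring A) (D : Coring B)
    (hC : LeftFlat C.bim) (hD : LeftFlat D.bim) (X : Bicomod C D) (Λ : Bicomod D C) :
    -- the case where `C` and `D` are flat on both sides
    (∀ (hC' : RightFlat C.bim) (hD' : RightFlat D.bim),
      (IsInverseEquivalencePair hC hD X Λ ↔
        ∃ (_ : cotensorBicomod X Λ (cotensorPure_of_flat hC' hC X Λ) ≅ C.regular)
          (_ : cotensorBicomod Λ X (cotensorPure_of_flat hD' hD Λ X) ≅ D.regular),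
          (LeftFlat X.mod ∧ LeftFlat Λ.mod ∧
            IsPureLeftModuleMap (omega X.toRComod Λ.toLComod) ∧
            IsPureLeftModuleMap (omega Λ.toRComod X.toLComod)) ∨
          (X.toLComod.IsCoflat ∧ Λ.toLComod.IsCoflat)) ∧
      (IsInverseEquivalencePair hC hD X Λ →
        ∃ (f : cotensorBicomod X Λ (cotensorPure_of_flat hC' hC X Λ) ≅ C.regular)
          (g : cotensorBicomod Λ X (cotensorPure_of_flat hD' hD Λ X) ≅ D.regular),
          SquareCommutes X Λ _ _ f.hom g.hom ∧ SquareCommutes Λ X _ _ g.hom f.hom) ∧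
      (IsVonNeumannRegular A → IsVonNeumannRegular B →
        (IsInverseEquivalencePair hC hD X Λ ↔
          Nonempty (cotensorBicomod X Λ (cotensorPure_of_flat hC' hC X Λ) ≅ C.regular) ∧
          Nonempty (cotensorBicomod Λ X (cotensorPure_of_flat hD' hD Λ X) ≅ D.regular)))) ∧
    -- the case where `C` and `D` are coseparable
    (∀ (hC' : C.IsCoseparable) (hD' : D.IsCoseparable),
      (IsInverseEquivalencePair hC hD X Λ ↔
        Nonempty (cotensorBicomod X Λ (cotensorPure_of_coseparable hD' X Λ) ≅ C.regular) ∧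
        Nonempty (cotensorBicomod Λ X (cotensorPure_of_coseparable hC' Λ X) ≅ D.regular)) ∧
      (IsInverseEquivalencePair hC hD X Λ →
        ∃ (f : cotensorBicomod X Λ (cotensorPure_of_coseparable hD' X Λ) ≅ C.regular)
          (g : cotensorBicomod Λ X (cotensorPure_of_coseparable hC' Λ X) ≅ D.regular),
          SquareCommutes X Λ _ _ f.hom g.hom ∧ SquareCommutes Λ X _ _ g.hom f.hom)) := by
  refine ⟨fun hC' hD' => ⟨⟨fun h => ?_, ?_⟩, fun h => h.exists_iso _ _, fun hA hB =>
    ⟨fun h => ?_, ?_⟩⟩, fun hC' hD' => ⟨⟨fun h => ?_, ?_⟩, fun h => h.exists_iso _ _⟩⟩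
  · obtain ⟨f, g, -⟩ := h.exists_iso (cotensorPure_of_flat hC' hC X Λ)
      (cotensorPure_of_flat hD' hD Λ X)
    exact ⟨f, g, Or.inr h.isCoflat⟩
  · rintro ⟨f, g, ⟨hX, hΛ, hp, hp'⟩ | ⟨hX, hΛ⟩⟩
    · exact isInverseEquivalencePair_of_flat hC hD f g hX hΛ hp hp'
    · have hX' := hX.leftFlat hC
      have hΛ' := hΛ.leftFlat hD
      exact isInverseEquivalencePair_of_flat hC hD f g hX' hΛ'
        (isPureLeftModuleMap_of_coflat (N := X.toRComod) hX' hΛ)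
        (isPureLeftModuleMap_of_coflat (N := Λ.toRComod) hΛ' hX)
  · obtain ⟨f, g, -⟩ := h.exists_iso (cotensorPure_of_flat hC' hC X Λ)
      (cotensorPure_of_flat hD' hD Λ X)
    exact ⟨⟨f⟩, ⟨g⟩⟩
  · rintro ⟨⟨f⟩, ⟨g⟩⟩
    exact isInverseEquivalencePair_of_flat hC hD f g (hA.leftFlat _) (hB.leftFlat _)
      (hA.isPureLeftModuleMap _) (hB.isPureLeftModuleMap _)
  · obtain ⟨f, g, -⟩ := h.exists_iso (cotensorPure_of_coseparable hD' X Λ)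
      (cotensorPure_of_coseparable hC' Λ X)
    exact ⟨⟨f⟩, ⟨g⟩⟩
  · rintro ⟨⟨f⟩, ⟨g⟩⟩
    exact isInverseEquivalencePair_of_assocPure hC hD f g
      (assocPure_of_coseparable hC' hD') (assocPure_of_coseparable hD' hC')
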